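/- Fix integers $n\ge 2$ and $1\le k_1,k_2\le n-1$. For $1\le k\le n-1$ let $\mathbb{X}_k=\mathrm{Gr}(k,n)\times\mathbb{C}^\times$, with points $N|t$, where $N\subset\mathbb{C}^n$ is a $k$-dimensional subspace with Plücker coordinates $P_J(N)$; for a set $J$ of integers, $P_J$ means $P_{J'}$ with $J'\subset[n]$ the set of residues of $J$ modulo $n$, and $P_J=0$ if $|J'|\ne k$. Write $[a,b]=\{a,a+1,\dots,b\}$ and $[b]=[1,b]$. *The matrix $g$.* For an indeterminate $\lambda$, $g(N|t)$ is the $n\times n$ matrix over $\mathbb{C}[\lambda]$ with $$g(N|t)_{ij}=c_{ij}\,\frac{P_{[j-k+1,j-1]\cup\{i\}}(N)}{P_{[j-k,j-1]}(N)},\qquad c_{ij}=\begin{cases}1& j\le k\\ t& j>k,\ i\ge j\\ \lambda& j>k,\ i<j,\end{cases}$$ defined when all $P_{[j-k,j-1]}(N)$, $1\le j\le n$, are nonzero. *Crystal structure.* For $i\in\mathbb{Z}/n\mathbb{Z}$ define rational functions on $\mathbb{X}_k$ by $$\varphi_i(N|t)=t^{-\delta_{i,0}}\frac{P_{[i-k+1,i-1]\cup\{i+1\}}(N)}{P_{[i-k+1,i]}(N)},\qquad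 \varepsilon_i(N|t)=t^{-\delta_{i,k}}\frac{P_{[i-k+1,i-1]\cup\{i+1\}}(N)\,P_{[i-k+1,i]}(N)}{P_{[i-k,i-1]}(N)\,P_{[i-k+2,i+1]}(N)},$$ and, for $c\in\mathbb{C}^\times$, $e_i^c(N|t)=(x_i(a)\cdot N)|t$, where $x_i(a)=\mathrm{Id}+aE_{i,i+1}$ for $1\le i\le n-1$, $x_0(a)=\mathrm{Id}+aE_{n,1}$, and $a=\frac{c-1}{\varphi_i(N|t)}$ if $i\ne0$, $a=\frac{(-1)^{k-1}}{t}\frac{c-1}{\varphi_0(N|t)}$ if $i=0$. On $\mathbb{X}_{k_1}\times\mathbb{X}_{k_2}$ put $e_i^c(u,v)=(e_i^{c_1}(u),e_i^{c_2}(v))$ with $$c_1=\frac{c\,\varepsilon_i(u)+\varphi_i(v)}{\varepsilon_i(u)+\varphi_i(v)},\qquad c_2=\frac{\varepsilon_i(u)+\varphi_i(v)}{\varepsilon_i(u)+c^{-1}\varphi_i(v)}.$$ *Geometric $R$-matrix.* For an $n\times n$ matrix $A$ over $\mathbb{C}[\lambda]$ and $z\in\mathbb{C}^\times$ let $\pi^k_z(A)=N|z$,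 where $N$ is the span of the first $k$ columns of $A|_{\lambda=(-1)^{k-1}z}$ (defined if these have rank $k$), and let $\mathrm{fl}(A)_{ij}=A_{n-j+1,n-i+1}$. Put $S(N|t)=\pi^k_t(\mathrm{fl}(g(N|t)))$ on $\mathbb{X}_k$, and $\Psi(M|s,N|t)=\pi^{k}_t(g(M|s)g(N|t))$ for $(M|s,N|t)\in\mathbb{X}_\ell\times\mathbb{X}_k$. The geometric $R$-matrix is the rational map $R:\mathbb{X}_{k_1}\times\mathbb{X}_{k_2}\to\mathbb{X}_{k_2}\times\mathbb{X}_{k_1}$, $R(u,v)=\bigl(\Psi(u,v),\,S(\Psi(S(v),S(u)))\bigr)$. **Proposition.** Let $k=\min(k_1,k_2)$ and let $E(u,v)=\Delta_{[n-k+1,n],[k]}(g(u)g(v))$ be the minor of $g(u)g(v)$ with rows $[n-k+1,n]$ and columns $[k]$. This minor does not depend on $\lambda$ whenever $g(u)$ and $g(v)$ are defined, and $E:\mathbb{X}_{k_1}\times\mathbb{X}_{k_2}\to\mathbb{C}$ is a geometric coenergy function. That is, $E$ is a rational function and, for every $c\in\mathbb{C}^\times$, the following identities of rational functions of $(u,v)\in\mathbb{X}_{k_1}\times\mathbb{X}_{k_2}$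 hold (both sides are defined and equal on a nonempty Zariski open set): 1. $E(e_i^c(u,v))=E(u,v)$ for $i=1,\dots,n-1$; 2. with $R(u,v)=(v',u')$, $$E(e_0^c(u,v))=E(u,v)\left(\frac{\varepsilon_0(u)+c^{-1}\varphi_0(v)}{\varepsilon_0(u)+\varphi_0(v)}\right)\left(\frac{c\,\varepsilon_0(v')+\varphi_0(u')}{\varepsilon_0(v')+\varphi_0(u')}\right).$$ -/

import Mathlib

open Polynomial

namespace GeomCrystal

noncomputable section

/-! ## Index conventions

Rows and columns are indexed by `Fin n`; the element `a : Fin n` stands for the integer `a + 1` of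
`[n] = {1, …, n}`. Finite sets of integers are reduced modulo `n` to subsets of `[n]`. -/

/-- The set of residues (in `[n]`) of the elements of `I` modulo `n`, as a subset of `Fin n`. -/
def resid (n : ℕ) (I : Finset ℤ) : Finset (Fin n) :=
  Finset.univ.filter fun a => ∃ m ∈ I, m ≡ (a : ℤ) + 1 [ZMOD n]

/-- The minor `Δ_{I,J}(A)`: rows in `I`, columns in `J`, both in increasing order. -/
def minor {n : ℕ} {R : Type*} [CommRing R] (I J : Finset (Fin n)) (A : Matrix (Fin n) (Fin n) R) :
    R :=
  if h : J.card = I.card then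
    (A.submatrix (I.orderEmbOfFin rfl) (J.orderEmbOfFin h)).det
  else 0

/-- The maximal minor of an `n × k` matrix using the rows in `I`; it is `0` if `|I| ≠ k`. -/
def maxMinor {n k : ℕ} (A : Matrix (Fin n) (Fin k) ℂ) (I : Finset (Fin n)) : ℂ :=
  if h : I.card = k then (A.submatrix (I.orderEmbOfFin h) id).det else 0

/-! ## The variety `𝕏_k = Gr(k,n) × ℂˣ` -/

/-- A point `N|t` of `𝕏_k = Gr(k,n) × ℂˣ`: a `k`-dimensional subspace `N` of `ℂⁿ` and `t ∈ ℂˣ`. -/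
structure XX (n k : ℕ) where
  N : Submodule ℂ (Fin n → ℂ)
  finrank_N : Module.finrank ℂ N = k
  t : ℂˣ

/-- The `n × k` matrix `A` represents (the subspace part of) `x`: its columns span `N`. -/
def XX.IsRep {n k : ℕ} (x : XX n k) (A : Matrix (Fin n) (Fin k) ℂ) : Prop :=
  Submodule.span ℂ (Set.range A.col) = x.N

/-- A chosen matrix representative of the subspace. -/
def XX.rep {n k : ℕ} (x : XX n k) : Matrix (Fin n) (Fin k) ℂ :=
  Matrix.of fun i j => (Module.finBasisOfFinrankEq ℂ x.N x.finrank_N j : Fin n → ℂ) i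

/-- The Plücker coordinate `P_I(N)`, for a finite set `I` of integers (reduced modulo `n`; the value
is `0` if there are not exactly `k` residues). It is defined up to a common nonzero factor, see
`XX.maxMinor_of_isRep`, and is used below only in ratios of degree `0` and in conditions
`P_I(N) ≠ 0`. -/
def XX.P {n k : ℕ} (x : XX n k) (I : Finset ℤ) : ℂ :=
  maxMinor x.rep (resid n I)

theorem XX.isRep_rep {n k : ℕ} (x : XX n k) : x.IsRep x.rep := by
  have hcol : Set.range x.rep.col
      = x.N.subtype '' Set.range (Module.finBasisOfFinrankEq ℂ x.N x.finrank_N) := by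
    rw [← Set.range_comp]
    rfl
  rw [XX.IsRep, hcol, Submodule.span_image, Module.Basis.span_eq, Submodule.map_top,
    Submodule.range_subtype]

/-- Two matrix representatives of a point have proportional vectors of maximal minors. -/
theorem XX.maxMinor_of_isRep {n k : ℕ} (x : XX n k) (A : Matrix (Fin n) (Fin k) ℂ)
    (hA : x.IsRep A) :
    ∃ r : ℂ, r ≠ 0 ∧ ∀ I : Finset (Fin n), maxMinor A I = r * maxMinor x.rep I := by
  have key : ∀ B C : Matrix (Fin n) (Fin k) ℂ, x.IsRep B → x.IsRep C →
      ∃ M : Matrix (Fin k) (Fin k) ℂ, C = B * M := by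
    intro B C hB hC
    have h : ∀ j, ∃ c : Fin k → ℂ, ∑ l, c l • B.col l = C.col j := by
      intro j
      rw [← Submodule.mem_span_range_iff_exists_fun, hB, ← hC]
      exact Submodule.subset_span ⟨j, rfl⟩
    choose c hc using h
    refine ⟨Matrix.of fun l j => c j l, ?_⟩
    ext i j
    have := congrFun (hc j) i
    simp only [Finset.sum_apply, Pi.smul_apply, smul_eq_mul, Matrix.col_apply] at this
    rw [Matrix.mul_apply, ← this]
    exact Finset.sum_congr rfl fun l _ => by rw [Matrix.of_apply, mul_comm]
  obtain ⟨M, hM⟩ := key _ _ x.isRep_rep hA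
  obtain ⟨M', hM'⟩ := key _ _ hA x.isRep_rep
  have hinj : Function.Injective x.rep.mulVec := by
    rw [Matrix.mulVec_injective_iff]
    have := (Module.finBasisOfFinrankEq ℂ x.N x.finrank_N).linearIndependent.map'
      x.N.subtype (Submodule.ker_subtype _)
    exact this
  have h1 : M * M' = 1 := by
    have h2 : x.rep * (M * M') = x.rep * (1 : Matrix (Fin k) (Fin k) ℂ) := by
      rw [← Matrix.mul_assoc, ← hM, ← hM', Matrix.mul_one]
    ext i j
    have h3 : x.rep.mulVec ((M * M').col j) = x.rep.mulVec ((1 : Matrix _ _ ℂ).col j) := by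
      funext a
      exact congrFun (congrFun h2 a) j
    exact congrFun (hinj h3) i
  refine ⟨M.det, fun h0 => ?_, fun I => ?_⟩
  · have := congrArg Matrix.det h1
    rw [Matrix.det_mul, h0, zero_mul, Matrix.det_one] at this
    exact zero_ne_one this
  · unfold maxMinor
    split_ifs with h
    · rw [hM, mul_comm, ← Matrix.det_mul]
      congr 1
    · simp

/-! ## Rational functions and maps

A rational map is given as a partial function (a function with values in `Part`); every division
in a formula is guarded by the condition that the denominator does not vanish. -/

/-- Guarded division. -/
def pdiv (a b : ℂ) : Part ℂ := ⟨b ≠ 0, fun _ => a / b⟩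

/-- A complex number as an element of `ℂˣ`, when it is nonzero. -/
def toUnit (a : ℂ) : Part ℂˣ := ⟨a ≠ 0, fun h => Units.mk0 a h⟩

/-- The point `N|t`, when `N` has dimension `k`. -/
def mkPt {n : ℕ} (k : ℕ) (N : Submodule ℂ (Fin n → ℂ)) (t : ℂˣ) : Part (XX n k) :=
  ⟨Module.finrank ℂ N = k, fun h => ⟨N, h, t⟩⟩

/-- Coordinates on pairs of represented points: the entries of the first matrix, the first torus
coordinate, the entries of the second matrix, the second torus coordinate. -/
abbrev Coord (n k₁ k₂ : ℕ) : Type :=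
  ((Fin n × Fin k₁) ⊕ Unit) ⊕ ((Fin n × Fin k₂) ⊕ Unit)

/-- The coordinates of `(M|s, N|t)` with respect to matrix representatives `A` of `M`, `B` of `N`. -/
def coords {n k₁ k₂ : ℕ} (A : Matrix (Fin n) (Fin k₁) ℂ) (s : ℂˣ)
    (B : Matrix (Fin n) (Fin k₂) ℂ) (t : ℂˣ) : Coord n k₁ k₂ → ℂ :=
  Sum.elim (Sum.elim (fun p => A p.1 p.2) fun _ => (s : ℂ))
    (Sum.elim (fun p => B p.1 p.2) fun _ => (t : ℂ))

/-- `p` holds on a nonempty (hence dense) Zariski open subset of `𝕏_{k₁} × 𝕏_{k₂}`: wherever a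
suitable nonzero polynomial in the entries of matrix representatives and the torus coordinates does
not vanish. -/
def Generically {n k₁ k₂ : ℕ} (p : XX n k₁ → XX n k₂ → Prop) : Prop :=
  ∃ F : MvPolynomial (Coord n k₁ k₂) ℂ, F ≠ 0 ∧
    ∀ (u : XX n k₁) (v : XX n k₂) (A : Matrix (Fin n) (Fin k₁) ℂ) (B : Matrix (Fin n) (Fin k₂) ℂ),
      u.IsRep A → v.IsRep B → MvPolynomial.eval (coords A u.t B v.t) F ≠ 0 → p u v

/-- Equality of rational functions on `𝕏_{k₁} × 𝕏_{k₂}`: on a dense Zariski open subset both are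
defined and take the same value. -/
def RatEq {n k₁ k₂ : ℕ} (f g : XX n k₁ → XX n k₂ → Part ℂ) : Prop :=
  Generically fun u v => ∃ z : ℂ, z ∈ f u v ∧ z ∈ g u v

/-- The partial function `f` is a rational function on `𝕏_{k₁} × 𝕏_{k₂}`: in the coordinates above,
it is a ratio of two polynomials wherever the second one does not vanish. -/
def IsRational {n k₁ k₂ : ℕ} (f : XX n k₁ → XX n k₂ → Part ℂ) : Prop :=
  ∃ p q : MvPolynomial (Coord n k₁ k₂) ℂ, q ≠ 0 ∧
    ∀ (u : XX n k₁) (v : XX n k₂) (A : Matrix (Fin n) (Fin k₁) ℂ) (B : Matrix (Fin n) (Fin k₂) ℂ),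
      u.IsRep A → v.IsRep B → MvPolynomial.eval (coords A u.t B v.t) q ≠ 0 →
        MvPolynomial.eval (coords A u.t B v.t) p / MvPolynomial.eval (coords A u.t B v.t) q ∈ f u v

/-! ## The geometric crystal structure on `𝕏_k`

The index `i` is an integer; everything depends only on its class modulo `n`. -/

/-- `φ_i(N|t) = t^{-δ_{i,0}} P_{[i-k+1,i-1] ∪ {i+1}}(N) / P_{[i-k+1,i]}(N)`. -/
def phi {n k : ℕ} (i : ℤ) (x : XX n k) : Part ℂ :=
  pdiv ((if i ≡ 0 [ZMOD n] then (x.t : ℂ)⁻¹ else 1) *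
      x.P (Finset.Icc (i - k + 1) (i - 1) ∪ {i + 1}))
    (x.P (Finset.Icc (i - k + 1) i))

/-- `ε_i(N|t) = t^{-δ_{i,k}} P_{[i-k+1,i-1] ∪ {i+1}}(N) P_{[i-k+1,i]}(N) /
(P_{[i-k,i-1]}(N) P_{[i-k+2,i+1]}(N))`. -/
def eps {n k : ℕ} (i : ℤ) (x : XX n k) : Part ℂ :=
  pdiv ((if i ≡ k [ZMOD n] then (x.t : ℂ)⁻¹ else 1) *
      (x.P (Finset.Icc (i - k + 1) (i - 1) ∪ {i + 1}) * x.P (Finset.Icc (i - k + 1) i)))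
    (x.P (Finset.Icc (i - k) (i - 1)) * x.P (Finset.Icc (i - k + 2) (i + 1)))

/-- `x_i(a) = Id + a E_{i,i+1}`, with indices modulo `n`; in particular `x_0(a) = Id + a E_{n,1}`. -/
def xmat (n : ℕ) (i : ℤ) (a : ℂ) : Matrix (Fin n) (Fin n) ℂ :=
  1 + Matrix.of fun p q : Fin n =>
    if i ≡ (p : ℤ) + 1 [ZMOD n] ∧ i + 1 ≡ (q : ℤ) + 1 [ZMOD n] then a else 0

/-- The geometric crystal operator on `𝕏_k`: `e_i^c(N|t) = N'|t`, where `N' = x_i((c-1)/φ_i) N` for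
`i ≠ 0`, and `N' = x_0((-1)^{k-1} t⁻¹ (c-1)/φ_0) N` for `i = 0`. -/
def eOp {n k : ℕ} (i : ℤ) (c : ℂˣ) (x : XX n k) : Part (XX n k) := do
  let f ← phi i x
  let a ← pdiv ((c : ℂ) - 1) f
  mkPt k (x.N.map (xmat n i
    (if i ≡ 0 [ZMOD n] then (-1) ^ (k - 1) * (x.t : ℂ)⁻¹ * a else a)).mulVecLin) x.t

/-- The geometric crystal operator on the product `𝕏_{k₁} × 𝕏_{k₂}`:
`e_i^c(u,v) = (e_i^{c₁}(u), e_i^{c₂}(v))`, where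
`c₁ = (c ε_i(u) + φ_i(v)) / (ε_i(u) + φ_i(v))` and
`c₂ = (ε_i(u) + φ_i(v)) / (ε_i(u) + c⁻¹ φ_i(v))`. -/
def eProd {n k₁ k₂ : ℕ} (i : ℤ) (c : ℂˣ) (u : XX n k₁) (v : XX n k₂) :
    Part (XX n k₁ × XX n k₂) := do
  let a ← eps i u
  let b ← phi i v
  let z₁ ← pdiv ((c : ℂ) * a + b) (a + b)
  let c₁ ← toUnit z₁
  let z₂ ← pdiv (a + b) (a + (c : ℂ)⁻¹ * b)
  let c₂ ← toUnit z₂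
  let u' ← eOp i c₁ u
  let v' ← eOp i c₂ v
  return (u', v')

/-! ## The matrix `g(N|t)` and the geometric `R`-matrix

Folded matrices have entries in `ℂ[λ]`; the loop parameter `λ` is `Polynomial.X`. -/

/-- `g(N|t)_{ij} = c_{ij} P_{[j-k+1,j-1] ∪ {i}}(N) / P_{[j-k,j-1]}(N)`, with `c_{ij} = 1` if `j ≤ k`,
`c_{ij} = t` if `j > k` and `i ≥ j`, and `c_{ij} = λ` if `j > k` and `i < j`. It is defined when all
`P_{[j-k,j-1]}(N)` are nonzero. -/
def gMat {n k : ℕ} (x : XX n k) : Part (Matrix (Fin n) (Fin n) ℂ[X]) :=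
  ⟨∀ j : ℤ, 1 ≤ j → j ≤ n → x.P (Finset.Icc (j - k) (j - 1)) ≠ 0, fun _ =>
    Matrix.of fun i₀ j₀ : Fin n =>
      let i : ℤ := (i₀ : ℤ) + 1
      let j : ℤ := (j₀ : ℤ) + 1
      (if j ≤ k then 1 else if j ≤ i then C (x.t : ℂ) else X) *
        C (x.P (Finset.Icc (j - k + 1) (j - 1) ∪ {i}) / x.P (Finset.Icc (j - k) (j - 1)))⟩

/-- The evaluation-projection `π^k_z(A) = N|z`, where `N` is spanned by the first `k` columns of `A`
evaluated at `λ = (-1)^{k-1} z`; it is defined when these columns have full rank. -/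
def evalProj {n : ℕ} (k : ℕ) (z : ℂˣ) (A : Matrix (Fin n) (Fin n) ℂ[X]) : Part (XX n k) :=
  mkPt k (Submodule.span ℂ ((A.map (Polynomial.eval ((-1) ^ (k - 1) * (z : ℂ)))).col ''
    {j : Fin n | (j : ℕ) < k})) z

/-- The flip map `fl(A)_{ij} = A_{n-j+1,n-i+1}`. -/
def flip {n : ℕ} (A : Matrix (Fin n) (Fin n) ℂ[X]) : Matrix (Fin n) (Fin n) ℂ[X] :=
  Matrix.of fun i j => A (Fin.rev j) (Fin.rev i)

/-- The geometric Schützenberger involution `S(N|t) = π^k_t(fl(g(N|t)))`. -/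
def schutz {n k : ℕ} (x : XX n k) : Part (XX n k) := do
  let A ← gMat x
  evalProj k x.t (flip A)

/-- `Ψ(M|s, N|t) = π^k_t(g(M|s) g(N|t))`, a map `𝕏_ℓ × 𝕏_k → 𝕏_k`. -/
def Psi {n l k : ℕ} (u : XX n l) (v : XX n k) : Part (XX n k) := do
  let A ← gMat u
  let B ← gMat v
  evalProj k v.t (A * B)

/-- The geometric `R`-matrix `𝕏_ℓ × 𝕏_k → 𝕏_k × 𝕏_ℓ`: `R(u,v) = (Ψ(u,v), S(Ψ(S(v),S(u))))`. -/
def geomR {n l k : ℕ} (u : XX n l) (v : XX n k) : Part (XX n k × XX n l) := do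
  let v' ← Psi u v
  let Sv ← schutz v
  let Su ← schutz u
  let w ← Psi Sv Su
  let u' ← schutz w
  return (v', u')

/-! ## Geometric coenergy functions -/

/-- The right-hand side of the `e_0`-condition: with `R(u,v) = (v',u')`,
`H(u,v) · (ε_0(u) + c⁻¹ φ_0(v)) / (ε_0(u) + φ_0(v)) · (c ε_0(v') + φ_0(u')) / (ε_0(v') + φ_0(u'))`. -/
def coenergyRHS {n k₁ k₂ : ℕ} (H : XX n k₁ → XX n k₂ → Part ℂ) (c : ℂˣ)
    (u : XX n k₁) (v : XX n k₂) : Part ℂ := do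
  let h ← H u v
  let r ← geomR u v
  let a ← eps 0 u
  let b ← phi 0 v
  let a' ← eps 0 r.1
  let b' ← phi 0 r.2
  let q₁ ← pdiv (a + (c : ℂ)⁻¹ * b) (a + b)
  let q₂ ← pdiv ((c : ℂ) * a' + b') (a' + b')
  return h * q₁ * q₂

/-- The partial function `H(e_i^c(u,v))` of `(u,v)`. -/
def compE {n k₁ k₂ : ℕ} (H : XX n k₁ → XX n k₂ → Part ℂ) (i : ℤ) (c : ℂˣ)
    (u : XX n k₁) (v : XX n k₂) : Part ℂ := do
  let w ← eProd i c u v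
  H w.1 w.2

/-- `H` is a geometric coenergy function on `𝕏_{k₁} × 𝕏_{k₂}`: a rational function with
`H ∘ e_i^c = H` for `i = 1, …, n-1`, and with the prescribed behaviour under `e_0^c`. -/
structure IsGeomCoenergy {n k₁ k₂ : ℕ} (H : XX n k₁ → XX n k₂ → Part ℂ) : Prop where
  rational : IsRational H
  comp_e : ∀ i : ℤ, 1 ≤ i → i ≤ (n : ℤ) - 1 → ∀ c : ℂˣ, RatEq (compE H i c) H
  comp_e_zero : ∀ c : ℂˣ, RatEq (compE H 0 c) (coenergyRHS H c)

/-- The minor `Δ_{[n-k+1,n],[k]}(A)`. -/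
def cornerMinor {n : ℕ} (k : ℕ) (A : Matrix (Fin n) (Fin n) ℂ[X]) : ℂ[X] :=
  minor (resid n (Finset.Icc ((n : ℤ) - k + 1) n)) (resid n (Finset.Icc 1 (k : ℤ))) A

/-- `E(u,v) = Δ_{[n-k+1,n],[k]}(g(u)g(v))` with `k = min(k₁,k₂)`, as a complex number: the minor is a
polynomial in `λ`, and `E` is its constant coefficient. (The minor is in fact constant in `λ`; this
is asserted along with the coenergy property.) -/
def coenergyE {n k₁ k₂ : ℕ} (u : XX n k₁) (v : XX n k₂) : Part ℂ := do
  let A ← gMat u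
  let B ← gMat v
  return (cornerMinor (min k₁ k₂) (A * B)).coeff 0

end

end GeomCrystal

namespace GeomCrystal

/-! ### Maximal minors -/

section MaxMinor

variable {n : ℕ}

/-! Everything is read off from the matrix g. Unfolded to an n-periodic matrix on ℤ × ℤ, g(N|t) is a
band of width n - k with 1's on its lowest diagonal, and at the special value λ₀ = (-1)^(k-1) t its
columns span N. These properties characterise it: a matrix of this shape whose value at λ₀ has its
columns in N is g(N|t) (`Loop.eq_gam`). Statements about points thus become identities between
matrices.

Crystal operators. φ_i and ε_i are the quotients of an entry just below the diagonal by the two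
adjacent diagonal entries, and g(e_i^c x) = x_i((c-1)/φ_i) g(x) x_i((c⁻¹-1)/ε_i), where x_0(a) is
read as the loop matrix with a/λ in the corner (`exists_eOp_eq`). On a product, c₁ and c₂ make the
two inner factors cancel, so g(u)g(v) is merely multiplied by one x_i on each side
(`exists_eProd_eq`). For i ≠ 0 these are row and column operations which preserve the corner minor
(`cornerVal_xm_mul`).

R-matrix. Let λ₁, λ₂ be the special values of u, v. The space of v' = Ψ(u,v) is the column space of
g(u)g(v) at λ₂, so g(v') divides g(u)g(v) on the left. The quotient is again banded and drops rank
at λ₁, hence equals g(u') for some u'; flipping the identity shows that u' is the second component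
of R(u,v). Thus g(u)g(v) = g(v')g(u') (`exists_geomR_eq`).

The case i = 0. Since k is at most k₁ and k₂, the corner minor does not involve λ (`corner_fold`),
so λ may be set to the special value of the factor with the smaller k. There the product has rank k,
and the corner minor is, up to sign, a Plücker coordinate of the column space times one of the
flipped row space. Multiplication by x_0(a) scales such a coordinate by 1 + a φ_0
(`cornerVal_xm_zero`). The two spaces belong to u and S(u') if k₁ ≤ k₂, to v' and S(v) if k₂ ≤ k₁,
and φ_0 ∘ S = ε_0. Comparing diagonal and subdiagonal entries of g(u)g(v) = g(v')g(u') turns the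
resulting scalars into the required factor.

Genericity. Each condition needed is the nonvanishing of a function regular off the hypersurface
`disc`, so it is enough to exhibit one point for each. -/

theorem maxMinor_of_card_ne {k : ℕ} (M : Matrix (Fin n) (Fin k) ℂ) {I : Finset (Fin n)}
    (h : I.card ≠ k) : maxMinor M I = 0 := by
  rw [maxMinor, dif_neg h]

theorem maxMinor_of_card {k : ℕ} (M : Matrix (Fin n) (Fin k) ℂ) {I : Finset (Fin n)}
    (h : I.card = k) : maxMinor M I = (M.submatrix (I.orderEmbOfFin h) id).det := by
  rw [maxMinor, dif_pos h]

theorem maxMinor_ne_zero_card {k : ℕ} {M : Matrix (Fin n) (Fin k) ℂ} {I : Finset (Fin n)}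
    (h : maxMinor M I ≠ 0) : I.card = k := by
  by_contra hc
  exact h (maxMinor_of_card_ne M hc)

/-- The cofactor vector attached to a set `J` of `k` rows of a matrix with `k + 1` columns. -/
noncomputable def cofVec {k : ℕ} (M : Matrix (Fin n) (Fin (k + 1)) ℂ) (J : Finset (Fin n))
    (hJ : J.card = k) (l : Fin (k + 1)) : ℂ :=
  (-1) ^ (l : ℕ) * (M.submatrix (J.orderEmbOfFin hJ) l.succAbove).det

/-- Laplace expansion: pairing the cofactors of J with row i gives the determinant with row i placed
on top, and the sign moves that row to its place in increasing order. Hence the minors with one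
moving row form a vector of the column space, up to signs. This is how columns of g are recognised
as elements of N. -/
theorem mulVec_cofVec {k : ℕ} (M : Matrix (Fin n) (Fin (k + 1)) ℂ) (J : Finset (Fin n))
    (hJ : J.card = k) (i : Fin n) :
    M.mulVec (cofVec M J hJ) i
      = (-1) ^ (J.filter (· < i)).card * maxMinor M (insert i J) := by
  have h0 : M.mulVec (cofVec M J hJ) i
      = (M.submatrix (Fin.cons i (J.orderEmbOfFin hJ) : Fin (k + 1) → Fin n) id).det := by
    rw [Matrix.det_succ_row_zero, Matrix.mulVec, dotProduct]
    refine Finset.sum_congr rfl fun l _ => ?_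
    simp only [cofVec, Matrix.submatrix_apply, Fin.cons_zero, id]
    have : ((M.submatrix (Fin.cons i (J.orderEmbOfFin hJ) : Fin (k + 1) → Fin n) id).submatrix
        Fin.succ l.succAbove) = M.submatrix (J.orderEmbOfFin hJ) l.succAbove := by
      ext a b
      simp
    rw [this]
    ring
  by_cases hi : i ∈ J
  · rw [maxMinor_of_card_ne, mul_zero, h0]
    · obtain ⟨a, ha⟩ : ∃ a, J.orderEmbOfFin hJ a = i := by
        have : i ∈ Set.range (J.orderEmbOfFin hJ) := by
          rw [Finset.range_orderEmbOfFin]; exact hi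
        exact this
      refine Matrix.det_zero_of_row_eq (i := 0) (j := a.succ) (Fin.succ_ne_zero a).symm ?_
      ext b
      simp [ha]
    · rw [Finset.insert_eq_of_mem hi, hJ]; omega
  · have hc : (insert i J).card = k + 1 := by rw [Finset.card_insert_of_notMem hi, hJ]
    rw [maxMinor_of_card M hc]
    obtain ⟨p, hp⟩ : ∃ p, (insert i J).orderEmbOfFin hc p = i := by
      have : i ∈ Set.range ((insert i J).orderEmbOfFin hc) := by
        rw [Finset.range_orderEmbOfFin]; exact Finset.mem_coe.2 (Finset.mem_insert_self i J)
      exact this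
    have hJe : (fun a => (insert i J).orderEmbOfFin hc (p.succAbove a)) = J.orderEmbOfFin hJ := by
      refine Finset.orderEmbOfFin_unique hJ (fun a => ?_) ?_
      · have h1 := Finset.orderEmbOfFin_mem (insert i J) hc (p.succAbove a)
        rcases Finset.mem_insert.1 h1 with h2 | h2
        · exact absurd (((insert i J).orderEmbOfFin hc).injective (h2.trans hp.symm))
            (Fin.succAbove_ne p a)
        · exact h2
      · exact ((insert i J).orderEmbOfFin hc).strictMono.comp (Fin.strictMono_succAbove p)
    have hpc : (J.filter (· < i)).card = (p : ℕ) := by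
      have : J.filter (· < i) = (Finset.Iio p).map ((insert i J).orderEmbOfFin hc).toEmbedding := by
        ext x
        simp only [Finset.mem_filter, Finset.mem_map, Finset.mem_Iio, RelEmbedding.coe_toEmbedding]
        constructor
        · rintro ⟨hx, hxi⟩
          have : x ∈ Set.range ((insert i J).orderEmbOfFin hc) := by
            rw [Finset.range_orderEmbOfFin]; exact Finset.mem_coe.2 (Finset.mem_insert_of_mem hx)
          obtain ⟨a, ha⟩ := this
          refine ⟨a, ?_, ha⟩
          rw [← hp, ← ha] at hxi
          exact ((insert i J).orderEmbOfFin hc).lt_iff_lt.1 hxi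
        · rintro ⟨a, ha, rfl⟩
          have hlt := ((insert i J).orderEmbOfFin hc).lt_iff_lt.2 ha
          rw [hp] at hlt
          refine ⟨?_, hlt⟩
          rcases Finset.mem_insert.1 (Finset.orderEmbOfFin_mem (insert i J) hc a) with h2 | h2
          · exact absurd h2 hlt.ne
          · exact h2
      rw [this, Finset.card_map, Fin.card_Iio]
    rw [hpc, Matrix.det_succ_row _ p, Matrix.mulVec, dotProduct, Finset.mul_sum]
    refine Finset.sum_congr rfl fun l _ => ?_
    have hs : ((M.submatrix ((insert i J).orderEmbOfFin hc) id).submatrix p.succAbove l.succAbove)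
        = M.submatrix (J.orderEmbOfFin hJ) l.succAbove := by
      ext a b
      simp [← congrFun hJe a]
    rw [hs, Matrix.submatrix_apply, hp, cofVec, pow_add]
    have : ((-1 : ℂ) ^ (p : ℕ)) * (-1) ^ (p : ℕ) = 1 := by
      rw [← mul_pow]; simp
    simp only [id]
    linear_combination (-(M i l * (-1) ^ (l : ℕ) *
      (M.submatrix (J.orderEmbOfFin hJ) l.succAbove).det)) * this

/-- A maximal minor is nonzero iff no nonzero vector in the column space vanishes on its rows. -/
theorem maxMinor_ne_zero_iff {k : ℕ} (M : Matrix (Fin n) (Fin k) ℂ) {I : Finset (Fin n)}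
    (hI : I.card = k) :
    maxMinor M I ≠ 0 ↔ ∀ w : Fin k → ℂ, (∀ i ∈ I, M.mulVec w i = 0) → w = 0 := by
  rw [maxMinor_of_card M hI, Ne, ← Matrix.exists_mulVec_eq_zero_iff, not_exists]
  constructor
  · intro h w hw
    by_contra hw0
    refine h w ⟨hw0, ?_⟩
    ext a
    exact hw _ (Finset.orderEmbOfFin_mem I hI a)
  · rintro h w ⟨hw0, hw⟩
    refine hw0 (h w fun i hi => ?_)
    have : i ∈ Set.range (I.orderEmbOfFin hI) := by
      rw [Finset.range_orderEmbOfFin]; exact hi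
    obtain ⟨a, rfl⟩ := this
    exact congrFun hw a

theorem mem_span_range_col_iff {k : ℕ} (M : Matrix (Fin n) (Fin k) ℂ) (y : Fin n → ℂ) :
    y ∈ Submodule.span ℂ (Set.range M.col) ↔ ∃ w, M.mulVec w = y := by
  rw [← Matrix.range_mulVecLin, LinearMap.mem_range]
  rfl

theorem XX.rep_mulVec_injective {k : ℕ} (x : XX n k) : Function.Injective x.rep.mulVec := by
  rw [Matrix.mulVec_injective_iff]
  exact (Module.finBasisOfFinrankEq ℂ x.N x.finrank_N).linearIndependent.map'
      x.N.subtype (Submodule.ker_subtype _)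

theorem XX.mem_iff {k : ℕ} (x : XX n k) {A : Matrix (Fin n) (Fin k) ℂ} (hA : x.IsRep A)
    (y : Fin n → ℂ) : y ∈ x.N ↔ ∃ w, A.mulVec w = y := by
  rw [← mem_span_range_col_iff, hA]

/-- Nonvanishing of a Plücker coordinate in terms of the subspace. -/
theorem XX.maxMinor_rep_ne_zero_iff {k : ℕ} (x : XX n k) {I : Finset (Fin n)} (hI : I.card = k) :
    maxMinor x.rep I ≠ 0 ↔ ∀ y ∈ x.N, (∀ i ∈ I, y i = 0) → y = 0 := by
  rw [maxMinor_ne_zero_iff _ hI]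
  constructor
  · intro h y hy hyI
    obtain ⟨w, rfl⟩ := (x.mem_iff x.isRep_rep y).1 hy
    rw [h w hyI, Matrix.mulVec_zero]
  · intro h w hw
    have := h _ ((x.mem_iff x.isRep_rep _).2 ⟨w, rfl⟩) hw
    exact x.rep_mulVec_injective (by rw [this, Matrix.mulVec_zero])

theorem XX.maxMinor_ne_zero_iff_rep {k : ℕ} (x : XX n k) {A : Matrix (Fin n) (Fin k) ℂ}
    (hA : x.IsRep A) (I : Finset (Fin n)) : maxMinor A I ≠ 0 ↔ maxMinor x.rep I ≠ 0 := by
  obtain ⟨r, hr, h⟩ := x.maxMinor_of_isRep A hA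
  rw [h]
  simp [hr]

/-- Ratios of Plücker coordinates can be computed from any representative. -/
theorem XX.maxMinor_div {k : ℕ} (x : XX n k) {A : Matrix (Fin n) (Fin k) ℂ}
    (hA : x.IsRep A) (I J : Finset (Fin n)) :
    maxMinor A I / maxMinor A J = maxMinor x.rep I / maxMinor x.rep J := by
  obtain ⟨r, hr, h⟩ := x.maxMinor_of_isRep A hA
  rw [h, h, mul_div_mul_left _ _ hr]

end MaxMinor

/-! ### Residues -/

section Resid

variable {n : ℕ}

/-- The offset of `i` relative to `j` modulo `n`. -/
def off (i j : Fin n) : ℤ := ((i : ℤ) - j) % n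

theorem off_of_le {i j : Fin n} (h : j ≤ i) : off i j = (i : ℤ) - j := by
  have h1 := i.2
  have h2 : (j : ℕ) ≤ i := h
  rw [off, Int.emod_eq_of_lt] <;> omega

theorem off_of_lt {i j : Fin n} (h : i < j) : off i j = (i : ℤ) - j + n := by
  have h1 := j.2
  have h2 : (i : ℕ) < j := h
  rw [off, ← Int.add_emod_right, Int.emod_eq_of_lt] <;> omega

theorem off_nonneg (i j : Fin n) : 0 ≤ off i j :=
  Int.emod_nonneg _ (by have := i.2; omega)

theorem off_lt (i j : Fin n) : off i j < n :=
  Int.emod_lt_of_pos _ (by have := i.2; omega)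

/-- The smallest integer ≥ p in the class of a + 1 is p + ((a + 1 - p) mod n), so only this one has
to be compared with q. -/
theorem mem_resid_Icc {p q : ℤ} {a : Fin n} :
    a ∈ resid n (Finset.Icc p q) ↔ ((a : ℤ) + 1 - p) % n ≤ q - p := by
  have hn : (n : ℤ) ≠ 0 := by have := a.2; omega
  simp only [resid, Finset.mem_filter, Finset.mem_univ, true_and, Finset.mem_Icc]
  constructor
  · rintro ⟨m, ⟨h1, h2⟩, h3⟩
    have h4 : ((a : ℤ) + 1 - p) % n = (m - p) % n := (h3.sub_right p).symm
    rw [h4]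
    have : 0 ≤ m - p := by omega
    have h5 : (m - p) % n ≤ m - p := by
      have h6 := Int.mul_ediv_add_emod (m - p) n
      have h7 : 0 ≤ (n : ℤ) * ((m - p) / n) :=
        mul_nonneg (by positivity) (Int.ediv_nonneg this (by positivity))
      omega
    omega
  · intro h
    refine ⟨p + ((a : ℤ) + 1 - p) % n, ⟨?_, by omega⟩, ?_⟩
    · have := Int.emod_nonneg ((a : ℤ) + 1 - p) hn
      omega
    · have : p + ((a : ℤ) + 1 - p) % n ≡ p + ((a : ℤ) + 1 - p) [ZMOD n] :=
        (Int.mod_modEq _ _).add_left p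
      simpa using this

theorem resid_union (I J : Finset ℤ) : resid n (I ∪ J) = resid n I ∪ resid n J := by
  ext a
  simp only [resid, Finset.mem_filter, Finset.mem_univ, true_and, Finset.mem_union]
  constructor
  · rintro ⟨m, h | h, h'⟩
    exacts [Or.inl ⟨m, h, h'⟩, Or.inr ⟨m, h, h'⟩]
  · rintro (⟨m, h, h'⟩ | ⟨m, h, h'⟩)
    exacts [⟨m, Or.inl h, h'⟩, ⟨m, Or.inr h, h'⟩]

theorem resid_singleton {m : ℤ} {i : Fin n} (h : m ≡ (i : ℤ) + 1 [ZMOD n]) :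
    resid n {m} = {i} := by
  ext a
  simp only [resid, Finset.mem_filter, Finset.mem_univ, true_and, Finset.mem_singleton,
    exists_eq_left]
  constructor
  · intro h'
    have h1 : (a : ℤ) ≡ i [ZMOD n] := by
      have := (h'.symm.trans h).sub_right 1
      simpa using this
    have h2 := Int.emod_eq_of_lt (a := (a : ℤ)) (b := n) (by positivity) (by exact_mod_cast a.2)
    have h3 := Int.emod_eq_of_lt (a := (i : ℤ)) (b := n) (by positivity) (by exact_mod_cast i.2)
    have h4 : (a : ℤ) % n = (i : ℤ) % n := h1
    ext
    omega
  · rintro rfl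
    exact h

theorem resid_union_singleton {m : ℤ} {i : Fin n} (h : m ≡ (i : ℤ) + 1 [ZMOD n]) (I : Finset ℤ) :
    resid n (I ∪ {m}) = insert i (resid n I) := by
  rw [resid_union, resid_singleton h, Finset.union_comm]
  rfl

/-- The residue in `Fin n` of an integer (with `0 ↦ 0`). -/
def cyc (n : ℕ) [NeZero n] (r : ℤ) : Fin n :=
  ⟨(r % n).toNat, by
    have h := Int.emod_lt_of_pos r (b := n) (by exact_mod_cast NeZero.pos n)
    have h' := Int.emod_nonneg r (b := n) (by exact_mod_cast NeZero.ne n)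
    omega⟩

variable [NeZero n]

theorem cyc_val (r : ℤ) : ((cyc n r : Fin n) : ℤ) = r % n := by
  have h' := Int.emod_nonneg r (b := n) (by exact_mod_cast NeZero.ne n)
  simp only [cyc]
  omega

theorem cyc_modEq (r : ℤ) : ((cyc n r : Fin n) : ℤ) ≡ r [ZMOD n] := by
  rw [cyc_val]
  exact Int.mod_modEq _ _

theorem cyc_eq_iff {r : ℤ} {i : Fin n} : cyc n r = i ↔ (i : ℤ) ≡ r [ZMOD n] := by
  constructor
  · rintro rfl
    exact cyc_modEq r
  · intro h
    have h3 := Int.emod_eq_of_lt (a := (i : ℤ)) (b := n) (by positivity) (by exact_mod_cast i.2)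
    have h4 : (i : ℤ) % n = r % n := h
    have := cyc_val (n := n) r
    ext
    omega

theorem cyc_coe (i : Fin n) : cyc n (i : ℤ) = i := cyc_eq_iff.2 rfl

theorem off_cyc (r c : ℤ) : off (cyc n r) (cyc n c) = (r - c) % n := by
  rw [off]
  exact (cyc_modEq r).sub (cyc_modEq c)

theorem cyc_injOn (m : ℤ) : Set.InjOn (cyc n) (Set.Ico m (m + n)) := by
  intro r hr s hs h
  have h1 : r ≡ s [ZMOD n] := (cyc_modEq r).symm.trans (h ▸ cyc_modEq s)
  have h2 := (Int.modEq_iff_dvd.1 h1)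
  obtain ⟨d, hd⟩ := h2
  have h3 : (n : ℤ) > 0 := by exact_mod_cast NeZero.pos n
  simp only [Set.mem_Ico] at hr hs
  have h4 : d < 1 := by nlinarith
  have h5 : -1 < d := by nlinarith
  have : d = 0 := by omega
  subst this
  omega

theorem resid_Icc_eq_image (p q : ℤ) :
    resid n (Finset.Icc p q) = (Finset.Icc (p - 1) (q - 1)).image (cyc n) := by
  ext a
  simp only [resid, Finset.mem_filter, Finset.mem_univ, true_and, Finset.mem_image, Finset.mem_Icc]
  constructor
  · rintro ⟨m, h1, h2⟩
    refine ⟨m - 1, by omega, cyc_eq_iff.2 ?_⟩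
    have := (h2.sub_right 1).symm
    simpa using this
  · rintro ⟨m, h1, h2⟩
    refine ⟨m + 1, by omega, ?_⟩
    exact (cyc_eq_iff.1 h2).symm.add_right 1

theorem card_resid_Icc {p : ℤ} {k : ℕ} (hk : k ≤ n) :
    (resid n (Finset.Icc p (p + k - 1))).card = k := by
  rw [resid_Icc_eq_image, Finset.card_image_of_injOn]
  · rw [Int.card_Icc]; omega
  · refine (cyc_injOn (p - 1)).mono ?_
    intro r hr
    simp only [Finset.coe_Icc, Set.mem_Icc, Set.mem_Ico] at hr ⊢
    omega

end Resid

end GeomCrystal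

namespace GeomCrystal

/-! ### Folded banded matrices -/

section Fold

variable {n : ℕ}

/-- The folded matrix with coefficients `γ`: entries strictly above the diagonal carry a factor
`λ`. -/
noncomputable def fold (γ : Matrix (Fin n) (Fin n) ℂ) : Matrix (Fin n) (Fin n) ℂ[X] :=
  Matrix.of fun i j => if j ≤ i then C (γ i j) else X * C (γ i j)

/-- The value of `fold γ` at `λ = μ`. -/
noncomputable def ev (γ : Matrix (Fin n) (Fin n) ℂ) (μ : ℂ) : Matrix (Fin n) (Fin n) ℂ :=
  Matrix.of fun i j => if j ≤ i then γ i j else μ * γ i j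

theorem map_eval_fold (γ : Matrix (Fin n) (Fin n) ℂ) (μ : ℂ) : (fold γ).map (eval μ) = ev γ μ := by
  ext i j
  simp only [fold, ev, Matrix.map_apply, Matrix.of_apply]
  split_ifs <;> simp only [eval_mul, eval_X, eval_C]

/-- The shape of `g(N|t)` for `N` of dimension `k`: a band of width `n - k` below the (unfolded)
diagonal, with lowest entries equal to `1`. -/
structure Loop (k : ℕ) (γ : Matrix (Fin n) (Fin n) ℂ) : Prop where
  zero : ∀ i j, γ i j ≠ 0 → off i j ≤ (n : ℤ) - k
  lead : ∀ i j, off i j = (n : ℤ) - k → γ i j = 1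

theorem Loop.ev_zero {k : ℕ} {γ : Matrix (Fin n) (Fin n) ℂ} (h : Loop k γ) (μ : ℂ) {i j : Fin n}
    (hij : (n : ℤ) - k < off i j) : ev γ μ i j = 0 := by
  have : γ i j = 0 := by
    by_contra h0
    have := h.zero i j h0
    omega
  simp [ev, this]

theorem Loop.ev_lead {k : ℕ} {γ : Matrix (Fin n) (Fin n) ℂ} (h : Loop k γ) (μ : ℂ) {i j : Fin n}
    (hij : off i j = (n : ℤ) - k) : ev γ μ i j = if j ≤ i then 1 else μ := by
  simp [ev, h.lead i j hij]

/-- A subspace of dimension at most `k` containing the columns of a value of a banded matrix has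
dimension `k`, and its cyclic Plücker coordinates do not vanish. -/
theorem Loop.eq_zero_of_mem [NeZero n] {k : ℕ} (hkn : k < n)
    {γ : Matrix (Fin n) (Fin n) ℂ} (h : Loop k γ) {μ : ℂ} (hμ : μ ≠ 0)
    {W : Submodule ℂ (Fin n → ℂ)} (hW : Module.finrank ℂ W ≤ k) (j : ℤ)
    (hcol : ∀ a : Fin k, (ev γ μ).col (cyc n (j + a)) ∈ W) :
    Module.finrank ℂ W = k ∧
      ∀ y ∈ W, (∀ b : Fin k, y (cyc n (j + (n - k) + b)) = 0) → y = 0 := by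
  -- Columns j, …, j+k-1 restricted to the last k rows of the cyclic window of length n starting at
  -- j. By the band shape this block is triangular with diagonal entries 1 or μ. So W surjects onto
  -- these k coordinates, and the bound on its dimension makes the surjection bijective.
  set T : Matrix (Fin k) (Fin k) ℂ :=
    Matrix.of fun b a => ev γ μ (cyc n (j + (n - k) + b)) (cyc n (j + a)) with hT
  have hoff : ∀ a b : Fin k, off (cyc n (j + (n - k) + b)) (cyc n (j + a))
      = ((n : ℤ) - k + b - a) % n := by
    intro a b
    rw [off_cyc]
    congr 1
    ring
  have hTtri : T.BlockTriangular id := by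
    intro b a hab
    have hab' : (a : ℕ) < b := hab
    have h1 := b.2
    rw [hT, Matrix.of_apply]
    refine h.ev_zero μ ?_
    rw [hoff, Int.emod_eq_of_lt] <;> omega
  have hTdet : T.det ≠ 0 := by
    rw [Matrix.det_of_isUpperTriangular hTtri]
    refine Finset.prod_ne_zero_iff.2 fun a _ => ?_
    rw [hT, Matrix.of_apply, h.ev_lead μ]
    · split_ifs <;> simp [hμ]
    · rw [hoff, Int.emod_eq_of_lt] <;> omega
  let ρ : W →ₗ[ℂ] (Fin k → ℂ) :=
    { toFun := fun y b => (y : Fin n → ℂ) (cyc n (j + (n - k) + b))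
      map_add' := fun _ _ => rfl
      map_smul' := fun _ _ => rfl }
  have hsurj : Function.Surjective ρ := by
    intro z
    refine ⟨⟨∑ a : Fin k, (T⁻¹.mulVec z) a • (ev γ μ).col (cyc n (j + a)),
      Submodule.sum_mem _ fun a _ => Submodule.smul_mem _ _ (hcol _)⟩, ?_⟩
    have h1 : T.mulVec (T⁻¹.mulVec z) = z := by
      rw [Matrix.mulVec_mulVec, Matrix.mul_nonsing_inv _ (isUnit_iff_ne_zero.2 hTdet),
        Matrix.one_mulVec]
    conv_rhs => rw [← h1]
    ext b
    simp only [ρ, LinearMap.coe_mk, AddHom.coe_mk, Finset.sum_apply, Pi.smul_apply, smul_eq_mul,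
      Matrix.col_apply]
    rw [Matrix.mulVec, dotProduct]
    exact Finset.sum_congr rfl fun a _ => mul_comm _ _
  have hge : k ≤ Module.finrank ℂ W := by
    have := LinearMap.finrank_le_finrank_of_surjective hsurj
    simpa using this
  have heq : Module.finrank ℂ W = k := le_antisymm hW hge
  refine ⟨heq, fun y hy hy0 => ?_⟩
  have hinj : Function.Injective ρ :=
    (LinearMap.injective_iff_surjective_of_finrank_eq_finrank (by simpa using heq)).2 hsurj
  have : (⟨y, hy⟩ : W) = 0 := hinj (by rw [map_zero]; ext b; exact hy0 b)
  exact congrArg Subtype.val this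

end Fold

/-! ### The matrix `g` -/

section GMat

variable {n k : ℕ}

/-- Residues of `[j - k + 1, j - 1]`, for the column `j`. -/
noncomputable def lowSet (k : ℕ) (j : Fin n) : Finset (Fin n) :=
  resid n (Finset.Icc ((j : ℤ) + 1 - k + 1) ((j : ℤ) + 1 - 1))

/-- Residues of `[j - k, j - 1]`, for the column `j`. -/
noncomputable def baseSet (k : ℕ) (j : Fin n) : Finset (Fin n) :=
  resid n (Finset.Icc ((j : ℤ) + 1 - k) ((j : ℤ) + 1 - 1))

/-- Adding a shift of at most n to a reduced offset wraps around at most once; this reduces cyclic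
membership questions to linear arithmetic. -/
theorem emod_shift {n : ℕ} {m o : ℤ} {k : ℤ} (h0 : 0 ≤ o) (h1 : o < n) (hk : 0 ≤ k) (hkn : k ≤ n)
    (h : m ≡ o + k [ZMOD n]) : m % n = if o + k < n then o + k else o + k - n := by
  have h2 : m % n = (o + k) % n := h
  rw [h2]
  split_ifs with h3
  · exact Int.emod_eq_of_lt (by omega) h3
  · rw [Int.emod_eq_sub_self_emod, Int.emod_eq_of_lt] <;> omega

theorem mem_lowSet (hk : 1 ≤ k) (hkn : k < n) {a j : Fin n} :
    a ∈ lowSet k j ↔ (n : ℤ) - k < off a j := by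
  have h1 := off_nonneg a j
  have h2 := off_lt a j
  rw [lowSet, mem_resid_Icc, emod_shift (o := off a j) (k := k - 1) h1 h2 (by omega) (by omega)]
  · split_ifs <;> omega
  · have : off a j + (k - 1) ≡ (a : ℤ) - j + (k - 1) [ZMOD n] := (Int.mod_modEq _ _).add_right _
    have e : (a : ℤ) + 1 - ((j : ℤ) + 1 - k + 1) = (a : ℤ) - j + (k - 1) := by ring
    rw [e]
    exact this.symm

theorem mem_baseSet (hk : 1 ≤ k) (hkn : k < n) {a j : Fin n} :
    a ∈ baseSet k j ↔ (n : ℤ) - k ≤ off a j := by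
  have h1 := off_nonneg a j
  have h2 := off_lt a j
  rw [baseSet, mem_resid_Icc, emod_shift (o := off a j) (k := k) h1 h2 (by omega) (by omega)]
  · split_ifs <;> omega
  · have : off a j + k ≡ (a : ℤ) - j + k [ZMOD n] := (Int.mod_modEq _ _).add_right _
    have e : (a : ℤ) + 1 - ((j : ℤ) + 1 - k) = (a : ℤ) - j + k := by ring
    rw [e]
    exact this.symm

theorem card_lowSet (hk : 1 ≤ k) (hkn : k < n) (j : Fin n) : (lowSet k j).card = k - 1 := by
  have : NeZero n := ⟨by omega⟩
  have := card_resid_Icc (n := n) (p := (j : ℤ) + 1 - k + 1) (k := k - 1) (by omega)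
  rw [lowSet, ← this]
  congr 3
  omega

theorem card_baseSet (hkn : k < n) (j : Fin n) : (baseSet k j).card = k := by
  have : NeZero n := ⟨by omega⟩
  have := card_resid_Icc (n := n) (p := (j : ℤ) + 1 - k) (k := k) (by omega)
  have e : (j : ℤ) + 1 - 1 = (j : ℤ) + 1 - k + k - 1 := by ring
  rw [baseSet, e, this]

theorem off_inj_left {a b j : Fin n} (h : off a j = off b j) : a = b := by
  rcases le_or_gt j a with ha | ha <;> rcases le_or_gt j b with hb | hb
  · rw [off_of_le ha, off_of_le hb] at h; ext; omega
  · rw [off_of_le ha, off_of_lt hb] at h; have := a.2; ext; omega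
  · rw [off_of_lt ha, off_of_le hb] at h; have := b.2; ext; omega
  · rw [off_of_lt ha, off_of_lt hb] at h; ext; omega

/-- In the lowest row of the band, numerator and denominator of the entry of g agree; this is the
source of the leading 1's. -/
theorem insert_lowSet (hk : 1 ≤ k) (hkn : k < n) {r j : Fin n} (h : off r j = (n : ℤ) - k) :
    insert r (lowSet k j) = baseSet k j := by
  ext a
  rw [Finset.mem_insert, mem_lowSet hk hkn, mem_baseSet hk hkn]
  constructor
  · rintro (rfl | h') <;> omega
  · intro h'
    rcases eq_or_lt_of_le h' with h2 | h2
    · exact Or.inl (off_inj_left (h2.symm.trans h.symm))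
    · exact Or.inr h2

/-- All denominators of `g(N|t)` are nonzero. -/
def XX.Good (x : XX n k) : Prop := ∀ j : Fin n, maxMinor x.rep (baseSet k j) ≠ 0

/-- The entries of `g(N|t)`, without the factors `λ`. -/
noncomputable def gam (x : XX n k) : Matrix (Fin n) (Fin n) ℂ :=
  Matrix.of fun i j => (if (k : ℕ) ≤ j ∧ j ≤ i then (x.t : ℂ) else 1) *
    (maxMinor x.rep (insert i (lowSet k j)) / maxMinor x.rep (baseSet k j))

theorem maxMinor_insert_lowSet_eq_zero (hk : 1 ≤ k) (hkn : k < n) (M : Matrix (Fin n) (Fin k) ℂ)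
    {i j : Fin n} (h : (n : ℤ) - k < off i j) : maxMinor M (insert i (lowSet k j)) = 0 := by
  apply maxMinor_of_card_ne
  rw [Finset.insert_eq_of_mem ((mem_lowSet hk hkn).2 h), card_lowSet hk hkn]
  omega

/-- The definition of g gives columns j ≤ k the factor 1 even above the diagonal, where `fold` puts
λ. The two agree because the Plücker coordinate there has a repeated index and vanishes. -/
theorem mem_gMat_iff (hk : 1 ≤ k) (hkn : k < n) (x : XX n k) (Y : Matrix (Fin n) (Fin n) ℂ[X]) :
    Y ∈ gMat x ↔ x.Good ∧ Y = fold (gam x) := by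
  have hdom : (∀ j : ℤ, 1 ≤ j → j ≤ n → x.P (Finset.Icc (j - k) (j - 1)) ≠ 0) ↔ x.Good := by
    constructor
    · intro h j
      exact h (j + 1) (by omega) (by have := j.2; omega)
    · intro h j h1 h2
      have := h ⟨(j - 1).toNat, by omega⟩
      rw [baseSet] at this
      have h3 : (((⟨(j - 1).toNat, by omega⟩ : Fin n) : ℕ) : ℤ) = j - 1 := by
        simp only; omega
      rw [h3] at this
      simpa [XX.P] using this
  have hval : ∀ h, (gMat x).get h = fold (gam x) := by
    intro h
    refine Matrix.ext fun i j => ?_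
    have hP : x.P (Finset.Icc ((j : ℤ) + 1 - k + 1) ((j : ℤ) + 1 - 1) ∪ {(i : ℤ) + 1})
        = maxMinor x.rep (insert i (lowSet k j)) := by
      rw [XX.P, resid_union_singleton (Int.ModEq.refl _)]
      rfl
    have hP' : x.P (Finset.Icc ((j : ℤ) + 1 - k) ((j : ℤ) + 1 - 1))
        = maxMinor x.rep (baseSet k j) := rfl
    have h0 : (j : ℕ) < k → ¬ j ≤ i → maxMinor x.rep (insert i (lowSet k j)) = 0 := by
      intro h1 h2
      apply maxMinor_insert_lowSet_eq_zero hk hkn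
      rw [off_of_lt (not_le.1 h2)]
      have := i.2
      omega
    simp only [gMat, fold, gam, Matrix.of_apply, hP, hP']
    have e1 : ((j : ℤ) + 1 ≤ k) ↔ (j : ℕ) < k := by omega
    have e2 : ((j : ℤ) + 1 ≤ (i : ℤ) + 1) ↔ j ≤ i := by
      rw [Fin.le_def]; omega
    simp only [e1, e2]
    by_cases h1 : (j : ℕ) < k <;> by_cases h2 : j ≤ i
    · simp [h1, h2, not_le.2 h1]
    · simp [h1, h2, h0 h1 h2]
    · simp [h1, h2, not_lt.1 h1]
    · simp [h1, h2]
  rw [Part.mem_eq]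
  constructor
  · rintro ⟨h, rfl⟩
    exact ⟨hdom.1 h, hval h⟩
  · rintro ⟨h, rfl⟩
    exact ⟨hdom.2 h, hval (hdom.2 h)⟩

theorem gMat_eq_some (hk : 1 ≤ k) (hkn : k < n) {x : XX n k} (hx : x.Good) :
    gMat x = Part.some (fold (gam x)) :=
  Part.eq_some_iff.2 ((mem_gMat_iff hk hkn x _).2 ⟨hx, rfl⟩)

theorem loop_gam (hk : 1 ≤ k) (hkn : k < n) {x : XX n k} (hx : x.Good) : Loop k (gam x) where
  zero i j h := by
    by_contra h'
    apply h
    rw [gam, Matrix.of_apply, maxMinor_insert_lowSet_eq_zero hk hkn _ (by omega)]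
    simp
  lead i j h := by
    rw [gam, Matrix.of_apply, insert_lowSet hk hkn h, div_self (hx j), if_neg, one_mul]
    rintro ⟨h1, h2⟩
    rw [off_of_le h2] at h
    have := i.2
    omega

/-- The special value of `λ` at which `g(N|t)` drops rank. -/
noncomputable def lam (k : ℕ) (t : ℂˣ) : ℂ := (-1) ^ (k - 1) * (t : ℂ)

theorem lam_ne_zero (k : ℕ) (t : ℂˣ) : lam k t ≠ 0 :=
  mul_ne_zero (pow_ne_zero _ (by norm_num)) t.ne_zero

/-- Column j is a multiple of the cofactor vector of `lowSet k j`, hence lies in N. The signs by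
which the cofactor vector differs from the Plücker coordinates are exactly those produced by λ₀ =
(-1)^(k-1) t. -/
theorem col_ev_gam_mem (hk : 1 ≤ k) (hkn : k < n) {x : XX n k} (j : Fin n) :
    (ev (gam x) (lam k x.t)).col j ∈ x.N := by
  obtain ⟨k, rfl⟩ : ∃ k', k = k' + 1 := ⟨k - 1, by omega⟩
  have hcard : (lowSet (k + 1) j).card = k := by rw [card_lowSet hk hkn]; omega
  have hmem : x.rep.mulVec (cofVec x.rep _ hcard) ∈ x.N := (x.mem_iff x.isRep_rep _).2 ⟨_, rfl⟩
  suffices h : ∃ κ : ℂ, (ev (gam x) (lam (k + 1) x.t)).col j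
      = κ • x.rep.mulVec (cofVec x.rep _ hcard) by
    obtain ⟨κ, hκ⟩ := h
    rw [hκ]
    exact Submodule.smul_mem _ _ hmem
  have hsq : ∀ m : ℕ, ((-1 : ℂ) ^ m) * (-1) ^ m = 1 := fun m => by rw [← mul_pow]; simp
  -- For the first k + 1 columns the rows in the band are not separated by elements of the low set,
  -- so the sign is constant. For later columns the low set lies below j: all of it precedes a row i
  -- ≥ j, none of it precedes a row i < j in the band, and the relative sign (-1)^k is cancelled by
  -- λ₀ = (-1)^k t.
  by_cases hj : (j : ℕ) < k + 1
  · refine ⟨(-1) ^ ((lowSet (k + 1) j).filter (· < j)).card / maxMinor x.rep (baseSet (k + 1) j), ?_⟩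
    ext i
    rw [Pi.smul_apply, mulVec_cofVec, Matrix.col_apply, smul_eq_mul, ev, Matrix.of_apply, gam,
      Matrix.of_apply, if_neg (show ¬(k + 1 ≤ (j : ℕ) ∧ j ≤ i) by omega)]
    by_cases hi : (n : ℤ) - (k + 1 : ℕ) < off i j
    · rw [maxMinor_insert_lowSet_eq_zero hk hkn _ hi]; simp
    · have hji : j ≤ i := by
        by_contra hji
        rw [off_of_lt (not_le.1 hji)] at hi
        have := i.2
        omega
      rw [if_pos hji]
      have : (lowSet (k + 1) j).filter (· < i) = (lowSet (k + 1) j).filter (· < j) := by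
        refine Finset.filter_congr fun a ha => ?_
        rw [mem_lowSet hk hkn] at ha
        rw [off_of_le hji] at hi
        rcases le_or_gt j a with h1 | h1
        · rw [off_of_le h1] at ha
          rw [Fin.lt_def, Fin.lt_def]
          rw [Fin.le_def] at h1
          omega
        · rw [Fin.lt_def, Fin.lt_def]
          rw [Fin.lt_def] at h1
          rw [Fin.le_def] at hji
          omega
      rw [this]
      have h2 := hsq ((lowSet (k + 1) j).filter (· < j)).card
      linear_combination (-(maxMinor x.rep (insert i (lowSet (k + 1) j)) /
        maxMinor x.rep (baseSet (k + 1) j))) * h2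
  · refine ⟨lam (k + 1) x.t / maxMinor x.rep (baseSet (k + 1) j), ?_⟩
    ext i
    rw [Pi.smul_apply, mulVec_cofVec, Matrix.col_apply, smul_eq_mul, ev, Matrix.of_apply, gam,
      Matrix.of_apply]
    by_cases hi : (n : ℤ) - (k + 1 : ℕ) < off i j
    · rw [maxMinor_insert_lowSet_eq_zero hk hkn _ hi]; simp
    by_cases hji : j ≤ i
    · rw [if_pos hji, if_pos ⟨by omega, hji⟩]
      have : (lowSet (k + 1) j).filter (· < i) = lowSet (k + 1) j := by
        refine Finset.filter_true_of_mem fun a ha => ?_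
        rw [mem_lowSet hk hkn] at ha
        rcases le_or_gt j a with h1 | h1
        · rw [off_of_le h1] at ha
          have := a.2
          omega
        · exact h1.trans_le hji
      rw [this, hcard, lam, Nat.add_sub_cancel]
      have h2 := hsq k
      linear_combination (-((x.t : ℂ) * (maxMinor x.rep (insert i (lowSet (k + 1) j)) /
        maxMinor x.rep (baseSet (k + 1) j)))) * h2
    · rw [if_neg hji, if_neg (fun h => hji h.2)]
      have : (lowSet (k + 1) j).filter (· < i) = ∅ := by
        refine Finset.filter_false_of_mem fun a ha => ?_
        rw [mem_lowSet hk hkn] at ha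
        rw [off_of_lt (not_le.1 hji)] at hi
        rw [Fin.lt_def]
        rcases le_or_gt j a with h1 | h1
        · rw [off_of_le h1] at ha
          have := a.2
          omega
        · rw [off_of_lt h1] at ha
          omega
      rw [this]
      simp
      ring

theorem mem_baseSet_iff_exists [NeZero n] (hk : 1 ≤ k) (hkn : k < n) {j : Fin n} (b : Fin k) :
    cyc n ((j : ℤ) + (n - k) + b) ∈ baseSet k j := by
  rw [mem_baseSet hk hkn]
  have : off (cyc n ((j : ℤ) + (n - k) + b)) j = (((j : ℤ) + (n - k) + b) - j) % n := by
    conv_lhs => rw [← cyc_coe j]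
    rw [cyc_coe j]
    conv_lhs => rw [← cyc_coe (n := n) j]
    rw [off_cyc, cyc_coe j]
  rw [this, Int.emod_eq_of_lt] <;> omega

theorem Loop.eq_zero_of_mem_baseSet (hk : 1 ≤ k) (hkn : k < n)
    {γ : Matrix (Fin n) (Fin n) ℂ} (h : Loop k γ) {μ : ℂ} (hμ : μ ≠ 0)
    {W : Submodule ℂ (Fin n → ℂ)} (hW : Module.finrank ℂ W ≤ k) (hcol : ∀ j, (ev γ μ).col j ∈ W)
    (j : Fin n) : ∀ y ∈ W, (∀ i ∈ baseSet k j, y i = 0) → y = 0 := by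
  have : NeZero n := ⟨by omega⟩
  intro y hy hy0
  exact (h.eq_zero_of_mem hkn hμ hW j fun _ => hcol _).2 y hy
    fun b => hy0 _ (mem_baseSet_iff_exists hk hkn b)

/-- The columns of `g(N|t)`, evaluated at the special value of `λ`, span `N`. -/
theorem span_col_ev_gam (hk : 1 ≤ k) (hkn : k < n) {x : XX n k} (hx : x.Good) :
    Submodule.span ℂ (Set.range (ev (gam x) (lam k x.t)).col) = x.N := by
  have : NeZero n := ⟨by omega⟩
  have hle : Submodule.span ℂ (Set.range (ev (gam x) (lam k x.t)).col) ≤ x.N := by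
    rw [Submodule.span_le]
    rintro _ ⟨j, rfl⟩
    exact col_ev_gam_mem hk hkn j
  refine Submodule.eq_of_le_of_finrank_le hle ?_
  have h1 := Submodule.finrank_mono hle
  rw [x.finrank_N] at h1 ⊢
  exact ((loop_gam hk hkn hx).eq_zero_of_mem hkn (lam_ne_zero k x.t) h1 0
    (fun _ => Submodule.subset_span ⟨_, rfl⟩)).1.ge

/-- A banded matrix whose value at the special `λ` has its columns in `N` is `g(N|t)`. -/
theorem Loop.eq_gam (hk : 1 ≤ k) (hkn : k < n) {γ : Matrix (Fin n) (Fin n) ℂ} (h : Loop k γ)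
    {x : XX n k} (hcol : ∀ j, (ev γ (lam k x.t)).col j ∈ x.N) : x.Good ∧ γ = gam x := by
  have hz := fun j => h.eq_zero_of_mem_baseSet hk hkn (lam_ne_zero k x.t) x.finrank_N.le hcol j
  have hg : x.Good := fun j => (x.maxMinor_rep_ne_zero_iff (card_baseSet hkn j)).2 (hz j)
  refine ⟨hg, ?_⟩
  have hl := loop_gam hk hkn hg
  -- Both matrices have the same entries in the rows of `baseSet k j`: the common leading entry and
  -- zeros. So the difference of two columns is a vector of N vanishing on these rows, hence zero.
  have key : ∀ j, (ev γ (lam k x.t)).col j - (ev (gam x) (lam k x.t)).col j = 0 := by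
    intro j
    refine hz j _ (Submodule.sub_mem _ (hcol j) (col_ev_gam_mem hk hkn j)) fun i hi => ?_
    rw [mem_baseSet hk hkn] at hi
    rw [Pi.sub_apply, Matrix.col_apply, Matrix.col_apply]
    rcases eq_or_lt_of_le hi with h1 | h1
    · rw [h.ev_lead _ h1.symm, hl.ev_lead _ h1.symm, sub_self]
    · rw [h.ev_zero _ h1, hl.ev_zero _ h1, sub_self]
  ext i j
  have h1 := sub_eq_zero.1 (congrFun (key j) i)
  simp only [Matrix.col_apply, ev, Matrix.of_apply] at h1
  split_ifs at h1
  · exact h1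
  · exact mul_left_cancel₀ (lam_ne_zero k x.t) h1

/-- A banded matrix whose value at the special `λ` has rank at most `k` is of the form `g(N|t)`. -/
theorem Loop.exists_eq_gam (hk : 1 ≤ k) (hkn : k < n) {γ : Matrix (Fin n) (Fin n) ℂ}
    (h : Loop k γ) (t : ℂˣ) (hr : (ev γ (lam k t)).rank ≤ k) :
    ∃ x : XX n k, x.t = t ∧ x.Good ∧ γ = gam x ∧
      x.N = Submodule.span ℂ (Set.range (ev γ (lam k t)).col) := by
  have : NeZero n := ⟨by omega⟩
  rw [Matrix.rank_eq_finrank_span_cols] at hr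
  have hf := (h.eq_zero_of_mem hkn (lam_ne_zero k t) hr 0
    (fun _ => Submodule.subset_span ⟨_, rfl⟩)).1
  refine ⟨⟨_, hf, t⟩, rfl, ?_⟩
  have := h.eq_gam hk hkn (x := ⟨_, hf, t⟩) (fun j => Submodule.subset_span ⟨j, rfl⟩)
  exact ⟨this.1, this.2, rfl⟩

end GMat

end GeomCrystal

namespace GeomCrystal

/-! ### Left division by g(N|t) -/

section Division

variable {n k : ℕ}

/-- The first `k` columns of `g(N|t)` already span `N`. -/
theorem span_first_cols (hk : 1 ≤ k) (hkn : k < n) {x : XX n k} (hx : x.Good) :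
    Submodule.span ℂ ((ev (gam x) (lam k x.t)).col '' {j : Fin n | (j : ℕ) < k}) = x.N := by
  have : NeZero n := ⟨by omega⟩
  have hle : Submodule.span ℂ ((ev (gam x) (lam k x.t)).col '' {j : Fin n | (j : ℕ) < k})
      ≤ x.N := by
    rw [Submodule.span_le]
    rintro _ ⟨j, -, rfl⟩
    exact col_ev_gam_mem hk hkn j
  refine Submodule.eq_of_le_of_finrank_le hle ?_
  have h1 := Submodule.finrank_mono hle
  rw [x.finrank_N] at h1 ⊢
  refine ((loop_gam hk hkn hx).eq_zero_of_mem hkn (lam_ne_zero k x.t) h1 0 fun a =>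
    Submodule.subset_span ⟨_, ?_, rfl⟩).1.ge
  have h2 := cyc_val (n := n) (0 + (a : ℤ))
  rw [zero_add, Int.emod_eq_of_lt (by omega) (by omega)] at h2
  simp only [Set.mem_ofPred_eq, zero_add]
  omega

/-- The coefficient of `λ` in `fold γ`. -/
noncomputable def linPart (γ : Matrix (Fin n) (Fin n) ℂ) : Matrix (Fin n) (Fin n) ℂ :=
  Matrix.of fun i j => if j ≤ i then 0 else γ i j

/-- The entries have degree at most one in λ, so their expansion at c stops after the linear term.
-/
theorem fold_eq_add (γ : Matrix (Fin n) (Fin n) ℂ) (c : ℂ) :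
    fold γ = (ev γ c).map C + (X - C c) • (linPart γ).map C := by
  refine Matrix.ext fun i j => ?_
  simp only [fold, ev, linPart, Matrix.of_apply, Matrix.add_apply, Matrix.map_apply,
    Matrix.smul_apply, smul_eq_mul]
  split_ifs
  · simp
  · simp only [C_mul]; ring

theorem Loop.linPart_eq_zero {γ : Matrix (Fin n) (Fin n) ℂ} (h : Loop k γ) {i j : Fin n}
    (hij : (j : ℤ) - k < i) : linPart γ i j = 0 := by
  rw [linPart, Matrix.of_apply]
  split_ifs with h1
  · rfl
  · by_contra h0
    have := h.zero i j h0
    rw [off_of_lt (not_le.1 h1)] at this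
    omega

/-- The first `k` columns of the special value of `fold γ`, followed by the last `n - k` columns of
its linear part. -/
noncomputable def mixed (k : ℕ) (γ : Matrix (Fin n) (Fin n) ℂ) (c : ℂ) :
    Matrix (Fin n) (Fin n) ℂ :=
  Matrix.of fun i j => if (j : ℕ) < k then ev γ c i j else linPart γ i j

/-- After a cyclic permutation of the rows the matrix would be block triangular with unitriangular
blocks: column j < k has its lowest entry 1 in row j + n - k, and column j ≥ k has a 1 in row j - k
with zeros below. For a kernel vector, the largest index with nonzero coordinate is excluded, first
among j < k and then among all j. -/
theorem Loop.det_mixed_ne_zero (hk : 1 ≤ k) (hkn : k < n) {γ : Matrix (Fin n) (Fin n) ℂ}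
    (h : Loop k γ) (c : ℂ) : (mixed k γ c).det ≠ 0 := by
  rw [Ne, ← Matrix.exists_mulVec_eq_zero_iff]
  rintro ⟨w, hw0, hw⟩
  have single : ∀ i p : Fin n, (∀ j, j ≠ p → mixed k γ c i j * w j = 0) → mixed k γ c i p = 1 →
      w p = 0 := by
    intro i p h1 h2
    have h3 := congrFun hw i
    rw [Matrix.mulVec, dotProduct, Finset.sum_eq_single p (fun j _ hj => h1 j hj)
      (fun hp => absurd (Finset.mem_univ p) hp), h2, one_mul] at h3
    exact h3
  have hsmall : ∀ j : Fin n, (j : ℕ) < k → w j = 0 := by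
    by_contra hne
    push Not at hne
    obtain ⟨j0, hj0, hj0'⟩ := hne
    have hS : ((Finset.univ : Finset (Fin n)).filter
        fun j : Fin n => (j : ℕ) < k ∧ w j ≠ 0).Nonempty := ⟨j0, by simp [hj0, hj0']⟩
    obtain ⟨p, hp, hmax⟩ := Finset.exists_max_image _ (fun j : Fin n => (j : ℕ)) hS
    simp only [Finset.mem_filter, Finset.mem_univ, true_and] at hp hmax
    refine hp.2 (single ⟨p + n - k, by have := p.2; omega⟩ p (fun j hj => ?_) ?_)
    · rw [mixed, Matrix.of_apply]
      split_ifs with hjk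
      · rcases lt_or_ge (p : ℕ) j with h1 | h1
        · have : w j = 0 := by
            by_contra h2
            have := hmax j ⟨hjk, h2⟩
            omega
          rw [this, mul_zero]
        · have h2 : (j : ℕ) ≠ p := fun h => hj (Fin.ext h)
          rw [h.ev_zero, zero_mul]
          rw [off_of_le (by rw [Fin.le_def]; simp only; omega)]
          simp only
          have := j.2
          omega
      · rw [h.linPart_eq_zero, zero_mul]
        simp only
        have := j.2
        omega
    · have hle : p ≤ ⟨p + n - k, by have := p.2; omega⟩ := by
        rw [Fin.le_def]; simp only; have := p.2; omega
      rw [mixed, Matrix.of_apply, if_pos hp.1, h.ev_lead, if_pos hle]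
      rw [off_of_le hle]
      simp only
      have := p.2
      omega
  refine hw0 ?_
  by_contra hne
  have hS : ((Finset.univ : Finset (Fin n)).filter fun j => w j ≠ 0).Nonempty := by
    by_contra hemp
    rw [Finset.not_nonempty_iff_eq_empty] at hemp
    refine hne (funext fun j => ?_)
    by_contra hj
    have : j ∈ (Finset.univ : Finset (Fin n)).filter fun j => w j ≠ 0 := by
      simpa using hj
    rw [hemp] at this
    exact absurd this (Finset.notMem_empty j)
  obtain ⟨p, hp, hmax⟩ := Finset.exists_max_image _ (fun j : Fin n => (j : ℕ)) hS
  simp only [Finset.mem_filter, Finset.mem_univ, true_and] at hp hmax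
  have hpk : k ≤ (p : ℕ) := by
    by_contra hlt
    exact hp (hsmall p (not_le.1 hlt))
  refine hp (single ⟨p - k, by omega⟩ p (fun j hj => ?_) ?_)
  · rcases lt_or_ge (p : ℕ) j with h1 | h1
    · have : w j = 0 := by
        by_contra h2
        have := hmax j h2
        omega
      rw [this, mul_zero]
    · have h2 : (j : ℕ) ≠ p := fun h => hj (Fin.ext h)
      by_cases hjk : (j : ℕ) < k
      · rw [hsmall j hjk, mul_zero]
      · rw [mixed, Matrix.of_apply, if_neg hjk, h.linPart_eq_zero, zero_mul]
        simp only
        omega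
  · have hlt : ¬ p ≤ ⟨p - k, by omega⟩ := by
      rw [Fin.le_def]; simp only; omega
    rw [mixed, Matrix.of_apply, if_neg (by omega), linPart, Matrix.of_apply, if_neg hlt, h.lead]
    rw [off_of_lt (not_le.1 hlt)]
    simp only
    omega

/-- `g(N|t)` divides `λ - λ₀` from the left, where `λ₀` is the special value of `λ`. -/
theorem exists_fold_gam_mul (hk : 1 ≤ k) (hkn : k < n) {x : XX n k} (hx : x.Good) :
    ∃ Y : Matrix (Fin n) (Fin n) ℂ[X],
      fold (gam x) * Y = (X - C (lam k x.t)) • (1 : Matrix (Fin n) (Fin n) ℂ[X]) := by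
  have hl := loop_gam hk hkn hx
  set c := lam k x.t with hc
  set γ := gam x
  -- Column operations normalise g: with G invertible, the value at c is G H and the linear part is
  -- G Z, where Z projects onto the last n - k coordinates and H is an idempotent with image in the
  -- first k.
  set G := mixed k γ c with hG
  set Z : Matrix (Fin n) (Fin n) ℂ := Matrix.diagonal fun j => if (j : ℕ) < k then 0 else 1 with hZ
  have hGdet : G.det ≠ 0 := hl.det_mixed_ne_zero hk hkn c
  have hDZ : linPart γ = G * Z := by
    ext i j
    rw [hZ, Matrix.mul_diagonal, hG, mixed, Matrix.of_apply]
    split_ifs with h1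
    · rw [mul_zero, hl.linPart_eq_zero]
      omega
    · rw [mul_one]
  have hcols : ∀ j : Fin n, ∃ w : Fin n → ℂ, (∀ i : Fin n, k ≤ (i : ℕ) → w i = 0) ∧
      G.mulVec w = (ev γ c).col j ∧ ((j : ℕ) < k → w = Pi.single j 1) := by
    have hbase : ∀ j : Fin n, (j : ℕ) < k → G.mulVec (Pi.single j 1) = (ev γ c).col j := by
      intro j hj
      ext i
      simp [hG, mixed, hj]
    intro j
    by_cases hj : (j : ℕ) < k
    · refine ⟨Pi.single j 1, fun i hi => ?_, hbase j hj, fun _ => rfl⟩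
      rw [Pi.single_eq_of_ne]
      rintro rfl
      omega
    · let V : Submodule ℂ (Fin n → ℂ) :=
        { carrier := {w | ∀ i : Fin n, k ≤ (i : ℕ) → w i = 0}
          add_mem' := fun {a b} ha hb i hi => by simp [ha i hi, hb i hi]
          zero_mem' := fun i _ => rfl
          smul_mem' := fun a b hb i hi => by simp [hb i hi] }
      have hle : x.N ≤ V.map G.mulVecLin := by
        rw [← span_first_cols hk hkn hx, Submodule.span_le]
        rintro _ ⟨a, ha, rfl⟩
        refine ⟨Pi.single a 1, fun i hi => ?_, hbase a ha⟩
        rw [Pi.single_eq_of_ne]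
        rintro rfl
        have : (i : ℕ) < k := ha
        omega
      obtain ⟨w, hw, hw'⟩ := hle (col_ev_gam_mem hk hkn (x := x) j)
      exact ⟨w, hw, hw', fun h => absurd h hj⟩
  choose w hw1 hw2 hw3 using hcols
  -- The columns of H are the coordinates, in the first k columns of G, of the columns of the
  -- special value; this uses that those k columns already span N.
  set H : Matrix (Fin n) (Fin n) ℂ := Matrix.of fun i j => w j i with hH
  have hGH : ev γ c = G * H := by
    ext i j
    exact (congrFun (hw2 j) i).symm
  have hZH : Z * H = 0 := by
    ext i j
    rw [hZ, Matrix.diagonal_mul, hH, Matrix.of_apply]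
    split_ifs with h1
    · simp
    · rw [hw1 j i (not_lt.1 h1)]; simp
  have hH1 : H * (1 - Z) = 1 - Z := by
    have : (1 - Z) = Matrix.diagonal fun j : Fin n => if (j : ℕ) < k then (1 : ℂ) else 0 := by
      rw [hZ, ← Matrix.diagonal_one, Matrix.diagonal_sub]
      congr 1
      funext j
      split_ifs <;> simp
    rw [this]
    ext i j
    rw [Matrix.mul_diagonal, hH, Matrix.of_apply]
    by_cases hj : (j : ℕ) < k
    · rw [if_pos hj, mul_one, hw3 j hj, Matrix.diagonal_apply]
      by_cases hij : i = j
      · subst hij; simp [hj]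
      · simp [hij]
    · rw [if_neg hj, mul_zero, Matrix.diagonal_apply]
      split_ifs with h1 h2
      · subst h1; exact absurd h2 hj
      · rfl
      · rfl
  have hZZ : Z * Z = Z := by
    rw [hZ, Matrix.diagonal_mul_diagonal]
    congr 1
    funext j
    split_ifs <;> simp
  have hHH : H * H = H := by
    have h1 : H = (1 - Z) * H := by rw [sub_mul, one_mul, hZH, sub_zero]
    calc H * H = H * ((1 - Z) * H) := by rw [← h1]
      _ = H := by rw [← mul_assoc, hH1, ← h1]
  let φ : Matrix (Fin n) (Fin n) ℂ →+* Matrix (Fin n) (Fin n) ℂ[X] := (C : ℂ →+* ℂ[X]).mapMatrix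
  have hφ : ∀ M : Matrix (Fin n) (Fin n) ℂ, M.map C = φ M := fun _ => rfl
  set p : ℂ[X] := X - C c
  -- With p = λ - c, the relations ZH = 0, HH = H, ZZ = Z and H(1-Z) = 1-Z give (H + pZ)(p(1-Z) + Z
  -- - HZ) = p.
  refine ⟨(p • φ (1 - Z) + φ (Z - H * Z)) * φ G⁻¹, ?_⟩
  have hL : fold γ = φ G * (φ H + p • φ Z) := by
    rw [fold_eq_add γ c, hφ, hφ, hGH, hDZ, map_mul, map_mul, mul_add, Matrix.mul_smul]
  have hmid : (φ H + p • φ Z) * (p • φ (1 - Z) + φ (Z - H * Z))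
      = p • (1 : Matrix (Fin n) (Fin n) ℂ[X]) := by
    rw [add_mul, mul_add, mul_add, Matrix.mul_smul, Matrix.mul_smul, Matrix.smul_mul,
      Matrix.smul_mul, ← map_mul, ← map_mul, ← map_mul, ← map_mul, hH1, mul_sub, mul_sub,
      mul_sub, ← mul_assoc H H Z, hHH, ← mul_assoc Z H Z, hZH, hZZ]
    simp [smul_sub]
  rw [hL, mul_assoc, ← mul_assoc (φ H + p • φ Z), hmid, Matrix.smul_mul, one_mul,
    Matrix.mul_smul, ← map_mul, Matrix.mul_nonsing_inv _ (isUnit_iff_ne_zero.2 hGdet), map_one]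

/-- At λ = μ the relation g Y = λ - λ₀ exhibits an inverse up to the nonzero scalar μ - λ₀. -/
theorem det_ev_gam_ne_zero (hk : 1 ≤ k) (hkn : k < n) {x : XX n k} (hx : x.Good) {μ : ℂ}
    (hμ : μ ≠ lam k x.t) : (ev (gam x) μ).det ≠ 0 := by
  obtain ⟨Y, hY⟩ := exists_fold_gam_mul hk hkn hx
  have h1 := congrArg (evalRingHom μ).mapMatrix hY
  rw [map_mul] at h1
  have h2 : (evalRingHom μ).mapMatrix (fold (gam x)) = ev (gam x) μ := map_eval_fold _ _
  have h3 : (evalRingHom μ).mapMatrix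
      ((X - C (lam k x.t)) • (1 : Matrix (Fin n) (Fin n) ℂ[X])) =
      (μ - lam k x.t) • (1 : Matrix (Fin n) (Fin n) ℂ) := by
    refine Matrix.ext fun i j => ?_
    by_cases hij : i = j
    · subst hij; simp
    · simp [hij]
  rw [h2, h3] at h1
  intro h0
  have h4 := congrArg Matrix.det h1
  rw [Matrix.det_mul, h0, zero_mul, Matrix.det_smul, Matrix.det_one, mul_one] at h4
  exact pow_ne_zero _ (sub_ne_zero.2 hμ) h4.symm

/-- Left division by `g(N|t)`. -/
theorem exists_eq_fold_gam_mul (hk : 1 ≤ k) (hkn : k < n) {x : XX n k} (hx : x.Good)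
    (A : Matrix (Fin n) (Fin n) ℂ[X]) (hA : ∀ j, (A.map (eval (lam k x.t))).col j ∈ x.N) :
    ∃ B, A = fold (gam x) * B := by
  obtain ⟨Y, hY⟩ := exists_fold_gam_mul hk hkn hx
  set c := lam k x.t
  have h1 : ∀ i j, ∃ q : ℂ[X], A i j = C ((A i j).eval c) + (X - C c) * q := by
    intro i j
    obtain ⟨q, hq⟩ := X_sub_C_dvd_sub_C_eval (a := c) (p := A i j)
    exact ⟨q, by rw [← hq]; ring⟩
  choose q hq using h1
  have h2 : ∀ j, ∃ w : Fin n → ℂ, (ev (gam x) c).mulVec w = (A.map (eval c)).col j := by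
    intro j
    have := hA j
    rw [← span_col_ev_gam hk hkn hx, mem_span_range_col_iff] at this
    exact this
  choose w hw using h2
  set Q : Matrix (Fin n) (Fin n) ℂ[X] := Matrix.of q
  set W : Matrix (Fin n) (Fin n) ℂ := Matrix.of fun i j => w j i
  have hAQ : A = (ev (gam x) c * W).map C + (X - C c) • Q := by
    refine Matrix.ext fun i j => ?_
    rw [Matrix.add_apply, Matrix.map_apply, Matrix.smul_apply, smul_eq_mul]
    conv_lhs => rw [hq i j]
    have : (ev (gam x) c * W) i j = eval c (A i j) := congrFun (hw j) i
    rw [this]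
    rfl
  -- Write L for the linear part, so that g = g(λ₀) + (λ - λ₀)L and A = g(λ₀)W + (λ - λ₀)Q. Then A =
  -- gW + (λ - λ₀)(Q - LW), and λ - λ₀ = gY.
  refine ⟨W.map C + Y * (Q - (linPart (gam x)).map C * W.map C), ?_⟩
  rw [mul_add, ← mul_assoc, hY, Matrix.smul_mul, one_mul]
  conv_lhs => rw [hAQ]
  rw [fold_eq_add (gam x) c, Matrix.map_mul, add_mul, Matrix.smul_mul, smul_sub]
  abel

end Division

end GeomCrystal

namespace GeomCrystal

/-! ### Unfolded coefficients -/

section Arr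

variable {n : ℕ} [NeZero n]

/-- The entries of the `n`-periodic `ℤ × ℤ` matrix obtained by unfolding `A`. -/
noncomputable def arr (A : Matrix (Fin n) (Fin n) ℂ[X]) (r c : ℤ) : ℂ :=
  if c / n ≤ r / n then (A (cyc n r) (cyc n c)).coeff (r / n - c / n).toNat else 0

theorem cyc_add_mul_ediv (r : ℤ) : ((cyc n r : Fin n) : ℤ) + n * (r / n) = r := by
  rw [cyc_val, add_comm]
  exact Int.mul_ediv_add_emod r n

theorem cyc_fin_add (i : Fin n) (b : ℤ) : cyc n ((i : ℤ) + n * b) = i := by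
  rw [cyc_eq_iff]
  exact (Int.modEq_iff_dvd.2 ⟨b, by ring⟩)

theorem fin_add_ediv (i : Fin n) (b : ℤ) : ((i : ℤ) + n * b) / n = b := by
  have h : (n : ℤ) ≠ 0 := by exact_mod_cast NeZero.ne n
  rw [Int.add_mul_ediv_left _ _ h, Int.ediv_eq_zero_of_lt (by positivity) (by exact_mod_cast i.2),
    zero_add]

/-- Unfolding is multiplicative: writing l as a residue plus n times a block index, the sum over
residues is the matrix product and the sum over block indices is the Cauchy product of polynomials
in λ. -/
theorem arr_mul (A B : Matrix (Fin n) (Fin n) ℂ[X]) (r c : ℤ) :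
    arr (A * B) r c = ∑ᶠ l : ℤ, arr A r l * arr B l c := by
  let e : ℤ × Fin n ≃ ℤ :=
    { toFun := fun p => (p.2 : ℤ) + n * p.1
      invFun := fun l => (l / n, cyc n l)
      left_inv := fun p => Prod.ext (fin_add_ediv _ _) (cyc_fin_add _ _)
      right_inv := fun l => cyc_add_mul_ediv l }
  rw [← finsum_comp_equiv e]
  have hterm : ∀ p : ℤ × Fin n, arr A r (e p) * arr B (e p) c
      = if c / n ≤ p.1 ∧ p.1 ≤ r / n then
          (A (cyc n r) p.2).coeff (r / n - p.1).toNat *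
            (B p.2 (cyc n c)).coeff (p.1 - c / n).toNat else 0 := by
    rintro ⟨b, l⟩
    simp only [e, Equiv.coe_fn_mk, arr, cyc_fin_add, fin_add_ediv]
    by_cases h1 : b ≤ r / n <;> by_cases h2 : c / n ≤ b <;> simp [h1, h2]
  rw [finsum_eq_sum_of_support_subset (s := Finset.Icc (c / n) (r / n) ×ˢ Finset.univ)]
  · rw [Finset.sum_product_right]
    rw [show arr (A * B) r c = if c / (n : ℤ) ≤ r / n then
      ((A * B) (cyc n r) (cyc n c)).coeff (r / (n : ℤ) - c / n).toNat else 0 from rfl]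
    split_ifs with hrc
    · rw [Matrix.mul_apply, finsetSum_coeff]
      refine Finset.sum_congr rfl fun l _ => ?_
      rw [coeff_mul]
      refine Finset.sum_bij' (fun p _ => r / n - (p.1 : ℤ))
        (fun b _ => ((r / n - b).toNat, (b - c / n).toNat)) ?_ ?_ ?_ ?_ ?_
      · intro p hp
        rw [Finset.HasAntidiagonal.mem_antidiagonal] at hp
        rw [Finset.mem_Icc]
        omega
      · intro b hb
        rw [Finset.mem_Icc] at hb
        rw [Finset.HasAntidiagonal.mem_antidiagonal]
        simp only
        omega
      · intro p hp
        rw [Finset.HasAntidiagonal.mem_antidiagonal] at hp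
        ext <;> simp only <;> omega
      · intro b hb
        rw [Finset.mem_Icc] at hb
        simp only
        omega
      · intro p hp
        rw [Finset.HasAntidiagonal.mem_antidiagonal] at hp
        have := hterm (r / n - (p.1 : ℤ), l)
        rw [this, if_pos (by simp only; omega)]
        congr 2 <;> omega
    · refine (Finset.sum_eq_zero fun l _ => Finset.sum_eq_zero fun b hb => ?_).symm
      rw [Finset.mem_Icc] at hb
      omega
  · intro p hp
    rw [Function.mem_support, hterm] at hp
    simp only [Finset.coe_product, Finset.coe_Icc, Finset.coe_univ, Set.mem_prod, Set.mem_Icc,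
      Set.mem_univ, and_true]
    by_contra h
    exact hp (if_neg h)

/-- Unfolded banded matrices of width `w`, with lowest entries equal to `1`. -/
structure Band (w : ℤ) (A : Matrix (Fin n) (Fin n) ℂ[X]) : Prop where
  lower : ∀ r c, r < c → arr A r c = 0
  upper : ∀ r c, c + w < r → arr A r c = 0
  lead : ∀ c, arr A (c + w) c = 1

theorem Band.mul {w w' : ℤ} {A B : Matrix (Fin n) (Fin n) ℂ[X]} (hA : Band w A) (hB : Band w' B) :
    Band (w + w') (A * B) where
  lower r c h := by
    rw [arr_mul]
    refine (finsum_congr fun l => ?_).trans finsum_zero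
    rcases lt_or_ge r l with h1 | h1
    · rw [hA.lower r l h1, zero_mul]
    · rw [hB.lower l c (by omega), mul_zero]
  upper r c h := by
    rw [arr_mul]
    refine (finsum_congr fun l => ?_).trans finsum_zero
    rcases lt_or_ge (l + w) r with h1 | h1
    · rw [hA.upper r l h1, zero_mul]
    · rw [hB.upper l c (by omega), mul_zero]
  lead c := by
    rw [arr_mul, finsum_eq_single _ (c + w')]
    · rw [hB.lead, mul_one, show c + (w + w') = c + w' + w by ring, hA.lead]
    · intro l hl
      rcases lt_or_ge (l + w) (c + (w + w')) with h1 | h1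
      · rw [hA.upper _ l h1, zero_mul]
      · rw [hB.upper l c (by omega), mul_zero]

theorem Band.arr_mul_self {w w' : ℤ} {A B : Matrix (Fin n) (Fin n) ℂ[X]} (hA : Band w A)
    (hB : Band w' B) (c : ℤ) : arr (A * B) c c = arr A c c * arr B c c := by
  rw [arr_mul, finsum_eq_single _ c]
  intro l hl
  rcases lt_or_ge c l with h1 | h1
  · rw [hA.lower _ l h1, zero_mul]
  · rw [hB.lower l c (by omega), mul_zero]

/-- Together with the diagonal case, this is all the information taken from the matrix identity
g(u)g(v) = g(v')g(u') when the scalars in the e_0-formula are compared. -/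
theorem Band.arr_mul_succ {w w' : ℤ} {A B : Matrix (Fin n) (Fin n) ℂ[X]} (hA : Band w A)
    (hB : Band w' B) (c : ℤ) : arr (A * B) (c + 1) c
      = arr A (c + 1) c * arr B c c + arr A (c + 1) (c + 1) * arr B (c + 1) c := by
  rw [arr_mul, finsum_eq_sum_of_support_subset (s := {c, c + 1})]
  · rw [Finset.sum_pair (by omega)]
  · intro l hl
    rw [Function.mem_support] at hl
    by_contra h
    have h' : l ≠ c ∧ l ≠ c + 1 := by simpa using h
    apply hl
    rcases lt_or_ge (c + 1) l with h1 | h1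
    · rw [hA.lower _ l h1, zero_mul]
    · rw [hB.lower l c (by omega), mul_zero]

theorem arr_eq_zero_of_lt (A : Matrix (Fin n) (Fin n) ℂ[X]) {r c : ℤ} (h : r < n * (c / n)) :
    arr A r c = 0 := by
  rw [arr, if_neg]
  intro h1
  have hn : (0 : ℤ) < n := by exact_mod_cast NeZero.pos n
  have h2 := Int.mul_ediv_self_le (x := r) (k := n) hn.ne'
  have h3 : (n : ℤ) * (c / n) ≤ n * (r / n) := mul_le_mul_of_nonneg_left h1 hn.le
  omega

/-- Polynomial entries make every unfolded column finite downwards, as needed for choosing an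
extremal row in `Band.of_mul`. -/
theorem exists_arr_eq_zero (A : Matrix (Fin n) (Fin n) ℂ[X]) (c : ℤ) :
    ∃ N : ℤ, ∀ r, N < r → arr A r c = 0 := by
  have hn : (0 : ℤ) < n := by exact_mod_cast NeZero.pos n
  set d : ℕ := Finset.univ.sup fun i => (A i (cyc n c)).natDegree with hd
  refine ⟨n * (c / n + d + 1), fun r hr => ?_⟩
  rw [arr]
  split_ifs with h
  · apply coeff_eq_zero_of_natDegree_lt
    have h1 : (A (cyc n r) (cyc n c)).natDegree ≤ d :=
      Finset.le_sup (f := fun i => (A i (cyc n c)).natDegree) (Finset.mem_univ _)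
    have h2 : c / n + d + 1 ≤ r / n := by
      rw [Int.le_ediv_iff_mul_le hn, mul_comm]
      exact hr.le
    omega
  · rfl

/-- A right factor of a banded matrix is banded. -/
theorem Band.of_mul {w w' : ℤ} {A B : Matrix (Fin n) (Fin n) ℂ[X]} (hA : Band w A)
    (hA0 : ∀ c, arr A c c ≠ 0) (hAB : Band (w + w') (A * B)) : Band w' B := by
  have hlow : ∀ r c, r < c → arr B r c = 0 := by
    intro r c hrc
    by_contra h0
    -- For the topmost offending row m, the entry (m, c) of A * B has the single term A(m,m) B(m,c):
    -- earlier rows of B vanish there by minimality and later ones are killed by A.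
    obtain ⟨m, ⟨hm1, hm2⟩, hmin⟩ := Int.exists_least_of_bdd (P := fun r => r < c ∧ arr B r c ≠ 0)
      ⟨n * (c / n), fun z hz => by
        by_contra hlt
        exact hz.2 (arr_eq_zero_of_lt B (not_le.1 hlt))⟩ ⟨r, hrc, h0⟩
    have h1 := hAB.lower m c hm1
    rw [arr_mul, finsum_eq_single _ m] at h1
    · exact mul_ne_zero (hA0 m) hm2 h1
    · intro l hl
      rcases lt_or_ge m l with h2 | h2
      · rw [hA.lower m l h2, zero_mul]
      · have : arr B l c = 0 := by
          by_contra h3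
          have := hmin l ⟨by omega, h3⟩
          omega
        rw [this, mul_zero]
  have hup : ∀ r c, c + w' < r → arr B r c = 0 := by
    intro r c hrc
    by_contra h0
    obtain ⟨N, hN⟩ := exists_arr_eq_zero B c
    -- Mirror argument with the bottommost offending row, now using the leading entries 1 of A in
    -- row m + w.
    obtain ⟨m, ⟨hm1, hm2⟩, hmax⟩ := Int.exists_greatest_of_bdd
      (P := fun r => c + w' < r ∧ arr B r c ≠ 0)
      ⟨N, fun z hz => by
        by_contra hlt
        exact hz.2 (hN z (not_le.1 hlt))⟩ ⟨r, hrc, h0⟩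
    have h1 := hAB.upper (m + w) c (by omega)
    rw [arr_mul, finsum_eq_single _ m] at h1
    · rw [hA.lead, one_mul] at h1
      exact hm2 h1
    · intro l hl
      rcases lt_or_ge (l + w) (m + w) with h2 | h2
      · rw [hA.upper _ l h2, zero_mul]
      · have : arr B l c = 0 := by
          by_contra h3
          have := hmax l ⟨by omega, h3⟩
          omega
        rw [this, mul_zero]
  refine ⟨hlow, hup, fun c => ?_⟩
  have h1 := hAB.lead c
  rw [arr_mul, finsum_eq_single _ (c + w'), show c + (w + w') = c + w' + w by ring, hA.lead,
    one_mul] at h1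
  · exact h1
  · intro l hl
    rcases lt_or_ge (l + w) (c + (w + w')) with h2 | h2
    · rw [hA.upper _ l h2, zero_mul]
    · rw [hup l c (by omega), mul_zero]

/-- Since the width is less than n, the band meets only the blocks d = 0 (constant terms, on or
below the diagonal) and d = 1 (coefficients of λ, above it). -/
theorem arr_fold_of_band {k : ℕ} (hk : 1 ≤ k) {γ : Matrix (Fin n) (Fin n) ℂ} (h : Loop k γ)
    (r c : ℤ) : arr (fold γ) r c
      = if c ≤ r ∧ r ≤ c + (n - k) then γ (cyc n r) (cyc n c) else 0 := by
  have hn : (0 : ℤ) < n := by exact_mod_cast NeZero.pos n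
  have hr := cyc_add_mul_ediv (n := n) r
  have hc := cyc_add_mul_ediv (n := n) c
  have hi := (cyc n r).2
  have hj := (cyc n c).2
  have hz := h.zero (cyc n r) (cyc n c)
  set i := cyc n r
  set j := cyc n c
  obtain ⟨d, hrd⟩ : ∃ d, r / (n : ℤ) = c / n + d := ⟨r / n - c / n, by ring⟩
  have hfold : arr (fold γ) r c
      = if c / (n : ℤ) ≤ r / n then (fold γ i j).coeff (r / (n : ℤ) - c / n).toNat else 0 := rfl
  rw [hrd] at hr hfold
  rw [hfold]
  set b := c / (n : ℤ)
  have hcase : d ≤ -1 ∨ d = 0 ∨ d = 1 ∨ 2 ≤ d := by omega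
  have e : r - c = (i : ℤ) - j + n * d := by rw [← hr, ← hc]; ring
  rw [add_sub_cancel_left]
  simp only [fold, Matrix.of_apply]
  rcases hcase with hd | rfl | rfl | hd
  · have : (n : ℤ) * d ≤ n * (-1) := mul_le_mul_of_nonneg_left hd hn.le
    rw [if_neg (by omega), if_neg (by omega)]
  · rw [if_pos (by omega)]
    rcases le_or_gt j i with hji | hji
    · rw [off_of_le hji] at hz
      rw [if_pos hji]
      simp only [Int.toNat_zero, coeff_C_zero]
      rw [Fin.le_def] at hji
      split_ifs with h1
      · rfl
      · by_contra h0
        have := hz h0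
        omega
    · rw [if_neg (not_le.2 hji)]
      rw [Fin.lt_def] at hji
      rw [if_neg (by omega)]
      simp
  · rw [if_pos (by omega)]
    rcases le_or_gt j i with hji | hji
    · rw [if_pos hji]
      rw [Fin.le_def] at hji
      rw [if_neg (by omega)]
      simp
    · rw [off_of_lt hji] at hz
      rw [if_neg (not_le.2 hji)]
      rw [Fin.lt_def] at hji
      have : (X * C (γ i j) : ℂ[X]).coeff (1 : ℤ).toNat = γ i j := by
        simpa using coeff_X_mul (C (γ i j)) 0
      rw [this]
      split_ifs with h1
      · rfl
      · by_contra h0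
        have := hz h0
        omega
  · have : (n : ℤ) * 2 ≤ n * d := mul_le_mul_of_nonneg_left hd hn.le
    rw [if_pos (by omega), if_neg (show ¬(c ≤ r ∧ r ≤ c + (n - k)) by omega)]
    obtain ⟨m, hm⟩ : ∃ m : ℕ, d.toNat = m + 1 + 1 := ⟨d.toNat - 2, by omega⟩
    rw [hm]
    split_ifs
    · simp
    · rw [coeff_X_mul, coeff_C_succ]

theorem Loop.band {k : ℕ} (hk : 1 ≤ k) (hkn : k < n) {γ : Matrix (Fin n) (Fin n) ℂ}
    (h : Loop k γ) : Band (n - k) (fold γ) where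
  lower r c hrc := by rw [arr_fold_of_band hk h, if_neg (by omega)]
  upper r c hrc := by rw [arr_fold_of_band hk h, if_neg (by omega)]
  lead c := by
    rw [arr_fold_of_band hk h, if_pos (by omega)]
    apply h.lead
    rw [off_cyc, add_sub_cancel_left, Int.emod_eq_of_lt] <;> omega

theorem arr_fin (A : Matrix (Fin n) (Fin n) ℂ[X]) (i j : Fin n) (m : ℕ) :
    arr A ((i : ℤ) + n * m) j = (A i j).coeff m := by
  have h1 : (j : ℤ) / n = 0 := by simpa using fin_add_ediv j 0
  have h2 : cyc n (j : ℤ) = j := cyc_coe j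
  rw [arr, fin_add_ediv, cyc_fin_add, h1, h2, if_pos (by positivity)]
  simp

/-- A banded matrix of width less than `n` has the shape of `g(N|t)`. -/
theorem Band.exists_loop {k : ℕ} (hk : 1 ≤ k) {A : Matrix (Fin n) (Fin n) ℂ[X]}
    (h : Band (n - k) A) : ∃ γ, Loop k γ ∧ A = fold γ := by
  have hn : (0 : ℤ) < n := by exact_mod_cast NeZero.pos n
  have h0 : ∀ i j : Fin n, (A i j).coeff 0 = arr A i j := fun i j => by
    simpa using (arr_fin A i j 0).symm
  have h1 : ∀ i j : Fin n, (A i j).coeff 1 = arr A (i + n) j := fun i j => by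
    simpa using (arr_fin A i j 1).symm
  refine ⟨Matrix.of fun i j => if j ≤ i then arr A i j else arr A (i + n) j,
    ⟨fun i j hij => ?_, fun i j hij => ?_⟩, ?_⟩
  · rw [Matrix.of_apply] at hij
    by_contra hlt
    apply hij
    split_ifs with hji
    · rw [off_of_le hji] at hlt
      exact h.upper _ _ (by omega)
    · rw [off_of_lt (not_le.1 hji)] at hlt
      exact h.upper _ _ (by omega)
  · rw [Matrix.of_apply]
    split_ifs with hji
    · rw [off_of_le hji] at hij
      rw [show (i : ℤ) = j + (n - k) by omega]
      exact h.lead _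
    · rw [off_of_lt (not_le.1 hji)] at hij
      rw [show (i : ℤ) + n = j + (n - k) by omega]
      exact h.lead _
  · refine Matrix.ext fun i j => Polynomial.ext fun m => ?_
    have hi := i.2
    have hj := j.2
    simp only [fold, Matrix.of_apply]
    rcases m with _ | _ | m
    · rw [h0]
      split_ifs with hji
      · simp
      · rw [h.lower _ _ (by rw [Fin.le_def] at hji; omega)]; simp
    · rw [zero_add, h1]
      split_ifs with hji
      · rw [h.upper _ _ (by rw [Fin.le_def] at hji; omega)]; simp
      · simpa using (coeff_X_mul (C (arr A (i + n) j)) 0).symm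
    · rw [← arr_fin, h.upper]
      · split_ifs
        · simp
        · rw [coeff_X_mul, coeff_C_succ]
      · have : (n : ℤ) * 2 ≤ n * ((m + 1 + 1 : ℕ) : ℤ) :=
          mul_le_mul_of_nonneg_left (by omega) hn.le
        omega

end Arr

end GeomCrystal

namespace GeomCrystal

/-! ### The flip and the factorisation g(u)g(v) = g(v')g(u') -/

section RMatrix

variable {n : ℕ}

theorem XX.ext' {k : ℕ} {x y : XX n k} (hN : x.N = y.N) (ht : x.t = y.t) : x = y := by
  cases x
  cases y
  simp only at hN ht
  subst hN
  subst ht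
  rfl

theorem mkPt_eq_some {k : ℕ} {N : Submodule ℂ (Fin n → ℂ)} {t : ℂˣ} (y : XX n k) (hN : y.N = N)
    (ht : y.t = t) : mkPt k N t = Part.some y := by
  subst hN
  subst ht
  exact Part.eq_some_iff.2 ⟨y.finrank_N, rfl⟩

theorem map_eval_mul (A B : Matrix (Fin n) (Fin n) ℂ[X]) (μ : ℂ) :
    (A * B).map (eval μ) = A.map (eval μ) * B.map (eval μ) :=
  map_mul ((evalRingHom μ).mapMatrix) A B

/-! #### The flip -/

/-- The flip of a complex matrix. -/
def cflip (Y : Matrix (Fin n) (Fin n) ℂ) : Matrix (Fin n) (Fin n) ℂ :=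
  Matrix.of fun i j => Y (Fin.rev j) (Fin.rev i)

theorem off_rev (i j : Fin n) : off (Fin.rev j) (Fin.rev i) = off i j := by
  rw [off, off, Fin.val_rev, Fin.val_rev]
  congr 1
  have := i.2
  have := j.2
  omega

theorem cflip_cflip (Y : Matrix (Fin n) (Fin n) ℂ) : cflip (cflip Y) = Y := by
  ext i j
  simp [cflip]

theorem cflip_mul (Y Z : Matrix (Fin n) (Fin n) ℂ) : cflip (Y * Z) = cflip Z * cflip Y := by
  ext i j
  simp only [cflip, Matrix.of_apply, Matrix.mul_apply]
  rw [← Equiv.sum_comp Fin.revPerm]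
  exact Finset.sum_congr rfl fun l _ => by simp [mul_comm]

theorem flip_fold (γ : Matrix (Fin n) (Fin n) ℂ) : flip (fold γ) = fold (cflip γ) := by
  refine Matrix.ext fun i j => ?_
  simp only [flip, fold, cflip, Matrix.of_apply, Fin.rev_le_rev]

theorem ev_cflip (γ : Matrix (Fin n) (Fin n) ℂ) (μ : ℂ) : ev (cflip γ) μ = cflip (ev γ μ) := by
  ext i j
  simp only [ev, cflip, Matrix.of_apply, Fin.rev_le_rev]

theorem rank_cflip (Y : Matrix (Fin n) (Fin n) ℂ) : (cflip Y).rank = Y.rank := by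
  have : cflip Y = (Y.transpose).submatrix (Fin.revPerm : Fin n ≃ Fin n) (Fin.revPerm) := by
    ext i j
    rfl
  rw [this, Matrix.rank_submatrix, Matrix.rank_transpose]

theorem det_cflip (Y : Matrix (Fin n) (Fin n) ℂ) : (cflip Y).det = Y.det := by
  have : cflip Y = (Y.transpose).submatrix (Fin.revPerm : Fin n ≃ Fin n) (Fin.revPerm) := by
    ext i j
    rfl
  rw [this, Matrix.det_submatrix_equiv_self, Matrix.det_transpose]

theorem Loop.cflip {k : ℕ} {γ : Matrix (Fin n) (Fin n) ℂ} (h : Loop k γ) : Loop k (cflip γ) where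
  zero i j hij := off_rev i j ▸ h.zero _ _ hij
  lead i j hij := h.lead _ _ ((off_rev i j).trans hij)

variable {k : ℕ}

theorem rank_ev_gam (hk : 1 ≤ k) (hkn : k < n) {x : XX n k} (hx : x.Good) :
    (ev (gam x) (lam k x.t)).rank = k := by
  rw [Matrix.rank_eq_finrank_span_cols, span_col_ev_gam hk hkn hx, x.finrank_N]

/-- A good point is determined by its matrix. -/
theorem XX.eq_of_gam (hk : 1 ≤ k) (hkn : k < n) {x y : XX n k} (hx : x.Good) (hy : y.Good)
    (ht : x.t = y.t) (h : gam x = gam y) : x = y := by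
  refine XX.ext' ?_ ht
  rw [← span_col_ev_gam hk hkn hx, ← span_col_ev_gam hk hkn hy, h, ht]

/-- The Schützenberger involution corresponds to the flip of matrices. -/
theorem exists_schutz_eq (hk : 1 ≤ k) (hkn : k < n) {x : XX n k} (hx : x.Good) :
    ∃ y : XX n k, schutz x = Part.some y ∧ y.t = x.t ∧ y.Good ∧ gam y = cflip (gam x) := by
  obtain ⟨y, hyt, hy, hyg, hyN⟩ := (loop_gam hk hkn hx).cflip.exists_eq_gam hk hkn x.t
    (by rw [ev_cflip, rank_cflip, rank_ev_gam hk hkn hx])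
  refine ⟨y, ?_, hyt, hy, hyg.symm⟩
  rw [schutz, gMat_eq_some hk hkn hx]
  change (Part.some _).bind _ = _
  rw [Part.bind_some, evalProj]
  refine mkPt_eq_some y ?_ hyt
  rw [flip_fold, map_eval_fold, hyg, ← span_first_cols hk hkn hy, hyt]
  rfl

theorem span_col_mul {m : ℕ} (Y : Matrix (Fin n) (Fin n) ℂ) (Z : Matrix (Fin n) (Fin m) ℂ)
    (S : Set (Fin m)) : Submodule.span ℂ ((Y * Z).col '' S)
      = (Submodule.span ℂ (Z.col '' S)).map Y.mulVecLin := by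
  rw [Submodule.map_span, ← Set.image_comp]
  congr 1

theorem exists_map_eq {x : XX n k} {Y : Matrix (Fin n) (Fin n) ℂ} (hY : Y.det ≠ 0) :
    ∃ y : XX n k, y.t = x.t ∧ y.N = x.N.map Y.mulVecLin := by
  refine ⟨⟨x.N.map Y.mulVecLin, ?_, x.t⟩, rfl, rfl⟩
  have hinj : Function.Injective Y.mulVecLin := Matrix.mulVec_injective_of_det_ne_zero hY
  rw [← (Submodule.equivMapOfInjective _ hinj x.N).finrank_eq, x.finrank_N]

/-- The first k columns of g(v) already span v.N at the special value, so Ψ(u, ·) is the action of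
g(u), evaluated there, on the subspace. -/
theorem Psi_eq {l : ℕ} (hl : 1 ≤ l) (hln : l < n) (hk : 1 ≤ k) (hkn : k < n) {u : XX n l}
    {v v' : XX n k} (hu : u.Good) (hv : v.Good) (ht : v'.t = v.t)
    (hN : v'.N = v.N.map (ev (gam u) (lam k v.t)).mulVecLin) : Psi u v = Part.some v' := by
  rw [Psi, gMat_eq_some hl hln hu]
  change (Part.some _).bind _ = _
  rw [Part.bind_some, gMat_eq_some hk hkn hv]
  change (Part.some _).bind _ = _
  rw [Part.bind_some, evalProj]
  refine mkPt_eq_some v' ?_ ht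
  rw [map_eval_mul, span_col_mul, hN, map_eval_fold, map_eval_fold]
  have := span_first_cols hk hkn hv
  rw [lam] at this ⊢
  rw [this]

/-- Adjoining j to the low set gives the denominator set of the next column. Diagonal entries of g
are therefore quotients of consecutive cyclic Plücker coordinates, up to a factor t, and do not
vanish. -/
theorem off_succ_base [NeZero n] (hk : 1 ≤ k) (hkn : k < n) (j : Fin n) :
    insert j (lowSet k j) = baseSet k (cyc n ((j : ℤ) + 1)) := by
  ext a
  rw [Finset.mem_insert, mem_lowSet hk hkn, mem_baseSet hk hkn]
  have h1 : off a (cyc n ((j : ℤ) + 1)) = ((a : ℤ) - (j + 1)) % n := by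
    conv_lhs => rw [← cyc_coe a]
    rw [off_cyc]
  have h2 := off_nonneg a j
  have h3 := off_lt a j
  have h4 : (a : ℤ) - (j + 1) ≡ off a j + (n - 1) [ZMOD n] := by
    have h5 : off a j + (n - 1) ≡ (a : ℤ) - j + (n - 1) [ZMOD n] :=
      (Int.mod_modEq _ _).add_right _
    refine Int.ModEq.trans ?_ h5.symm
    exact Int.modEq_iff_dvd.2 ⟨1, by ring⟩
  have h6 : a = j ↔ off a j = 0 := by
    constructor
    · rintro rfl
      rw [off_of_le le_rfl, sub_self]
    · intro h
      apply off_inj_left (j := j)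
      rw [h, off_of_le le_rfl, sub_self]
  rw [h1, emod_shift h2 h3 (by omega) (by omega) h4, h6]
  split_ifs <;> omega

theorem gam_diag_ne_zero (hk : 1 ≤ k) (hkn : k < n) {x : XX n k} (hx : x.Good) (j : Fin n) :
    gam x j j ≠ 0 := by
  have : NeZero n := ⟨by omega⟩
  rw [gam, Matrix.of_apply, off_succ_base hk hkn]
  refine mul_ne_zero ?_ (div_ne_zero (hx _) (hx _))
  split_ifs
  · exact x.t.ne_zero
  · exact one_ne_zero

variable [NeZero n]

theorem arr_fold_diag {k : ℕ} (hk : 1 ≤ k) (hkn : k < n) {γ : Matrix (Fin n) (Fin n) ℂ}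
    (h : Loop k γ) (c : ℤ) : arr (fold γ) c c = γ (cyc n c) (cyc n c) := by
  rw [arr_fold_of_band hk h, if_pos (by omega)]

theorem arr_fold_succ {k : ℕ} (hk : 1 ≤ k) (hkn : k < n) {γ : Matrix (Fin n) (Fin n) ℂ}
    (h : Loop k γ) (c : ℤ) : arr (fold γ) (c + 1) c = γ (cyc n (c + 1)) (cyc n c) := by
  rw [arr_fold_of_band hk h, if_pos (by omega)]

/-- The geometric `R`-matrix satisfies the matrix identity `g(u)g(v) = g(v')g(u')`. -/
theorem exists_geomR_eq {k₁ k₂ : ℕ} (hk₁ : 1 ≤ k₁) (hk₁n : k₁ < n) (hk₂ : 1 ≤ k₂) (hk₂n : k₂ < n)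
    {u : XX n k₁} {v : XX n k₂} (hu : u.Good) (hv : v.Good)
    (hne : lam k₁ u.t ≠ lam k₂ v.t)
    (hgood : ∀ j : Fin n, ∀ y ∈ v.N.map (ev (gam u) (lam k₂ v.t)).mulVecLin,
      (∀ i ∈ baseSet k₂ j, y i = 0) → y = 0) :
    ∃ (v' : XX n k₂) (u' : XX n k₁), geomR u v = Part.some (v', u') ∧ v'.t = v.t ∧ u'.t = u.t ∧
      v'.Good ∧ u'.Good ∧ fold (gam u) * fold (gam v) = fold (gam v') * fold (gam u') ∧
      v'.N = v.N.map (ev (gam u) (lam k₂ v.t)).mulVecLin := by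
  -- As the special values differ, g(u) is invertible at the special value of v and carries v.N to a
  -- space of the same dimension.
  obtain ⟨v', hv't, hv'N⟩ := exists_map_eq (x := v)
    (det_ev_gam_ne_zero hk₁ hk₁n hu (μ := lam k₂ v.t) hne.symm)
  have hv' : v'.Good := fun j =>
    (v'.maxMinor_rep_ne_zero_iff (card_baseSet hk₂n j)).2 (hv'N ▸ hgood j)
  obtain ⟨B, hB⟩ := exists_eq_fold_gam_mul hk₂ hk₂n hv' (fold (gam u) * fold (gam v)) (by
    intro j
    rw [hv't, hv'N, map_eval_mul, map_eval_fold, map_eval_fold]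
    exact ⟨_, col_ev_gam_mem hk₂ hk₂n j, rfl⟩)
  have hlu := loop_gam hk₁ hk₁n hu
  have hlv := loop_gam hk₂ hk₂n hv
  have hlv' := loop_gam hk₂ hk₂n hv'
  have hBand : Band (n - k₁ : ℤ) B := by
    refine (hlv'.band hk₂ hk₂n).of_mul (fun c => ?_) ?_
    · rw [arr_fold_diag hk₂ hk₂n hlv']
      exact gam_diag_ne_zero hk₂ hk₂n hv' _
    · rw [← hB, add_comm]
      exact (hlu.band hk₁ hk₁n).mul (hlv.band hk₂ hk₂n)
  obtain ⟨β, hβ, rfl⟩ := hBand.exists_loop hk₁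
  have hev : ev (gam u) (lam k₁ u.t) * ev (gam v) (lam k₁ u.t)
      = ev (gam v') (lam k₁ u.t) * ev β (lam k₁ u.t) := by
    have := congrArg (fun A => A.map (eval (lam k₁ u.t))) hB
    simpa only [map_eval_mul, map_eval_fold] using this
  have hdv : (ev (gam v) (lam k₁ u.t)).det ≠ 0 := det_ev_gam_ne_zero hk₂ hk₂n hv hne
  have hdv' : (ev (gam v') (lam k₁ u.t)).det ≠ 0 :=
    det_ev_gam_ne_zero hk₂ hk₂n hv' (by rw [hv't]; exact hne)
  -- At the special value of u both g(v) and g(v') are invertible, so the quotient has the same rank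
  -- k₁ as g(u).
  have hrank : (ev β (lam k₁ u.t)).rank ≤ k₁ := by
    have h1 := congrArg Matrix.rank hev
    rw [Matrix.rank_mul_eq_left_of_isUnit_det _ _ (isUnit_iff_ne_zero.2 hdv),
      Matrix.rank_mul_eq_right_of_isUnit_det _ _ (isUnit_iff_ne_zero.2 hdv'),
      rank_ev_gam hk₁ hk₁n hu] at h1
    exact h1.ge
  obtain ⟨u', hu't, hu', rfl, -⟩ := hβ.exists_eq_gam hk₁ hk₁n u.t hrank
  refine ⟨v', u', ?_, hv't, hu't, hv', hu', hB, hv'N⟩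
  obtain ⟨sv, hsv, hsvt, hsvg, hsvγ⟩ := exists_schutz_eq hk₂ hk₂n hv
  obtain ⟨su, hsu, hsut, hsug, hsuγ⟩ := exists_schutz_eq hk₁ hk₁n hu
  obtain ⟨w, hw, hwt, hwg, hwγ⟩ := exists_schutz_eq hk₁ hk₁n hu'
  obtain ⟨z, hz, hzt, hzg, hzγ⟩ := exists_schutz_eq hk₁ hk₁n hwg
  have hzu : z = u' := by
    refine XX.eq_of_gam hk₁ hk₁n hzg hu' (hzt.trans hwt) ?_
    rw [hzγ, hwγ, cflip_cflip]
  -- The flip reverses products: at the special value of u, g(Sv)g(Su) = g(Su')·fl(g(v')) with the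
  -- last factor invertible. Hence Ψ(Sv, Su) = S(u'), and applying S once more returns u' because
  -- the flip is an involution.
  have hPsi2 : Psi sv su = Part.some w := by
    refine Psi_eq hk₂ hk₂n hk₁ hk₁n hsvg hsug (by rw [hwt, hu't, hsut]) ?_
    have h1 := congrArg cflip hev
    rw [cflip_mul, cflip_mul, ← ev_cflip, ← ev_cflip, ← ev_cflip, ← ev_cflip, ← hsvγ, ← hsuγ,
      ← hwγ] at h1
    have h2 : (ev (cflip (gam v')) (lam k₁ u.t)).det ≠ 0 := by
      rw [ev_cflip, det_cflip]; exact hdv'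
    rw [← span_col_ev_gam hk₁ hk₁n hwg, ← span_col_ev_gam hk₁ hk₁n hsug, hsut, hwt, hu't,
      ← Set.image_univ, ← Set.image_univ, ← span_col_mul, h1, Set.image_univ, Set.image_univ,
      ← Matrix.range_mulVecLin, ← Matrix.range_mulVecLin, Matrix.mulVecLin_mul,
      LinearMap.range_comp_of_range_eq_top]
    rw [LinearMap.range_eq_top]
    exact Matrix.mulVec_surjective_iff_isUnit.2 ((Matrix.isUnit_iff_isUnit_det _).2
      (isUnit_iff_ne_zero.2 h2))
  rw [geomR, Psi_eq hk₁ hk₁n hk₂ hk₂n hu hv hv't hv'N]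
  change (Part.some _).bind _ = _
  rw [Part.bind_some, hsv]
  change (Part.some _).bind _ = _
  rw [Part.bind_some, hsu]
  change (Part.some _).bind _ = _
  rw [Part.bind_some, hPsi2]
  change (Part.some _).bind _ = _
  rw [Part.bind_some, hz]
  change (Part.some _).bind _ = _
  rw [Part.bind_some, hzu]
  rfl

end RMatrix

end GeomCrystal

namespace GeomCrystal

/-! ### The crystal operators on matrices -/

section Crystal

variable {n : ℕ} [NeZero n]

omit [NeZero n] in
theorem resid_Icc_congr {a b a' b' : ℤ} (h : a ≡ a' [ZMOD n]) (hab : b - a = b' - a') :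
    resid n (Finset.Icc a b) = resid n (Finset.Icc a' b') := by
  ext x
  rw [mem_resid_Icc, mem_resid_Icc, hab]
  have : ((x : ℤ) + 1 - a) % n = ((x : ℤ) + 1 - a') % n := (Int.ModEq.refl _).sub h
  rw [this]

/-- Cyclic adjacency: `q` is the successor of `p` modulo `n`. -/
def CycSucc (p q : Fin n) : Prop := (q : ℕ) = p + 1 ∨ ((p : ℕ) = n - 1 ∧ (q : ℕ) = 0)

theorem cycSucc_cyc (i : ℤ) : CycSucc (cyc n (i - 1)) (cyc n i) := by
  have h1 := cyc_val (n := n) (i - 1)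
  have h2 := cyc_val (n := n) i
  have h3 := (cyc n (i - 1)).2
  have hmod : i ≡ (cyc n (i - 1) : ℤ) + 1 [ZMOD n] := by
    simpa using ((cyc_modEq (n := n) (i - 1)).add_right 1).symm
  have h5 := emod_shift (by positivity) (by exact_mod_cast h3) (by norm_num)
    (by have := NeZero.pos n; omega) hmod
  unfold CycSucc
  split_ifs at h5 <;> omega

theorem cyc_eq_zero_iff (i : ℤ) : ((cyc n i : Fin n) : ℕ) = 0 ↔ i ≡ 0 [ZMOD n] := by
  have h2 := cyc_val (n := n) i
  rw [Int.ModEq, Int.zero_emod]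
  omega

theorem xmat_eq (i : ℤ) (a : ℂ) :
    xmat n i a = 1 + Matrix.single (cyc n (i - 1)) (cyc n i) a := by
  rw [xmat]
  congr 1
  ext p q
  rw [Matrix.of_apply, Matrix.single_apply]
  refine if_congr (and_congr (Iff.trans ⟨fun h => ?_, fun h => ?_⟩ cyc_eq_iff.symm)
    (Iff.trans ⟨fun h => ?_, fun h => ?_⟩ cyc_eq_iff.symm)) rfl rfl
  · simpa using (h.sub_right 1).symm
  · simpa using (h.add_right 1).symm
  · simpa using (h.sub_right 1).symm
  · simpa using (h.add_right 1).symm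

variable {k : ℕ}

/-- Both entries lie in one column and share its denominator. The power t⁻¹ at i = 0 arises because
in column n the diagonal entry carries t while the entry in row 1, being above the diagonal, carries
λ instead. -/
theorem gam_succ_ratio_phi (hk : 1 ≤ k) (hkn : k < n) {x : XX n k} (hx : x.Good) (i : ℤ) :
    phi i x = Part.some (gam x (cyc n i) (cyc n (i - 1)) /
      gam x (cyc n (i - 1)) (cyc n (i - 1))) := by
  have hs := cycSucc_cyc (n := n) i
  have hz := cyc_eq_zero_iff (n := n) i
  have hn := NeZero.pos n
  have e1 : resid n (Finset.Icc (i - k + 1) (i - 1)) = lowSet k (cyc n (i - 1)) := by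
    refine resid_Icc_congr ?_ (by ring)
    have := ((cyc_modEq (n := n) (i - 1)).add_right (2 - (k : ℤ))).symm
    convert this using 1 <;> ring
  have e2 : resid n (Finset.Icc (i - k + 1) i) = baseSet k (cyc n i) := by
    refine resid_Icc_congr ?_ (by ring)
    have := ((cyc_modEq (n := n) i).add_right (1 - (k : ℤ))).symm
    convert this using 1 <;> ring
  have e3 : insert (cyc n (i - 1)) (lowSet k (cyc n (i - 1))) = baseSet k (cyc n i) := by
    rw [off_succ_base hk hkn]
    congr 1
    rw [cyc_eq_iff]
    refine (cyc_modEq i).trans ?_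
    simpa using ((cyc_modEq (n := n) (i - 1)).add_right 1).symm
  have h1 : maxMinor x.rep (baseSet k (cyc n i)) ≠ 0 := hx _
  have h0 : maxMinor x.rep (baseSet k (cyc n (i - 1))) ≠ 0 := hx _
  have ht := x.t.ne_zero
  rw [phi, pdiv, XX.P, XX.P, resid_union_singleton (i := cyc n i) ((cyc_modEq i).symm.add_right 1),
    e1, e2]
  refine Part.eq_some_iff.2 ⟨h1, ?_⟩
  simp only [gam, Matrix.of_apply]
  rw [e3]
  set p0 := cyc n (i - 1)
  set p1 := cyc n i
  rcases hs with hs | ⟨hs1, hs2⟩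
  · rw [if_neg (fun h => by have := hz.2 h; omega)]
    have hle : p0 ≤ p1 := by rw [Fin.le_def]; omega
    simp only [hle, le_refl, and_true]
    split_ifs <;> field_simp
  · rw [if_pos (hz.1 hs2)]
    have hle : ¬ p0 ≤ p1 := by rw [Fin.le_def]; omega
    rw [if_neg (show ¬(k ≤ (p0 : ℕ) ∧ p0 ≤ p1) from fun h => hle h.2),
      if_pos (show k ≤ (p0 : ℕ) ∧ p0 ≤ p0 from ⟨by omega, le_rfl⟩)]
    field_simp

/-- Two entries of one row in adjacent columns. The power t⁻¹ at i = k arises because column k + 1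
is the first whose diagonal entry carries t; for all other i the powers of t cancel or are absent.
-/
theorem gam_succ_ratio_eps (hk : 1 ≤ k) (hkn : k < n) {x : XX n k} (hx : x.Good) (i : ℤ) :
    eps i x = Part.some (gam x (cyc n i) (cyc n (i - 1)) / gam x (cyc n i) (cyc n i)) := by
  have hs := cycSucc_cyc (n := n) i
  have hz := cyc_eq_zero_iff (n := n) i
  have hn := NeZero.pos n
  have e1 : resid n (Finset.Icc (i - k + 1) (i - 1)) = lowSet k (cyc n (i - 1)) := by
    refine resid_Icc_congr ?_ (by ring)
    have := ((cyc_modEq (n := n) (i - 1)).add_right (2 - (k : ℤ))).symm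
    convert this using 1 <;> ring
  have e2 : resid n (Finset.Icc (i - k + 1) i) = baseSet k (cyc n i) := by
    refine resid_Icc_congr ?_ (by ring)
    have := ((cyc_modEq (n := n) i).add_right (1 - (k : ℤ))).symm
    convert this using 1 <;> ring
  have e4 : resid n (Finset.Icc (i - k) (i - 1)) = baseSet k (cyc n (i - 1)) := by
    refine resid_Icc_congr ?_ (by ring)
    have := ((cyc_modEq (n := n) (i - 1)).add_right (1 - (k : ℤ))).symm
    convert this using 1 <;> ring
  have e5 : resid n (Finset.Icc (i - k + 2) (i + 1)) = insert (cyc n i) (lowSet k (cyc n i)) := by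
    rw [off_succ_base hk hkn]
    refine resid_Icc_congr ?_ (by ring)
    have h1 := (((cyc_modEq (n := n) (((cyc n i : Fin n) : ℤ) + 1)).trans
      ((cyc_modEq (n := n) i).add_right 1)).add_right (1 - (k : ℤ))).symm
    convert h1 using 1 <;> ring
  have hk0 : i ≡ k [ZMOD n] ↔ ((cyc n i : Fin n) : ℕ) = k := by
    have h2 := cyc_val (n := n) i
    have h3 := Int.emod_eq_of_lt (a := (k : ℤ)) (b := n) (by positivity) (by exact_mod_cast hkn)
    rw [Int.ModEq]
    omega
  have h1 : maxMinor x.rep (baseSet k (cyc n i)) ≠ 0 := hx _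
  have h0 : maxMinor x.rep (baseSet k (cyc n (i - 1))) ≠ 0 := hx _
  have h2 : maxMinor x.rep (insert (cyc n i) (lowSet k (cyc n i))) ≠ 0 := by
    rw [off_succ_base hk hkn]; exact hx _
  have ht := x.t.ne_zero
  rw [eps, pdiv, XX.P, XX.P, XX.P, XX.P,
    resid_union_singleton (i := cyc n i) ((cyc_modEq i).symm.add_right 1), e1, e2, e4, e5]
  refine Part.eq_some_iff.2 ⟨mul_ne_zero h0 h2, ?_⟩
  simp only [gam, Matrix.of_apply]
  set p0 := cyc n (i - 1)
  set p1 := cyc n i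
  simp only [le_refl, and_true]
  rcases hs with hs | ⟨hs1, hs2⟩
  · have hle : p0 ≤ p1 := by rw [Fin.le_def]; omega
    simp only [hle, and_true]
    by_cases hik : (p1 : ℕ) = k
    · rw [if_pos (hk0.2 hik), if_neg (by omega), if_pos (by omega)]
      field_simp
    · rw [if_neg (fun h => hik (hk0.1 h))]
      by_cases hp : k ≤ (p0 : ℕ)
      · rw [if_pos hp, if_pos (by omega)]
        field_simp
      · rw [if_neg hp, if_neg (by omega)]
        field_simp
  · have hle : ¬ p0 ≤ p1 := by rw [Fin.le_def]; omega
    rw [if_neg (fun h => by have := hk0.1 h; omega),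
      if_neg (show ¬(k ≤ (p0 : ℕ) ∧ p0 ≤ p1) from fun h => hle h.2), if_neg (by omega)]
    field_simp

/-- The effect of a crystal operator on the coefficients of `g`. -/
noncomputable def crys (γ : Matrix (Fin n) (Fin n) ℂ) (p₀ p₁ : Fin n) (a b : ℂ) :
    Matrix (Fin n) (Fin n) ℂ :=
  Matrix.of fun p q => γ p q + (if p = p₀ ∧ q ≠ p₁ then a * γ p₁ q else 0)
    + (if q = p₁ ∧ p ≠ p₀ then b * γ p p₀ else 0)

/-- The loop version of `x_i(a)`, evaluated at `λ = μ`. -/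
noncomputable def xm (n : ℕ) (i : ℤ) (a μ : ℂ) : Matrix (Fin n) (Fin n) ℂ :=
  xmat n i (if i ≡ 0 [ZMOD n] then a * μ⁻¹ else a)

omit [NeZero n] in
theorem one_add_single_mul_apply (p₀ p₁ : Fin n) (a : ℂ) {m : Type*} (Y : Matrix (Fin n) m ℂ)
    (p : Fin n) (q : m) : ((1 + Matrix.single p₀ p₁ a : Matrix (Fin n) (Fin n) ℂ) * Y) p q
      = Y p q + if p = p₀ then a * Y p₁ q else 0 := by
  rw [Matrix.add_mul, Matrix.one_mul, Matrix.add_apply]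
  congr 1
  split_ifs with h
  · subst h; simp
  · rw [Matrix.single_mul_apply_of_ne]
    exact h

omit [NeZero n] in
theorem mul_one_add_single_apply (p₀ p₁ : Fin n) (b : ℂ) {m : Type*} (Y : Matrix m (Fin n) ℂ)
    (p : m) (q : Fin n) : (Y * (1 + Matrix.single p₀ p₁ b : Matrix (Fin n) (Fin n) ℂ)) p q
      = Y p q + if q = p₁ then b * Y p p₀ else 0 := by
  rw [Matrix.mul_add, Matrix.mul_one, Matrix.add_apply]
  congr 1
  split_ifs with h
  · subst h; simp [mul_comm]
  · rw [Matrix.mul_single_apply_of_ne]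
    exact h

/-- `crys` leaves the entry (i, i+1) alone, whereas the product adds to it exactly the left side of
`hab`. That sum would sit strictly above the unfolded diagonal, so its vanishing is what keeps the
product banded. -/
theorem ev_crys (hn : 2 ≤ n) (γ : Matrix (Fin n) (Fin n) ℂ) {a b μ : ℂ} (hμ : μ ≠ 0) (i : ℤ)
    (hab : a * γ (cyc n i) (cyc n i) + b * γ (cyc n (i - 1)) (cyc n (i - 1))
      + a * b * γ (cyc n i) (cyc n (i - 1)) = 0) :
    ev (crys γ (cyc n (i - 1)) (cyc n i) a b) μ = xm n i a μ * ev γ μ * xm n i b μ := by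
  have hs := cycSucc_cyc (n := n) i
  have hz := cyc_eq_zero_iff (n := n) i
  rw [xm, xm, xmat_eq, xmat_eq]
  set p0 := cyc n (i - 1)
  set p1 := cyc n i
  ext p q
  rw [mul_one_add_single_apply, one_add_single_mul_apply, one_add_single_mul_apply]
  rcases hs with hs | ⟨hs1, hs2⟩
  · have hle : p0 ≤ p1 := by rw [Fin.le_def]; omega
    have hi0 : ¬ i ≡ 0 [ZMOD n] := fun h => by have := hz.2 h; omega
    simp only [if_neg hi0, ev, crys, Matrix.of_apply]
    by_cases hp : p = p0
    · by_cases hq : q = p1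
      · subst hp
        subst hq
        have hlt : ¬ p1 ≤ p0 := by rw [Fin.le_def]; omega
        simp only [hlt, hle, le_refl, if_true, if_false, true_and, ne_eq, not_true_eq_false,
          and_false]
        linear_combination -hab
      · subst hp
        have e : q ≤ p0 ↔ q ≤ p1 := by
          have : (q : ℕ) ≠ p1 := fun h => hq (Fin.ext h)
          rw [Fin.le_def, Fin.le_def]; omega
        simp only [hq, e, if_true, if_false, true_and, ne_eq, not_false_eq_true,
          false_and, not_true_eq_false, add_zero]
        split_ifs <;> ring
    · by_cases hq : q = p1
      · subst hq
        have e : p1 ≤ p ↔ p0 ≤ p := by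
          have : (p : ℕ) ≠ p0 := fun h => hp (Fin.ext h)
          rw [Fin.le_def, Fin.le_def]; omega
        simp only [hp, e, if_true, if_false, true_and, ne_eq, not_false_eq_true,
          false_and, add_zero]
        split_ifs <;> ring
      · simp [hp, hq]
  · have hle : ¬ p0 ≤ p1 := by rw [Fin.le_def]; omega
    have hle' : p1 ≤ p0 := by rw [Fin.le_def]; omega
    have hi0 : i ≡ 0 [ZMOD n] := hz.1 hs2
    simp only [if_pos hi0, ev, crys, Matrix.of_apply]
    by_cases hp : p = p0
    · by_cases hq : q = p1
      · subst hp
        subst hq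
        simp only [hle, hle', le_refl, if_true, if_false, true_and, ne_eq, not_true_eq_false,
          and_false, add_zero]
        field_simp
        linear_combination -hab
      · subst hp
        have e : q ≤ p0 := by rw [Fin.le_def]; have := q.2; omega
        have e' : ¬ q ≤ p1 := by
          have : (q : ℕ) ≠ p1 := fun h => hq (Fin.ext h)
          rw [Fin.le_def]; omega
        simp only [hq, e, e', if_true, if_false, true_and, ne_eq, not_false_eq_true,
          false_and, not_true_eq_false, add_zero]
        field_simp
    · by_cases hq : q = p1
      · subst hq
        have e : p1 ≤ p := by rw [Fin.le_def]; omega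
        have e' : ¬ p0 ≤ p := by
          have : (p : ℕ) ≠ p0 := fun h => hp (Fin.ext h)
          have := p.2
          rw [Fin.le_def]; omega
        simp only [hp, e, e', if_true, if_false, true_and, ne_eq, not_false_eq_true,
          false_and, add_zero]
        field_simp
      · simp [hp, hq]

omit [NeZero n] in
-- An added term comes from a position of offset one larger than the position it is added to. At or
-- beyond the lowest diagonal such terms are therefore zero.
theorem Loop.crys {γ : Matrix (Fin n) (Fin n) ℂ} (h : Loop k γ)
    {p₀ p₁ : Fin n} (hs : CycSucc p₀ p₁) (a b : ℂ) : Loop k (crys γ p₀ p₁ a b) := by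
  have hval : ∀ p q : Fin n, q ≤ p ∧ off p q = (p : ℤ) - q ∨ p < q ∧ off p q = (p : ℤ) - q + n := by
    intro p q
    rcases le_or_gt q p with h1 | h1
    · exact Or.inl ⟨h1, off_of_le h1⟩
    · exact Or.inr ⟨h1, off_of_lt h1⟩
  have hne : ∀ p q : Fin n, p ≠ q → (p : ℕ) ≠ q := fun p q h h' => h (Fin.ext h')
  have hrow : ∀ q, q ≠ p₁ → off p₁ q = off p₀ q + 1 := by
    intro q hq
    have h1 := hval p₁ q
    have h2 := hval p₀ q
    have h3 := hne _ _ hq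
    have := q.2
    simp only [Fin.le_def, Fin.lt_def] at h1 h2
    rcases hs with hs | hs <;> omega
  have hcol : ∀ p, p ≠ p₀ → off p p₀ = off p p₁ + 1 := by
    intro p hp
    have h1 := hval p p₁
    have h2 := hval p p₀
    have h3 := hne _ _ hp
    have := p.2
    simp only [Fin.le_def, Fin.lt_def] at h1 h2
    rcases hs with hs | hs <;> omega
  have hz : ∀ p q, (n : ℤ) - k < off p q → γ p q = 0 := by
    intro p q hpq
    by_contra h0
    have := h.zero p q h0
    omega
  constructor
  · intro p q hpq
    by_contra hlt
    rw [not_le] at hlt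
    apply hpq
    rw [GeomCrystal.crys, Matrix.of_apply, hz p q hlt]
    have e1 : (if p = p₀ ∧ q ≠ p₁ then a * γ p₁ q else 0) = 0 := by
      split_ifs with h1
      · obtain ⟨rfl, h2⟩ := h1
        rw [hz _ _ (by rw [hrow q h2]; omega), mul_zero]
      · rfl
    have e2 : (if q = p₁ ∧ p ≠ p₀ then b * γ p p₀ else 0) = 0 := by
      split_ifs with h1
      · obtain ⟨rfl, h2⟩ := h1
        rw [hz _ _ (by rw [hcol p h2]; omega), mul_zero]
      · rfl
    rw [e1, e2]
    ring
  · intro p q hpq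
    rw [GeomCrystal.crys, Matrix.of_apply, h.lead p q hpq]
    have e1 : (if p = p₀ ∧ q ≠ p₁ then a * γ p₁ q else 0) = 0 := by
      split_ifs with h1
      · obtain ⟨rfl, h2⟩ := h1
        rw [hz _ _ (by rw [hrow q h2]; omega), mul_zero]
      · rfl
    have e2 : (if q = p₁ ∧ p ≠ p₀ then b * γ p p₀ else 0) = 0 := by
      split_ifs with h1
      · obtain ⟨rfl, h2⟩ := h1
        rw [hz _ _ (by rw [hcol p h2]; omega), mul_zero]
      · rfl
    rw [e1, e2]
    ring

theorem cyc_ne_cyc_sub_one (hn : 2 ≤ n) (i : ℤ) : cyc n (i - 1) ≠ cyc n i := by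
  intro h
  have hs := cycSucc_cyc (n := n) i
  rw [h] at hs
  rcases hs with hs | hs <;> omega

theorem xm_mul_xm (hn : 2 ≤ n) (i : ℤ) (a b μ : ℂ) :
    xm n i a μ * xm n i b μ = xm n i (a + b) μ := by
  have hne := cyc_ne_cyc_sub_one hn i
  rw [xm, xm, xm, xmat_eq, xmat_eq, xmat_eq, add_mul, mul_add, mul_add, one_mul, one_mul, mul_one,
    Matrix.single_mul_single_of_ne _ _ _ _ hne.symm, add_zero, add_assoc, ← Matrix.single_add]
  congr 2
  split_ifs <;> ring

theorem xm_zero (i : ℤ) (μ : ℂ) : xm n i 0 μ = 1 := by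
  rw [xm, xmat_eq]
  simp

theorem det_xm (hn : 2 ≤ n) (i : ℤ) (a μ : ℂ) : (xm n i a μ).det ≠ 0 := by
  intro h
  have h1 := congrArg Matrix.det (xm_mul_xm hn i a (-a) μ)
  rw [add_neg_cancel, xm_zero, Matrix.det_one, Matrix.det_mul, h, zero_mul] at h1
  exact zero_ne_one h1

/-- The matrix of `e_i^c(x)`. -/
theorem exists_eOp_eq (hk : 1 ≤ k) (hkn : k < n) {x : XX n k} (hx : x.Good) (i : ℤ) (c : ℂˣ)
    (h10 : gam x (cyc n i) (cyc n (i - 1)) ≠ 0) :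
    ∃ y : XX n k, eOp i c x = Part.some y ∧ y.t = x.t ∧ y.Good ∧
      ∀ μ : ℂ, μ ≠ 0 → ev (gam y) μ
        = xm n i (((c : ℂ) - 1) / (gam x (cyc n i) (cyc n (i - 1)) /
            gam x (cyc n (i - 1)) (cyc n (i - 1)))) μ * ev (gam x) μ *
          xm n i (((c : ℂ)⁻¹ - 1) / (gam x (cyc n i) (cyc n (i - 1)) /
            gam x (cyc n i) (cyc n i))) μ := by
  have hn : 2 ≤ n := by omega
  have h00 := gam_diag_ne_zero hk hkn hx (cyc n (i - 1))
  have h11 := gam_diag_ne_zero hk hkn hx (cyc n i)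
  have hc := c.ne_zero
  set a := ((c : ℂ) - 1) / (gam x (cyc n i) (cyc n (i - 1)) /
            gam x (cyc n (i - 1)) (cyc n (i - 1))) with ha
  set b := ((c : ℂ)⁻¹ - 1) / (gam x (cyc n i) (cyc n (i - 1)) /
            gam x (cyc n i) (cyc n i)) with hb
  -- With a = (c-1)/φ and b = (c⁻¹-1)/ε this is c c⁻¹ = 1, expanded as (1 + (c-1))(1 + (c⁻¹-1)) = 1.
  -- The value of a is dictated by the definition of e_i^c, and b is then forced.
  have hab : a * gam x (cyc n i) (cyc n i) + b * gam x (cyc n (i - 1)) (cyc n (i - 1))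
      + a * b * gam x (cyc n i) (cyc n (i - 1)) = 0 := by
    rw [ha, hb]
    field_simp
    ring
  obtain ⟨y, hyt, hyN⟩ := exists_map_eq (x := x) (det_xm hn i a (lam k x.t))
  have hev := fun μ (hμ : μ ≠ 0) => ev_crys hn (gam x) hμ i hab
  obtain ⟨hyg, hyγ⟩ := ((loop_gam hk hkn hx).crys (cycSucc_cyc i) a b).eq_gam hk hkn
    (x := y) (by
      intro j
      rw [hyt, hev _ (lam_ne_zero _ _), mul_assoc, hyN]
      refine ⟨(ev (gam x) (lam k x.t) * xm n i b (lam k x.t)).col j, ?_, rfl⟩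
      rw [← span_col_ev_gam hk hkn hx, ← Matrix.range_mulVecLin]
      exact ⟨(xm n i b (lam k x.t)).col j, rfl⟩)
  refine ⟨y, ?_, hyt, hyg, fun μ hμ => by rw [← hyγ, hev μ hμ]⟩
  rw [eOp, gam_succ_ratio_phi hk hkn hx]
  change (Part.some _).bind _ = _
  rw [Part.bind_some, show pdiv ((c : ℂ) - 1) (gam x (cyc n i) (cyc n (i - 1)) /
            gam x (cyc n (i - 1)) (cyc n (i - 1))) = Part.some a from
    Part.eq_some_iff.2 ⟨div_ne_zero h10 h00, rfl⟩]
  change (Part.some _).bind _ = _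
  rw [Part.bind_some]
  refine mkPt_eq_some y ?_ hyt
  rw [hyN, xm]
  congr 3
  refine if_congr Iff.rfl ?_ rfl
  -- The constant (-1)^(k-1) t⁻¹ in the definition of e_0^c is the inverse of the special value, so
  -- x_0 there is the loop matrix evaluated at λ₀.
  have h1 : ((-1 : ℂ) ^ (k - 1)) * (-1) ^ (k - 1) = 1 := by rw [← mul_pow]; simp
  have ht := x.t.ne_zero
  have h2 : (lam k x.t)⁻¹ = (-1) ^ (k - 1) * (x.t : ℂ)⁻¹ := by
    rw [inv_eq_iff_eq_inv, mul_inv, inv_inv, lam]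
    congr 1
    exact eq_inv_of_mul_eq_one_left h1
  rw [h2, mul_comm]

end Crystal

end GeomCrystal

namespace GeomCrystal

/-! ### Corner minors -/

section Corner

variable {n k : ℕ}

theorem minor_eq_det {R : Type*} [CommRing R] {I J : Finset (Fin n)} (A : Matrix (Fin n) (Fin n) R)
    {f g : Fin k → Fin n} (hf : StrictMono f) (hg : StrictMono g) (hI : I.card = k)
    (hJ : J.card = k) (hfI : ∀ b, f b ∈ I) (hgJ : ∀ b, g b ∈ J) :
    minor I J A = (A.submatrix f g).det := by
  subst hI
  rw [minor, dif_pos hJ, Finset.orderEmbOfFin_unique rfl hfI hf,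
    Finset.orderEmbOfFin_unique hJ hgJ hg]

/-- The last `k` rows. -/
def lastF (h : k ≤ n) (b : Fin k) : Fin n := ⟨n - k + b, by have := b.2; omega⟩

/-- The first `k` columns. -/
def firstF (h : k ≤ n) (b : Fin k) : Fin n := ⟨b, by have := b.2; omega⟩

theorem lastF_strictMono (h : k ≤ n) : StrictMono (lastF h) := by
  intro a b hab
  rw [Fin.lt_def] at hab ⊢
  simp only [lastF]
  omega

theorem firstF_strictMono (h : k ≤ n) : StrictMono (firstF h) := fun _ _ hab => hab

theorem cornerMinor_eq (hk : 1 ≤ k) (hkn : k < n) (A : Matrix (Fin n) (Fin n) ℂ[X]) :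
    cornerMinor k A = (A.submatrix (lastF hkn.le) (firstF hkn.le)).det := by
  have : NeZero n := ⟨by omega⟩
  have h1 := card_resid_Icc (n := n) (p := (n : ℤ) - k + 1) hkn.le
  have h2 := card_resid_Icc (n := n) (p := 1) hkn.le
  rw [show (n : ℤ) - k + 1 + k - 1 = n by ring] at h1
  rw [show (1 : ℤ) + k - 1 = k by ring] at h2
  refine minor_eq_det A (lastF_strictMono _) (firstF_strictMono _) h1 h2 (fun b => ?_) fun b => ?_
  · rw [mem_resid_Icc]
    have := b.2
    simp only [lastF]
    rw [Int.emod_eq_of_lt] <;> omega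
  · rw [mem_resid_Icc]
    have := b.2
    simp only [firstF]
    rw [Int.emod_eq_of_lt] <;> omega

variable {k₁ k₂ : ℕ}

/-- Only the last k rows of the first factor and the first k columns of the second are involved.
Entries above the diagonal in these positions lie outside the bands, because k ≤ k₁ and k ≤ k₂, so
no λ survives. -/
theorem corner_fold (hkn : k < n) (h1 : k ≤ k₁) (h2 : k ≤ k₂)
    {γ δ : Matrix (Fin n) (Fin n) ℂ} (hγ : Loop k₁ γ) (hδ : Loop k₂ δ) :
    (fold γ * fold δ).submatrix (lastF hkn.le) (firstF hkn.le)
      = ((γ * δ).submatrix (lastF hkn.le) (firstF hkn.le)).map C := by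
  refine Matrix.ext fun b a => ?_
  simp only [Matrix.submatrix_apply, Matrix.map_apply, Matrix.mul_apply, map_sum, map_mul]
  have hb := b.2
  have ha := a.2
  refine Finset.sum_congr rfl fun l _ => ?_
  have hl := l.2
  have e1 : fold γ (lastF hkn.le b) l = C (γ (lastF hkn.le b) l) := by
    simp only [fold, Matrix.of_apply]
    split_ifs with h
    · rfl
    · have : γ (lastF hkn.le b) l = 0 := by
        by_contra h0
        have h3 := hγ.zero _ _ h0
        rw [off_of_lt (not_le.1 h)] at h3
        simp only [lastF] at h3
        omega
      rw [this]
      simp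
  have e2 : fold δ l (firstF hkn.le a) = C (δ l (firstF hkn.le a)) := by
    simp only [fold, Matrix.of_apply]
    split_ifs with h
    · rfl
    · have : δ l (firstF hkn.le a) = 0 := by
        by_contra h0
        have h3 := hδ.zero _ _ h0
        rw [off_of_lt (not_le.1 h)] at h3
        simp only [firstF] at h3
        omega
      rw [this]
      simp
  rw [e1, e2]

theorem corner_ev (hkn : k < n) (h1 : k ≤ k₁) (h2 : k ≤ k₂)
    {γ δ : Matrix (Fin n) (Fin n) ℂ} (hγ : Loop k₁ γ) (hδ : Loop k₂ δ) (μ : ℂ) :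
    (ev γ μ * ev δ μ).submatrix (lastF hkn.le) (firstF hkn.le)
      = (γ * δ).submatrix (lastF hkn.le) (firstF hkn.le) := by
  have h := congrArg (fun M => M.map (eval μ)) (corner_fold hkn h1 h2 hγ hδ)
  rw [← Matrix.submatrix_map, map_eval_mul, map_eval_fold, map_eval_fold] at h
  rw [h]
  ext
  simp

/-- The corner minor of a product of two good points. -/
noncomputable def cornerVal (hkn : k < n) (Y : Matrix (Fin n) (Fin n) ℂ) : ℂ :=
  (Y.submatrix (lastF hkn.le) (firstF hkn.le)).det

theorem cornerMinor_fold (hk : 1 ≤ k) (hkn : k < n) (h1 : k ≤ k₁) (h2 : k ≤ k₂)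
    {γ δ : Matrix (Fin n) (Fin n) ℂ} (hγ : Loop k₁ γ) (hδ : Loop k₂ δ) :
    cornerMinor k (fold γ * fold δ) = C (cornerVal hkn (γ * δ)) := by
  rw [cornerMinor_eq hk hkn, corner_fold hkn h1 h2 hγ hδ, cornerVal, RingHom.map_det]
  rfl

theorem coenergyE_eq (hk₁ : 1 ≤ k₁) (hk₁n : k₁ < n) (hk₂ : 1 ≤ k₂) (hk₂n : k₂ < n)
    (hk : min k₁ k₂ < n) {u : XX n k₁} {v : XX n k₂} (hu : u.Good) (hv : v.Good) :
    coenergyE u v = Part.some (cornerVal hk (gam u * gam v)) := by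
  rw [coenergyE, gMat_eq_some hk₁ hk₁n hu]
  change (Part.some _).bind _ = _
  rw [Part.bind_some, gMat_eq_some hk₂ hk₂n hv]
  change (Part.some _).bind _ = _
  rw [Part.bind_some, cornerMinor_fold (le_min hk₁ hk₂) hk (min_le_left _ _) (min_le_right _ _)
    (loop_gam hk₁ hk₁n hu) (loop_gam hk₂ hk₂n hv), coeff_C_zero]
  rfl

/-- On the left, row i receives a multiple of row i + 1; if row i is among the last k rows, so is
row i + 1. On the right, column i + 1 receives a multiple of column i, which is among the first k
whenever column i + 1 is. -/
theorem cornerVal_xm_mul [NeZero n] (hkn : k < n) {i : ℤ} (hi : ¬ i ≡ 0 [ZMOD n]) (a b μ : ℂ)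
    (Y : Matrix (Fin n) (Fin n) ℂ) :
    cornerVal hkn (xm n i a μ * Y * xm n i b μ) = cornerVal hkn Y := by
  have hs := cycSucc_cyc (n := n) i
  have hz := cyc_eq_zero_iff (n := n) i
  rw [xm, xm, if_neg hi, if_neg hi, xmat_eq, xmat_eq]
  set p0 := cyc n (i - 1)
  set p1 := cyc n i
  have hs' : (p1 : ℕ) = p0 + 1 := by
    rcases hs with hs | hs
    · exact hs
    · exact absurd (hz.1 hs.2) hi
  have hp1 := p1.2
  have hrow : ∀ Z : Matrix (Fin n) (Fin n) ℂ,
      cornerVal hkn ((1 + Matrix.single p0 p1 a) * Z) = cornerVal hkn Z := by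
    intro Z
    rw [cornerVal, cornerVal]
    by_cases hp : n - k ≤ (p0 : ℕ)
    · have h0 : lastF hkn.le ⟨p0 - (n - k), by omega⟩ = p0 := by
        ext; simp only [lastF]; omega
      have h1 : lastF hkn.le ⟨p1 - (n - k), by omega⟩ = p1 := by
        ext; simp only [lastF]; omega
      have hne : (⟨p0 - (n - k), by omega⟩ : Fin k) ≠ ⟨p1 - (n - k), by omega⟩ := by
        rw [Ne, Fin.mk.injEq]; omega
      rw [← Matrix.det_updateRow_add_smul_self (Z.submatrix (lastF hkn.le) (firstF hkn.le)) hne a]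
      congr 1
      ext x y
      rw [Matrix.submatrix_apply, one_add_single_mul_apply, Matrix.updateRow_apply]
      by_cases hx : x = ⟨p0 - (n - k), by omega⟩
      · subst hx
        simp [h0, h1]
      · have hx' : lastF hkn.le x ≠ p0 := fun h =>
          hx ((lastF_strictMono hkn.le).injective (h.trans h0.symm))
        simp [hx, hx']
    · congr 1
      ext x y
      rw [Matrix.submatrix_apply, one_add_single_mul_apply, if_neg, add_zero]
      · rfl
      · rintro h
        apply hp
        rw [← h]
        simp [lastF]
  have hcol : ∀ Z : Matrix (Fin n) (Fin n) ℂ,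
      cornerVal hkn (Z * (1 + Matrix.single p0 p1 b)) = cornerVal hkn Z := by
    intro Z
    rw [cornerVal, cornerVal]
    by_cases hp : (p1 : ℕ) < k
    · have h0 : firstF hkn.le ⟨p0, by omega⟩ = p0 := rfl
      have h1 : firstF hkn.le ⟨p1, by omega⟩ = p1 := rfl
      have hne : (⟨p1, by omega⟩ : Fin k) ≠ ⟨p0, by omega⟩ := by
        rw [Ne, Fin.mk.injEq]; omega
      rw [← Matrix.det_updateCol_add_smul_self (Z.submatrix (lastF hkn.le) (firstF hkn.le)) hne b]
      congr 1
      ext x y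
      rw [Matrix.submatrix_apply, mul_one_add_single_apply, Matrix.updateCol_apply]
      by_cases hy : y = ⟨p1, by omega⟩
      · subst hy
        simp [h0, h1]
      · have hy' : firstF hkn.le y ≠ p1 := fun h =>
          hy ((firstF_strictMono hkn.le).injective (h.trans h1.symm))
        simp [hy, hy']
    · congr 1
      ext x y
      rw [Matrix.submatrix_apply, mul_one_add_single_apply, if_neg, add_zero]
      · rfl
      · rintro h
        apply hp
        rw [← h]
        exact y.2
  rw [hcol, hrow]

/-! #### The action of `x_0` on a corner minor -/

theorem det_lastF (hkn : k < n) (M : Matrix (Fin n) (Fin k) ℂ) {I : Finset (Fin n)}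
    (hI : I.card = k) (hmem : ∀ b, lastF hkn.le b ∈ I) :
    (M.submatrix (lastF hkn.le) id).det = maxMinor M I := by
  rw [maxMinor_of_card M hI, Finset.orderEmbOfFin_unique hI hmem (lastF_strictMono _)]

theorem cofVec_congr {m : ℕ} {M M' : Matrix (Fin n) (Fin (m + 1)) ℂ} {J : Finset (Fin n)}
    (hJ : J.card = m) (h : ∀ i ∈ J, ∀ l, M i l = M' i l) : cofVec M J hJ = cofVec M' J hJ := by
  ext l
  rw [cofVec, cofVec]
  congr 2
  ext a b
  exact h _ (Finset.orderEmbOfFin_mem J hJ a) _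

variable [NeZero n]

/-- The bottom minor is a Plücker coordinate, and x_0 adds a multiple of row 1 to row n. The result
is a combination of two Plücker coordinates whose ratio is φ_0 up to t and the sign of moving row 1
to the bottom; dividing a by λ₀ absorbs both. -/
theorem det_xm_zero_mul (hk : 1 ≤ k) (hkn : k < n) (x : XX n k) (hx : x.Good)
    {M : Matrix (Fin n) (Fin k) ℂ} (hM : x.IsRep M) (a : ℂ) :
    ((xm n 0 a (lam k x.t) * M).submatrix (lastF hkn.le) id).det
      = (M.submatrix (lastF hkn.le) id).det * (1 + a * (gam x (cyc n 0) (cyc n (0 - 1)) /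
        gam x (cyc n (0 - 1)) (cyc n (0 - 1)))) := by
  obtain ⟨m, rfl⟩ : ∃ m, k = m + 1 := ⟨k - 1, by omega⟩
  have hz := cyc_eq_zero_iff (n := n) 0
  have hs := cycSucc_cyc (n := n) 0
  have hzero : ((cyc n 0 : Fin n) : ℕ) = 0 := hz.2 rfl
  have hlast : ((cyc n (0 - 1) : Fin n) : ℕ) = n - 1 := by
    rcases hs with hs | hs <;> omega
  rw [xm, if_pos (Int.ModEq.refl _), xmat_eq]
  have h00 := gam_diag_ne_zero hk hkn hx (cyc n (0 - 1))
  have hgood := hx (cyc n ((cyc n (0 - 1) : ℤ) + 1))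
  have hgood0 := hx (cyc n (0 - 1))
  rw [← off_succ_base hk hkn] at hgood
  have hg1 : gam x (cyc n 0) (cyc n (0 - 1)) / gam x (cyc n (0 - 1)) (cyc n (0 - 1))
      = (x.t : ℂ)⁻¹ * (maxMinor x.rep (insert (cyc n 0) (lowSet (m + 1) (cyc n (0 - 1))))
        / maxMinor x.rep (insert (cyc n (0 - 1)) (lowSet (m + 1) (cyc n (0 - 1))))) := by
    have ht := x.t.ne_zero
    have hle : ¬ cyc n (0 - 1) ≤ cyc n 0 := by rw [Fin.le_def]; omega
    simp only [gam, Matrix.of_apply]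
    rw [if_neg (fun h => hle h.2), if_pos ⟨by omega, le_rfl⟩]
    field_simp
  rw [hg1]
  set p0 := cyc n (0 - 1) with hp0
  set p1 := cyc n 0 with hp1
  set J := lowSet (m + 1) p0 with hJdef
  have hJ : J.card = m := by rw [hJdef, card_lowSet hk hkn]; omega
  have hp0J : p0 ∉ J := by
    rw [hJdef, mem_lowSet hk hkn, off_of_le le_rfl]
    omega
  have hIcard : (insert p0 J).card = m + 1 := by
    rw [Finset.card_insert_of_notMem hp0J, hJ]
  have hmem : ∀ b, lastF hkn.le b ∈ insert p0 J := by
    intro b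
    rw [Finset.mem_insert, hJdef, mem_lowSet hk hkn]
    have hb := b.2
    by_cases hb' : (b : ℕ) = m
    · left
      ext
      simp only [lastF]
      omega
    · right
      rw [off_of_lt]
      · simp only [lastF]; omega
      · rw [Fin.lt_def]; simp only [lastF]; omega
  have hfilt : (J.filter (· < p0)) = J := by
    refine Finset.filter_true_of_mem fun b hb => ?_
    have hne : b ≠ p0 := fun h => hp0J (h ▸ hb)
    have hb2 := b.2
    have : (b : ℕ) ≠ p0 := fun h => hne (Fin.ext h)
    rw [Fin.lt_def]
    omega
  have hfilt1 : (J.filter (· < p1)) = ∅ := by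
    refine Finset.filter_false_of_mem fun b _ => ?_
    rw [Fin.lt_def]
    omega
  have hsq : ((-1 : ℂ) ^ m) * (-1) ^ m = 1 := by rw [← mul_pow]; simp
  set α := a * (lam (m + 1) x.t)⁻¹ with hα
  -- Only row n is changed and it is not in J, so the cofactor vector is the same before and after.
  have hcof : cofVec ((1 + Matrix.single p0 p1 α : Matrix (Fin n) (Fin n) ℂ) * M) J hJ
      = cofVec M J hJ := by
    refine cofVec_congr hJ fun i hi l => ?_
    rw [one_add_single_mul_apply, if_neg, add_zero]
    rintro rfl
    exact hp0J hi
  have key : maxMinor ((1 + Matrix.single p0 p1 α : Matrix (Fin n) (Fin n) ℂ) * M) (insert p0 J)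
      = maxMinor M (insert p0 J) + (-1) ^ m * α * maxMinor M (insert p1 J) := by
    have h1 := mulVec_cofVec ((1 + Matrix.single p0 p1 α : Matrix (Fin n) (Fin n) ℂ) * M) J hJ p0
    have h2 := mulVec_cofVec M J hJ p0
    have h3 := mulVec_cofVec M J hJ p1
    rw [hfilt, hJ] at h1 h2
    rw [hfilt1, Finset.card_empty, pow_zero, one_mul] at h3
    rw [hcof, ← Matrix.mulVec_mulVec, Matrix.add_mulVec, Matrix.one_mulVec, Pi.add_apply, h2,
      Matrix.single_mulVec, Function.update_self, h3] at h1
    linear_combination (-(-1) ^ m) * h1 + (maxMinor M (insert p0 J) -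
      maxMinor ((1 + Matrix.single p0 p1 α : Matrix (Fin n) (Fin n) ℂ) * M) (insert p0 J)) * hsq
  have hlam : lam (m + 1) x.t = (-1) ^ m * (x.t : ℂ) := by rw [lam, Nat.add_sub_cancel]
  have hMne : maxMinor M (insert p0 J) ≠ 0 := (x.maxMinor_ne_zero_iff_rep hM _).2 hgood
  rw [det_lastF hkn _ hIcard hmem, det_lastF hkn _ hIcard hmem, key, ← x.maxMinor_div hM, hα, hlam]
  have ht := x.t.ne_zero
  have hm1 : ((-1 : ℂ) ^ m) ≠ 0 := pow_ne_zero _ (by norm_num)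
  field_simp

/-- The position (n, 1) is fixed by reflection in the antidiagonal, so right multiplication by x_0
becomes left multiplication after the flip. -/
theorem cflip_xm (hn : 2 ≤ n) (a μ : ℂ) : cflip (xm n 0 a μ) = xm n 0 a μ := by
  have hz := cyc_eq_zero_iff (n := n) 0
  have hs := cycSucc_cyc (n := n) 0
  have hzero : ((cyc n 0 : Fin n) : ℕ) = 0 := hz.2 rfl
  have hlast : ((cyc n (0 - 1) : Fin n) : ℕ) = n - 1 := by
    rcases hs with hs | hs <;> omega
  rw [xm, if_pos (Int.ModEq.refl _), xmat_eq]
  ext i j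
  simp only [cflip, Matrix.of_apply, Matrix.add_apply, Matrix.one_apply, Matrix.single_apply,
    Fin.ext_iff, Fin.val_rev, hzero, hlast]
  have hi := i.2
  have hj := j.2
  congr 1
  · exact if_congr (by omega) rfl rfl
  · exact if_congr (by omega) rfl rfl

/-- The effect of `x_0` on a corner minor of a matrix of rank `k`. -/
theorem cornerVal_xm_zero (hk : 1 ≤ k) (hkn : k < n) {x y : XX n k} (hx : x.Good) (hy : y.Good)
    (hxy : x.t = y.t) {Y : Matrix (Fin n) (Fin n) ℂ}
    (hYx : Submodule.span ℂ (Set.range Y.col) = x.N)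
    (hYy : Submodule.span ℂ (Set.range (cflip Y).col) = y.N) (a b : ℂ) :
    cornerVal hkn (xm n 0 a (lam k x.t) * Y * xm n 0 b (lam k x.t)) = cornerVal hkn Y *
      (1 + a * (gam x (cyc n 0) (cyc n (0 - 1)) / gam x (cyc n (0 - 1)) (cyc n (0 - 1)))) *
      (1 + b * (gam y (cyc n 0) (cyc n (0 - 1)) / gam y (cyc n (0 - 1)) (cyc n (0 - 1)))) := by
  have h1 : ∀ j, ∃ w : Fin k → ℂ, x.rep.mulVec w = Y.col j := fun j =>
    (x.mem_iff x.isRep_rep _).1 (hYx ▸ Submodule.subset_span ⟨j, rfl⟩)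
  choose w hw using h1
  set W : Matrix (Fin k) (Fin n) ℂ := Matrix.of fun l j => w j l
  set M := x.rep
  have hMW : Y = M * W := by
    ext i j
    exact (congrFun (hw j) i).symm
  -- In the rank factorisation Y = M W, reversing and transposing W gives a representative of the
  -- column space of the flip of Y, namely of y.
  set V : Matrix (Fin n) (Fin k) ℂ := Matrix.of fun i l => W l (Fin.rev i) with hV
  have hflip : cflip Y = V * Matrix.of fun l j => M (Fin.rev j) l := by
    ext i j
    rw [hMW]
    simp only [cflip, Matrix.of_apply, Matrix.mul_apply, hV]
    exact Finset.sum_congr rfl fun l _ => mul_comm _ _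
  have hVy : y.IsRep V := by
    have hle : y.N ≤ Submodule.span ℂ (Set.range V.col) := by
      rw [← hYy, hflip, ← Matrix.range_mulVecLin, ← Matrix.range_mulVecLin, Matrix.mulVecLin_mul]
      exact LinearMap.range_comp_le_range _ _
    refine (Submodule.eq_of_le_of_finrank_le hle ?_).symm
    rw [y.finrank_N]
    refine (finrank_range_le_card V.col).trans ?_
    simp
  -- The corner minor of a rank-k product is a k × k minor of M times one of W. The permutation sign
  -- comes from reversing the columns of W and does not depend on a', b', so it disappears on
  -- comparison with a' = b' = 0.
  have hsplit : ∀ a' b' : ℂ, cornerVal hkn (xm n 0 a' (lam k x.t) * Y * xm n 0 b' (lam k x.t))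
      = ((xm n 0 a' (lam k x.t) * M).submatrix (lastF hkn.le) id).det *
        ((Equiv.Perm.sign (Fin.revPerm : Equiv.Perm (Fin k)) : ℤ) : ℂ) *
        ((xm n 0 b' (lam k x.t) * V).submatrix (lastF hkn.le) id).det := by
    intro a' b'
    have hT : ((xm n 0 b' (lam k x.t) * V).submatrix (lastF hkn.le) id).submatrix
        (Fin.revPerm : Equiv.Perm (Fin k)) id
        = ((W * xm n 0 b' (lam k x.t)).submatrix id (firstF hkn.le)).transpose := by
      conv_lhs => rw [← cflip_xm (by omega) b' (lam k x.t)]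
      ext s l
      simp only [Matrix.submatrix_apply, id, Matrix.transpose_apply, Matrix.mul_apply, cflip, hV,
        Matrix.of_apply, Fin.revPerm_apply]
      rw [← Equiv.sum_comp Fin.revPerm]
      refine Finset.sum_congr rfl fun r _ => ?_
      have : Fin.rev (lastF hkn.le (Fin.rev s)) = firstF hkn.le s := by
        ext
        simp only [lastF, firstF, Fin.val_rev]
        have := s.2
        omega
      simp [this, mul_comm]
    rw [mul_assoc (Matrix.det _), ← Matrix.det_permute, hT, Matrix.det_transpose,
      ← Matrix.det_mul, cornerVal, hMW]
    congr 1
    rw [← Matrix.submatrix_mul _ _ _ id _ Function.bijective_id, Matrix.mul_assoc,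
      Matrix.mul_assoc, Matrix.mul_assoc]
  have h0 := hsplit 0 0
  rw [xm_zero, Matrix.one_mul, Matrix.mul_one, Matrix.one_mul, Matrix.one_mul] at h0
  rw [hsplit, h0, det_xm_zero_mul hk hkn x hx x.isRep_rep a, hxy,
    det_xm_zero_mul hk hkn y hy hVy b]
  ring

end Corner

end GeomCrystal

namespace GeomCrystal

/-! ### Crystal operators on products and the two coenergy identities -/

section Product

variable {n : ℕ} [NeZero n] {k₁ k₂ : ℕ}

/-- The crystal operators on a product, in terms of matrices. -/
theorem exists_eProd_eq (hk₁ : 1 ≤ k₁) (hk₁n : k₁ < n) (hk₂ : 1 ≤ k₂) (hk₂n : k₂ < n)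
    {u : XX n k₁} {v : XX n k₂} (hu : u.Good) (hv : v.Good) (i : ℤ) (c : ℂˣ) {ε φ ε' φ' : ℂ}
    (hε : ε = gam u (cyc n i) (cyc n (i - 1)) / gam u (cyc n i) (cyc n i))
    (hφ : φ = gam v (cyc n i) (cyc n (i - 1)) / gam v (cyc n (i - 1)) (cyc n (i - 1)))
    (hφ' : φ' = gam u (cyc n i) (cyc n (i - 1)) / gam u (cyc n (i - 1)) (cyc n (i - 1)))
    (hε' : ε' = gam v (cyc n i) (cyc n (i - 1)) / gam v (cyc n i) (cyc n i))
    (hu0 : gam u (cyc n i) (cyc n (i - 1)) ≠ 0) (hv0 : gam v (cyc n i) (cyc n (i - 1)) ≠ 0)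
    (h1 : ε + φ ≠ 0) (hc : (c : ℂ) * ε + φ ≠ 0) :
    ∃ (u' : XX n k₁) (v' : XX n k₂), eProd i c u v = Part.some (u', v') ∧ u'.Good ∧ v'.Good ∧
      ∀ μ : ℂ, μ ≠ 0 → ev (gam u') μ * ev (gam v') μ
        = xm n i (((c : ℂ) - 1) * ε / (φ' * (ε + φ))) μ * (ev (gam u) μ * ev (gam v) μ) *
          xm n i (((c : ℂ)⁻¹ - 1) * φ / (ε' * (ε + φ))) μ := by
  have hn : 2 ≤ n := by omega
  have hc0 := c.ne_zero
  have hu00 := gam_diag_ne_zero hk₁ hk₁n hu (cyc n (i - 1))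
  have hu11 := gam_diag_ne_zero hk₁ hk₁n hu (cyc n i)
  have hv00 := gam_diag_ne_zero hk₂ hk₂n hv (cyc n (i - 1))
  have hv11 := gam_diag_ne_zero hk₂ hk₂n hv (cyc n i)
  have hε0 : ε ≠ 0 := hε ▸ div_ne_zero hu0 hu11
  have hφ0 : φ ≠ 0 := hφ ▸ div_ne_zero hv0 hv00
  have hε'0 : ε' ≠ 0 := hε' ▸ div_ne_zero hv0 hv11
  have hφ'0 : φ' ≠ 0 := hφ' ▸ div_ne_zero hu0 hu00
  have h2 : ε + (c : ℂ)⁻¹ * φ ≠ 0 := by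
    intro h
    apply hc
    have : (c : ℂ) * ε + φ = c * (ε + (c : ℂ)⁻¹ * φ) := by field_simp
    rw [this, h, mul_zero]
  set c₁ : ℂˣ := Units.mk0 (((c : ℂ) * ε + φ) / (ε + φ)) (div_ne_zero hc h1) with hc₁
  set c₂ : ℂˣ := Units.mk0 ((ε + φ) / (ε + (c : ℂ)⁻¹ * φ)) (div_ne_zero h1 h2) with hc₂
  have hc₁v : (c₁ : ℂ) = ((c : ℂ) * ε + φ) / (ε + φ) := rfl
  have hc₂v : (c₂ : ℂ) = (ε + φ) / (ε + (c : ℂ)⁻¹ * φ) := rfl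
  obtain ⟨u', hu'e, -, hu'g, hu'⟩ := exists_eOp_eq hk₁ hk₁n hu i c₁ hu0
  obtain ⟨v', hv'e, -, hv'g, hv'⟩ := exists_eOp_eq hk₂ hk₂n hv i c₂ hv0
  refine ⟨u', v', ?_, hu'g, hv'g, fun μ hμ => ?_⟩
  · rw [eProd, gam_succ_ratio_eps hk₁ hk₁n hu, ← hε]
    change (Part.some _).bind _ = _
    rw [Part.bind_some, gam_succ_ratio_phi hk₂ hk₂n hv, ← hφ]
    change (Part.some _).bind _ = _
    rw [Part.bind_some, show pdiv ((c : ℂ) * ε + φ) (ε + φ) = Part.some (c₁ : ℂ) from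
      Part.eq_some_iff.2 ⟨h1, rfl⟩]
    change (Part.some _).bind _ = _
    rw [Part.bind_some, show toUnit (c₁ : ℂ) = Part.some c₁ from
      Part.eq_some_iff.2 ⟨c₁.ne_zero, Units.ext rfl⟩]
    change (Part.some _).bind _ = _
    rw [Part.bind_some, show pdiv (ε + φ) (ε + (c : ℂ)⁻¹ * φ) = Part.some (c₂ : ℂ) from
      Part.eq_some_iff.2 ⟨h2, rfl⟩]
    change (Part.some _).bind _ = _
    rw [Part.bind_some, show toUnit (c₂ : ℂ) = Part.some c₂ from
      Part.eq_some_iff.2 ⟨c₂.ne_zero, Units.ext rfl⟩]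
    change (Part.some _).bind _ = _
    rw [Part.bind_some, hu'e]
    change (Part.some _).bind _ = _
    rw [Part.bind_some, hv'e]
    change (Part.some _).bind _ = _
    rw [Part.bind_some]
    rfl
  · rw [hu' μ hμ, hv' μ hμ, ← hε, ← hφ, ← hφ', ← hε']
    set b := ((c₁ : ℂ)⁻¹ - 1) / ε with hb
    set a := ((c₂ : ℂ) - 1) / φ with ha
    -- The right factor of g(e_i^{c₁}u) meets the left factor of g(e_i^{c₂}v). Their parameters are
    -- (1-c)/(cε+φ) and (c-1)/(cε+φ), so they cancel: this is the role of the formulas for c₁ and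
    -- c₂.
    have hba : b + a = 0 := by
      have h2' : (c : ℂ) * ε + φ = c * (ε + (c : ℂ)⁻¹ * φ) := by field_simp
      rw [hb, ha, hc₁v, hc₂v, h2']
      field_simp
      ring
    have e1 : ((c₁ : ℂ) - 1) / φ' = ((c : ℂ) - 1) * ε / (φ' * (ε + φ)) := by
      rw [hc₁v]
      field_simp
      ring
    have e2 : ((c₂ : ℂ)⁻¹ - 1) / ε' = ((c : ℂ)⁻¹ - 1) * φ / (ε' * (ε + φ)) := by
      rw [hc₂v, inv_div]
      have : (ε + (c : ℂ)⁻¹ * φ) / (ε + φ) - 1 = ((c : ℂ)⁻¹ - 1) * φ / (ε + φ) := by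
        rw [div_sub_one h1]
        ring
      rw [this, div_div]
      congr 1
      ring
    rw [e1, e2]
    have hmid : xm n i b μ * xm n i a μ = 1 := by rw [xm_mul_xm hn, hba, xm_zero]
    calc _ = xm n i (((c : ℂ) - 1) * ε / (φ' * (ε + φ))) μ * ev (gam u) μ *
          (xm n i b μ * xm n i a μ) * ev (gam v) μ *
          xm n i (((c : ℂ)⁻¹ - 1) * φ / (ε' * (ε + φ))) μ := by simp only [Matrix.mul_assoc]
      _ = _ := by rw [hmid]; simp only [Matrix.mul_assoc, Matrix.one_mul]

/-- The invariance of `E` under `e_i^c`, `i ≠ 0`, at sufficiently generic points. -/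
theorem compE_coenergyE_eq (hk₁ : 1 ≤ k₁) (hk₁n : k₁ < n) (hk₂ : 1 ≤ k₂) (hk₂n : k₂ < n)
    {u : XX n k₁} {v : XX n k₂} (hu : u.Good) (hv : v.Good) {i : ℤ} (hi : ¬ i ≡ 0 [ZMOD n])
    (c : ℂˣ)
    (hu0 : gam u (cyc n i) (cyc n (i - 1)) ≠ 0) (hv0 : gam v (cyc n i) (cyc n (i - 1)) ≠ 0)
    (h1 : gam u (cyc n i) (cyc n (i - 1)) / gam u (cyc n i) (cyc n i) +
      gam v (cyc n i) (cyc n (i - 1)) / gam v (cyc n (i - 1)) (cyc n (i - 1)) ≠ 0)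
    (hc : (c : ℂ) * (gam u (cyc n i) (cyc n (i - 1)) / gam u (cyc n i) (cyc n i)) +
      gam v (cyc n i) (cyc n (i - 1)) / gam v (cyc n (i - 1)) (cyc n (i - 1)) ≠ 0) :
    ∃ z, compE coenergyE i c u v = Part.some z ∧ coenergyE u v = Part.some z := by
  have hkn : min k₁ k₂ < n := (min_le_left _ _).trans_lt hk₁n
  obtain ⟨u', v', he, hu', hv', hev⟩ :=
    exists_eProd_eq hk₁ hk₁n hk₂ hk₂n hu hv i c rfl rfl rfl rfl hu0 hv0 h1 hc
  refine ⟨_, ?_, coenergyE_eq hk₁ hk₁n hk₂ hk₂n hkn hu hv⟩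
  rw [compE, he]
  change (Part.some _).bind _ = _
  rw [Part.bind_some, coenergyE_eq hk₁ hk₁n hk₂ hk₂n hkn hu' hv']
  congr 1
  -- The corner minor being independent of λ, any nonzero value serves; λ = 1 is used.
  have e1 := corner_ev hkn (min_le_left k₁ k₂) (min_le_right k₁ k₂) (loop_gam hk₁ hk₁n hu)
    (loop_gam hk₂ hk₂n hv) 1
  have e2 := corner_ev hkn (min_le_left k₁ k₂) (min_le_right k₁ k₂) (loop_gam hk₁ hk₁n hu')
    (loop_gam hk₂ hk₂n hv') 1
  have e3 := cornerVal_xm_mul hkn hi (((c : ℂ) - 1) *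
      (gam u (cyc n i) (cyc n (i - 1)) / gam u (cyc n i) (cyc n i)) /
        (gam u (cyc n i) (cyc n (i - 1)) / gam u (cyc n (i - 1)) (cyc n (i - 1)) *
          (gam u (cyc n i) (cyc n (i - 1)) / gam u (cyc n i) (cyc n i) +
      gam v (cyc n i) (cyc n (i - 1)) / gam v (cyc n (i - 1)) (cyc n (i - 1)))))
    (((c : ℂ)⁻¹ - 1) * (gam v (cyc n i) (cyc n (i - 1)) / gam v (cyc n (i - 1)) (cyc n (i - 1))) /
      (gam v (cyc n i) (cyc n (i - 1)) / gam v (cyc n i) (cyc n i) *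
      (gam u (cyc n i) (cyc n (i - 1)) / gam u (cyc n i) (cyc n i) +
      gam v (cyc n i) (cyc n (i - 1)) / gam v (cyc n (i - 1)) (cyc n (i - 1))))) 1
    (ev (gam u) 1 * ev (gam v) 1)
  rw [← hev 1 one_ne_zero] at e3
  rw [cornerVal, cornerVal, e1, e2] at e3
  exact e3

omit [NeZero n] in
theorem span_col_mul_of_det_ne_zero (Y Z : Matrix (Fin n) (Fin n) ℂ) (hZ : Z.det ≠ 0) :
    Submodule.span ℂ (Set.range (Y * Z).col) = Submodule.span ℂ (Set.range Y.col) := by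
  rw [← Matrix.range_mulVecLin, ← Matrix.range_mulVecLin, Matrix.mulVecLin_mul,
    LinearMap.range_comp_of_range_eq_top]
  rw [LinearMap.range_eq_top]
  exact Matrix.mulVec_surjective_iff_isUnit.2 ((Matrix.isUnit_iff_isUnit_det _).2
    (isUnit_iff_ne_zero.2 hZ))

omit [NeZero n] in
theorem cornerVal_congr {k k' : ℕ} (h : k = k') (hkn : k < n) (hkn' : k' < n)
    (Y : Matrix (Fin n) (Fin n) ℂ) : cornerVal hkn Y = cornerVal hkn' Y := by
  subst h
  rfl

/-- The behaviour of `E` under `e_0^c` at sufficiently generic points. -/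
theorem compE_zero_coenergyE (hk₁ : 1 ≤ k₁) (hk₁n : k₁ < n) (hk₂ : 1 ≤ k₂) (hk₂n : k₂ < n)
    {u : XX n k₁} {v : XX n k₂} (hu : u.Good) (hv : v.Good) (c : ℂˣ)
    (hu0 : gam u (cyc n 0) (cyc n (0 - 1)) ≠ 0) (hv0 : gam v (cyc n 0) (cyc n (0 - 1)) ≠ 0)
    (h1 : gam u (cyc n 0) (cyc n (0 - 1)) / gam u (cyc n 0) (cyc n 0) +
      gam v (cyc n 0) (cyc n (0 - 1)) / gam v (cyc n (0 - 1)) (cyc n (0 - 1)) ≠ 0)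
    (hc : (c : ℂ) * (gam u (cyc n 0) (cyc n (0 - 1)) / gam u (cyc n 0) (cyc n 0)) +
      gam v (cyc n 0) (cyc n (0 - 1)) / gam v (cyc n (0 - 1)) (cyc n (0 - 1)) ≠ 0)
    (hne : lam k₁ u.t ≠ lam k₂ v.t)
    (hgood : ∀ j : Fin n, ∀ y ∈ v.N.map (ev (gam u) (lam k₂ v.t)).mulVecLin,
      (∀ i ∈ baseSet k₂ j, y i = 0) → y = 0) :
    ∃ z, z ∈ compE coenergyE 0 c u v ∧ z ∈ coenergyRHS coenergyE c u v := by
  have hkn : min k₁ k₂ < n := (min_le_left _ _).trans_lt hk₁n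
  have hc0 := c.ne_zero
  obtain ⟨v', u', hR, hv't, hu't, hv', hu', hfac, hv'N⟩ :=
    exists_geomR_eq hk₁ hk₁n hk₂ hk₂n hu hv hne hgood
  have lu := loop_gam hk₁ hk₁n hu
  have lv := loop_gam hk₂ hk₂n hv
  have lu' := loop_gam hk₁ hk₁n hu'
  have lv' := loop_gam hk₂ hk₂n hv'
  -- Diagonal and subdiagonal entries of the two factorisations at the unfolded columns -1 and 0.
  -- The last comparison also gives ε_0(v') + φ_0(u') ≠ 0 below.
  have f00 : gam u (cyc n (0 - 1)) (cyc n (0 - 1)) * gam v (cyc n (0 - 1)) (cyc n (0 - 1))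
      = gam v' (cyc n (0 - 1)) (cyc n (0 - 1)) * gam u' (cyc n (0 - 1)) (cyc n (0 - 1)) := by
    have h2 := (lu.band hk₁ hk₁n).arr_mul_self (lv.band hk₂ hk₂n) (0 - 1)
    rw [hfac, (lv'.band hk₂ hk₂n).arr_mul_self (lu'.band hk₁ hk₁n)] at h2
    simp only [arr_fold_diag hk₁ hk₁n lu, arr_fold_diag hk₂ hk₂n lv, arr_fold_diag hk₁ hk₁n lu',
      arr_fold_diag hk₂ hk₂n lv'] at h2
    exact h2.symm
  have f11 : gam u (cyc n 0) (cyc n 0) * gam v (cyc n 0) (cyc n 0)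
      = gam v' (cyc n 0) (cyc n 0) * gam u' (cyc n 0) (cyc n 0) := by
    have h2 := (lu.band hk₁ hk₁n).arr_mul_self (lv.band hk₂ hk₂n) 0
    rw [hfac, (lv'.band hk₂ hk₂n).arr_mul_self (lu'.band hk₁ hk₁n)] at h2
    simp only [arr_fold_diag hk₁ hk₁n lu, arr_fold_diag hk₂ hk₂n lv, arr_fold_diag hk₁ hk₁n lu',
      arr_fold_diag hk₂ hk₂n lv'] at h2
    exact h2.symm
  have f10 : gam u (cyc n 0) (cyc n (0 - 1)) * gam v (cyc n (0 - 1)) (cyc n (0 - 1)) +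
        gam u (cyc n 0) (cyc n 0) * gam v (cyc n 0) (cyc n (0 - 1))
      = gam v' (cyc n 0) (cyc n (0 - 1)) * gam u' (cyc n (0 - 1)) (cyc n (0 - 1)) +
        gam v' (cyc n 0) (cyc n 0) * gam u' (cyc n 0) (cyc n (0 - 1)) := by
    have h2 := (lu.band hk₁ hk₁n).arr_mul_succ (lv.band hk₂ hk₂n) (0 - 1)
    rw [hfac, (lv'.band hk₂ hk₂n).arr_mul_succ (lu'.band hk₁ hk₁n)] at h2
    simp only [arr_fold_diag hk₁ hk₁n lu, arr_fold_diag hk₂ hk₂n lv, arr_fold_diag hk₁ hk₁n lu',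
      arr_fold_diag hk₂ hk₂n lv', arr_fold_succ hk₁ hk₁n lu, arr_fold_succ hk₂ hk₂n lv,
      arr_fold_succ hk₁ hk₁n lu', arr_fold_succ hk₂ hk₂n lv'] at h2
    simp only [sub_add_cancel] at h2
    exact h2.symm
  obtain ⟨u1, v1, he, hu1, hv1, hev⟩ :=
    exists_eProd_eq hk₁ hk₁n hk₂ hk₂n hu hv 0 c rfl rfl rfl rfl hu0 hv0 h1 hc
  have hu00 := gam_diag_ne_zero hk₁ hk₁n hu (cyc n (0 - 1))
  have hu11 := gam_diag_ne_zero hk₁ hk₁n hu (cyc n 0)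
  have hv00 := gam_diag_ne_zero hk₂ hk₂n hv (cyc n (0 - 1))
  have hv11 := gam_diag_ne_zero hk₂ hk₂n hv (cyc n 0)
  have hu'00 := gam_diag_ne_zero hk₁ hk₁n hu' (cyc n (0 - 1))
  have hu'11 := gam_diag_ne_zero hk₁ hk₁n hu' (cyc n 0)
  have hv'00 := gam_diag_ne_zero hk₂ hk₂n hv' (cyc n (0 - 1))
  have hv'11 := gam_diag_ne_zero hk₂ hk₂n hv' (cyc n 0)
  have hz := cyc_eq_zero_iff (n := n) 0
  have hs := cycSucc_cyc (n := n) 0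
  have hzero : ((cyc n 0 : Fin n) : ℕ) = 0 := hz.2 rfl
  have hlast : ((cyc n (0 - 1) : Fin n) : ℕ) = n - 1 := by
    rcases hs with hs | hs <;> omega
  have hrev0 : Fin.rev (cyc n 0) = cyc n (0 - 1) := by
    ext; rw [Fin.val_rev]; omega
  have hrev1 : Fin.rev (cyc n (0 - 1)) = cyc n 0 := by
    rw [← hrev0, Fin.rev_rev]
  have hE := coenergyE_eq hk₁ hk₁n hk₂ hk₂n hkn hu hv
  have hE1 := coenergyE_eq hk₁ hk₁n hk₂ hk₂n hkn hu1 hv1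
  have hcomp : compE coenergyE 0 c u v = Part.some (cornerVal hkn (gam u1 * gam v1)) := by
    rw [compE, he]
    change (Part.some _).bind _ = _
    rw [Part.bind_some]
    exact hE1
  have hcor : ∀ μ, cornerVal hkn (ev (gam u) μ * ev (gam v) μ) = cornerVal hkn (gam u * gam v) := by
    intro μ
    rw [cornerVal, cornerVal, corner_ev hkn (min_le_left k₁ k₂) (min_le_right k₁ k₂) lu lv]
  have hcor1 : ∀ μ,
      cornerVal hkn (ev (gam u1) μ * ev (gam v1) μ) = cornerVal hkn (gam u1 * gam v1) := by
    intro μ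
    rw [cornerVal, cornerVal, corner_ev hkn (min_le_left k₁ k₂) (min_le_right k₁ k₂)
      (loop_gam hk₁ hk₁n hu1) (loop_gam hk₂ hk₂n hv1)]
  have heps := gam_succ_ratio_eps hk₁ hk₁n hu 0
  have hphi := gam_succ_ratio_phi hk₂ hk₂n hv 0
  have heps' := gam_succ_ratio_eps hk₂ hk₂n hv' 0
  have hphi' := gam_succ_ratio_phi hk₁ hk₁n hu' 0
  have hevμ : ∀ μ, ev (gam u) μ * ev (gam v) μ = ev (gam v') μ * ev (gam u') μ := by
    intro μ
    have := congrArg (fun A => A.map (eval μ)) hfac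
    simpa only [map_eval_mul, map_eval_fold] using this
  set p0 := cyc n (0 - 1)
  set p1 := cyc n 0
  set E := cornerVal hkn (gam u * gam v) with hEdef
  have hA10 : gam u p1 p0 * gam v p0 p0 + gam u p1 p1 * gam v p1 p0 ≠ 0 := by
    intro h
    apply h1
    field_simp
    linear_combination h
  have h1' : gam v' p1 p0 / gam v' p1 p1 + gam u' p1 p0 / gam u' p0 p0 ≠ 0 := by
    intro h
    apply hA10
    rw [f10]
    field_simp at h
    linear_combination h
  have hval : cornerVal hkn (gam u1 * gam v1) = E *
      ((gam u p1 p0 / gam u p1 p1 + (c : ℂ)⁻¹ * (gam v p1 p0 / gam v p0 p0)) /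
        (gam u p1 p0 / gam u p1 p1 + gam v p1 p0 / gam v p0 p0)) *
      (((c : ℂ) * (gam v' p1 p0 / gam v' p1 p1) + gam u' p1 p0 / gam u' p0 p0) /
        (gam v' p1 p0 / gam v' p1 p1 + gam u' p1 p0 / gam u' p0 p0)) := by
    have hdiv : ∀ U11 V00 U10 V10 : ℂ, U11 ≠ 0 → V00 ≠ 0 →
        U10 / U11 + V10 / V00 = (U10 * V00 + U11 * V10) / (U11 * V00) := by
      intro U11 V00 U10 V10 h2 h3
      field_simp
    -- This is the shape produced by the case k₁ ≤ k₂. It agrees with the required one since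
    -- (cε+φ)(ε'+c⁻¹φ') = (ε+c⁻¹φ)(cε'+φ').
    have hE' : cornerVal hkn (gam u1 * gam v1) = E *
        ((c * (gam u p1 p0 * gam v p0 p0) + gam u p1 p1 * gam v p1 p0) /
          (gam u p1 p0 * gam v p0 p0 + gam u p1 p1 * gam v p1 p0)) *
        ((gam v' p1 p0 * gam u' p0 p0 + (c : ℂ)⁻¹ * (gam v' p1 p1 * gam u' p1 p0)) /
          (gam u p1 p0 * gam v p0 p0 + gam u p1 p1 * gam v p1 p0)) := by
      have hα : ((c : ℂ) - 1) * (gam u p1 p0 / gam u p1 p1) / (gam u p1 p0 / gam u p0 p0 *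
            (gam u p1 p0 / gam u p1 p1 + gam v p1 p0 / gam v p0 p0))
          = ((c : ℂ) - 1) * (gam u p0 p0 * gam v p0 p0) /
            (gam u p1 p0 * gam v p0 p0 + gam u p1 p1 * gam v p1 p0) := by
        rw [hdiv _ _ _ _ hu11 hv00]
        field_simp
      have hβ : ((c : ℂ)⁻¹ - 1) * (gam v p1 p0 / gam v p0 p0) / (gam v p1 p0 / gam v p1 p1 *
            (gam u p1 p0 / gam u p1 p1 + gam v p1 p0 / gam v p0 p0))
          = ((c : ℂ)⁻¹ - 1) * (gam u p1 p1 * gam v p1 p1) /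
            (gam u p1 p0 * gam v p0 p0 + gam u p1 p1 * gam v p1 p0) := by
        rw [hdiv _ _ _ _ hu11 hv00]
        field_simp
      simp only [hα, hβ] at hev
      set A10 := gam u p1 p0 * gam v p0 p0 + gam u p1 p1 * gam v p1 p0 with hA10def
      rcases le_total k₁ k₂ with hle | hle
      -- At the special value of u the product g(u)g(v) has column space u.N. Written as g(v')g(u'),
      -- its flip has the column space of S(u'), and φ_0(S(u')) = ε_0(u').
      · have hmin : min k₁ k₂ = k₁ := min_eq_left hle
        obtain ⟨w, -, hwt, hwg, hwγ⟩ := exists_schutz_eq hk₁ hk₁n hu'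
        have hμ := lam_ne_zero k₁ u.t
        have hdv : (ev (gam v) (lam k₁ u.t)).det ≠ 0 := det_ev_gam_ne_zero hk₂ hk₂n hv hne
        have hdv' : (ev (gam v') (lam k₁ u.t)).det ≠ 0 :=
          det_ev_gam_ne_zero hk₂ hk₂n hv' (by rw [hv't]; exact hne)
        have key := cornerVal_xm_zero hk₁ hk₁n hu hwg (hu't.symm.trans hwt.symm)
          (Y := ev (gam u) (lam k₁ u.t) * ev (gam v) (lam k₁ u.t))
          (by rw [span_col_mul_of_det_ne_zero _ _ hdv, span_col_ev_gam hk₁ hk₁n hu])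
          (by rw [hevμ, cflip_mul, span_col_mul_of_det_ne_zero _ _ (by rw [det_cflip]; exact hdv'),
                ← ev_cflip, ← hwγ, ← hu't, ← hwt, span_col_ev_gam hk₁ hk₁n hwg])
          (((c : ℂ) - 1) * (gam u p0 p0 * gam v p0 p0) / A10)
          (((c : ℂ)⁻¹ - 1) * (gam u p1 p1 * gam v p1 p1) / A10)
        rw [← hev _ hμ, ← cornerVal_congr hmin hkn, ← cornerVal_congr hmin hkn, hcor, hcor1] at key
        rw [key, hwγ]
        change E * (1 + _ * (gam u p1 p0 / gam u p0 p0)) * (1 + _ * (gam u' (Fin.rev p0) (Fin.rev p1)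
          / gam u' (Fin.rev p0) (Fin.rev p0))) = _
        rw [hrev0, hrev1]
        congr 1
        · congr 1
          field_simp
          rw [hA10def]
          ring
        · rw [f11]
          have hA : A10 = _ := f10
          field_simp
          rw [hA]
          ring
      -- At the special value of v the column space of g(u)g(v) is v'.N, and that of the flip
      -- belongs to S(v), with φ_0(S(v)) = ε_0(v).
      · have hmin : min k₁ k₂ = k₂ := min_eq_right hle
        obtain ⟨w, -, hwt, hwg, hwγ⟩ := exists_schutz_eq hk₂ hk₂n hv
        have hμ := lam_ne_zero k₂ v.t
        have hdu : (ev (gam u) (lam k₂ v.t)).det ≠ 0 := det_ev_gam_ne_zero hk₁ hk₁n hu hne.symm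
        have key := cornerVal_xm_zero hk₂ hk₂n hv' hwg (hv't.trans hwt.symm)
          (Y := ev (gam u) (lam k₂ v.t) * ev (gam v) (lam k₂ v.t))
          (by rw [hv'N, ← span_col_ev_gam hk₂ hk₂n hv, ← Set.image_univ, ← Set.image_univ,
                span_col_mul])
          (by rw [cflip_mul, span_col_mul_of_det_ne_zero _ _ (by rw [det_cflip]; exact hdu),
                ← ev_cflip, ← hwγ, ← hwt, span_col_ev_gam hk₂ hk₂n hwg])
          (((c : ℂ) - 1) * (gam u p0 p0 * gam v p0 p0) / A10)
          (((c : ℂ)⁻¹ - 1) * (gam u p1 p1 * gam v p1 p1) / A10)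
        rw [hv't, ← hev _ hμ, ← cornerVal_congr hmin hkn, ← cornerVal_congr hmin hkn, hcor,
          hcor1] at key
        rw [key, hwγ]
        change E * (1 + _ * (gam v' p1 p0 / gam v' p0 p0)) * (1 + _ * (gam v (Fin.rev p0) (Fin.rev p1)
          / gam v (Fin.rev p0) (Fin.rev p0))) = _
        rw [hrev0, hrev1]
        have e1 : 1 + ((c : ℂ) - 1) * (gam u p0 p0 * gam v p0 p0) / A10 *
            (gam v' p1 p0 / gam v' p0 p0) = (c * (gam v' p1 p0 * gam u' p0 p0) +
              gam v' p1 p1 * gam u' p1 p0) / A10 := by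
          rw [f00]
          have hA : A10 = _ := f10
          field_simp
          rw [hA]
          ring
        have e2 : 1 + ((c : ℂ)⁻¹ - 1) * (gam u p1 p1 * gam v p1 p1) / A10 *
            (gam v p1 p0 / gam v p1 p1) = (gam u p1 p0 * gam v p0 p0 +
              (c : ℂ)⁻¹ * (gam u p1 p1 * gam v p1 p0)) / A10 := by
          field_simp
          rw [hA10def]
          ring
        rw [e1, e2]
        field_simp
    rw [hE', hdiv _ _ _ _ hu11 hv00, hdiv _ _ _ _ hv'11 hu'00, ← f10]
    field_simp
  refine ⟨_, Part.eq_some_iff.1 hcomp, Part.eq_some_iff.1 ?_⟩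
  rw [hval, coenergyRHS, hE]
  change (Part.some _).bind _ = _
  rw [Part.bind_some, hR]
  change (Part.some _).bind _ = _
  rw [Part.bind_some, heps]
  change (Part.some _).bind _ = _
  rw [Part.bind_some, hphi]
  change (Part.some _).bind _ = _
  rw [Part.bind_some, heps']
  change (Part.some _).bind _ = _
  rw [Part.bind_some, hphi']
  change (Part.some _).bind _ = _
  rw [Part.bind_some, Part.eq_some_iff.2 (show _ ∈ pdiv _ _ from ⟨h1, rfl⟩)]
  change (Part.some _).bind _ = _
  rw [Part.bind_some, Part.eq_some_iff.2 (show _ ∈ pdiv _ _ from ⟨h1', rfl⟩)]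
  change (Part.some _).bind _ = _
  rw [Part.bind_some]
  rfl

end Product

end GeomCrystal

namespace GeomCrystal

/-! ### Regular functions on the complement of a hypersurface -/

section Regular

variable {σ : Type*}

/-- `f` is a polynomial divided by a power of `D`, wherever the polynomial `D` does not vanish. -/
def Reg (D : MvPolynomial σ ℂ) (f : (σ → ℂ) → ℂ) : Prop :=
  ∃ (p : MvPolynomial σ ℂ) (m : ℕ), ∀ ξ, MvPolynomial.eval ξ D ≠ 0 →
    f ξ * MvPolynomial.eval ξ D ^ m = MvPolynomial.eval ξ p

variable {D : MvPolynomial σ ℂ} {f g : (σ → ℂ) → ℂ}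

theorem Reg.const (c : ℂ) : Reg D fun _ => c :=
  ⟨MvPolynomial.C c, 0, fun ξ _ => by simp⟩

theorem Reg.coord (i : σ) : Reg D fun ξ => ξ i :=
  ⟨MvPolynomial.X i, 0, fun ξ _ => by simp⟩

theorem Reg.add (hf : Reg D f) (hg : Reg D g) : Reg D fun ξ => f ξ + g ξ := by
  obtain ⟨p, m, hp⟩ := hf
  obtain ⟨q, l, hq⟩ := hg
  refine ⟨p * D ^ l + q * D ^ m, m + l, fun ξ h => ?_⟩
  rw [map_add, map_mul, map_mul, map_pow, map_pow, ← hp ξ h, ← hq ξ h, pow_add]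
  ring

theorem Reg.mul (hf : Reg D f) (hg : Reg D g) : Reg D fun ξ => f ξ * g ξ := by
  obtain ⟨p, m, hp⟩ := hf
  obtain ⟨q, l, hq⟩ := hg
  refine ⟨p * q, m + l, fun ξ h => ?_⟩
  rw [map_mul, ← hp ξ h, ← hq ξ h, pow_add]
  ring

theorem Reg.sum {ι : Type*} (s : Finset ι) {F : ι → (σ → ℂ) → ℂ} (h : ∀ i ∈ s, Reg D (F i)) :
    Reg D fun ξ => ∑ i ∈ s, F i ξ := by
  classical
  induction s using Finset.induction_on with
  | empty => simpa using Reg.const 0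
  | insert a s ha ih =>
    simp only [Finset.sum_insert ha]
    exact (h a (Finset.mem_insert_self a s)).add (ih fun i hi => h i (Finset.mem_insert_of_mem hi))

theorem Reg.prod {ι : Type*} (s : Finset ι) {F : ι → (σ → ℂ) → ℂ} (h : ∀ i ∈ s, Reg D (F i)) :
    Reg D fun ξ => ∏ i ∈ s, F i ξ := by
  classical
  induction s using Finset.induction_on with
  | empty => simpa using Reg.const 1
  | insert a s ha ih =>
    simp only [Finset.prod_insert ha]
    exact (h a (Finset.mem_insert_self a s)).mul (ih fun i hi => h i (Finset.mem_insert_of_mem hi))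

theorem Reg.det {m : ℕ} {M : (σ → ℂ) → Matrix (Fin m) (Fin m) ℂ}
    (h : ∀ i j, Reg D fun ξ => M ξ i j) : Reg D fun ξ => (M ξ).det := by
  simp only [Matrix.det_apply']
  exact Reg.sum _ fun τ _ => (Reg.const _).mul (Reg.prod _ fun i _ => h _ _)

theorem Reg.maxMinor {n m : ℕ} {M : (σ → ℂ) → Matrix (Fin n) (Fin m) ℂ}
    (h : ∀ i j, Reg D fun ξ => M ξ i j) (I : Finset (Fin n)) :
    Reg D fun ξ => GeomCrystal.maxMinor (M ξ) I := by
  by_cases hI : I.card = m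
  · simp only [maxMinor_of_card _ hI]
    exact Reg.det fun i j => h _ _
  · simp only [maxMinor_of_card_ne _ hI]
    exact Reg.const 0

/-- Division by a factor of D is multiplication by the complementary factor at the cost of one more
power of D. -/
theorem Reg.div_of_dvd {d : MvPolynomial σ ℂ} (hf : Reg D f) (hd : d ∣ D)
    (hg : ∀ ξ, g ξ = MvPolynomial.eval ξ d) : Reg D fun ξ => f ξ / g ξ := by
  obtain ⟨p, m, hp⟩ := hf
  obtain ⟨e, rfl⟩ := hd
  refine ⟨p * e, m + 1, fun ξ h => ?_⟩
  have h1 := hp ξ h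
  rw [map_mul] at h h1
  have h2 : MvPolynomial.eval ξ d ≠ 0 := left_ne_zero_of_mul h
  rw [map_mul, map_mul, ← h1]
  show f ξ / g ξ * _ = _
  rw [hg]
  field_simp
  ring

/-- `Q` holds wherever a suitable nonzero polynomial does not vanish. -/
def Gen (Q : (σ → ℂ) → Prop) : Prop :=
  ∃ F : MvPolynomial σ ℂ, F ≠ 0 ∧ ∀ ξ, MvPolynomial.eval ξ F ≠ 0 → Q ξ

theorem Gen.and {Q R : (σ → ℂ) → Prop} (hQ : Gen Q) (hR : Gen R) : Gen fun ξ => Q ξ ∧ R ξ := by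
  obtain ⟨F, hF, hFQ⟩ := hQ
  obtain ⟨G, hG, hGR⟩ := hR
  refine ⟨F * G, mul_ne_zero hF hG, fun ξ h => ?_⟩
  rw [map_mul] at h
  exact ⟨hFQ ξ (left_ne_zero_of_mul h), hGR ξ (right_ne_zero_of_mul h)⟩

theorem Gen.forall {ι : Type*} [Fintype ι] {Q : ι → (σ → ℂ) → Prop} (h : ∀ i, Gen (Q i)) :
    Gen fun ξ => ∀ i, Q i ξ := by
  choose F hF hFQ using h
  refine ⟨∏ i, F i, Finset.prod_ne_zero_iff.2 fun i _ => hF i, fun ξ h i => ?_⟩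
  rw [map_prod] at h
  exact hFQ i ξ (Finset.prod_ne_zero_iff.1 h i (Finset.mem_univ i))

/-- A regular function which does not vanish at some point is generically nonzero. -/
theorem Reg.gen (hf : Reg D f) (h : ∃ ξ, MvPolynomial.eval ξ D ≠ 0 ∧ f ξ ≠ 0) :
    Gen fun ξ => MvPolynomial.eval ξ D ≠ 0 ∧ f ξ ≠ 0 := by
  obtain ⟨p, m, hp⟩ := hf
  obtain ⟨ξ₀, h1, h2⟩ := h
  refine ⟨D * p, fun h0 => ?_, fun ξ hξ => ?_⟩
  · have h3 := congrArg (MvPolynomial.eval ξ₀) h0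
    rw [map_mul, ← hp ξ₀ h1, map_zero] at h3
    exact mul_ne_zero h1 (mul_ne_zero h2 (pow_ne_zero _ h1)) h3
  · rw [map_mul] at hξ
    have h3 := left_ne_zero_of_mul hξ
    have h4 := right_ne_zero_of_mul hξ
    rw [← hp ξ h3] at h4
    exact ⟨h3, left_ne_zero_of_mul h4⟩

end Regular

/-! ### Generic matrices -/

section Generic

variable {n k : ℕ}

/-- A maximal minor of a matrix of polynomials. -/
noncomputable def polyMinor {σ : Type*} (M : Matrix (Fin n) (Fin k) (MvPolynomial σ ℂ))
    (I : Finset (Fin n)) : MvPolynomial σ ℂ :=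
  if h : I.card = k then (M.submatrix (I.orderEmbOfFin h) id).det else 0

theorem eval_polyMinor {σ : Type*} (M : Matrix (Fin n) (Fin k) (MvPolynomial σ ℂ))
    (I : Finset (Fin n)) (ξ : σ → ℂ) :
    MvPolynomial.eval ξ (polyMinor M I) = maxMinor (M.map (MvPolynomial.eval ξ)) I := by
  rw [polyMinor, maxMinor]
  split_ifs with h
  · rw [RingHom.map_det]
    rfl
  · simp

theorem exists_maxMinor_ne_zero {I : Finset (Fin n)} (hI : I.card = k) :
    ∃ B : Matrix (Fin n) (Fin k) ℂ, maxMinor B I ≠ 0 := by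
  refine ⟨Matrix.of fun i j => if i = I.orderEmbOfFin hI j then 1 else 0, ?_⟩
  rw [maxMinor_of_card _ hI]
  have : (Matrix.of fun i j => if i = I.orderEmbOfFin hI j then (1 : ℂ) else 0).submatrix
      (I.orderEmbOfFin hI) id = 1 := by
    ext a b
    simp [Matrix.one_apply]
  rw [this, Matrix.det_one]
  exact one_ne_zero

/-- For an invertible matrix `G`, all maximal minors of `B` and of `G * B` are nonzero, for a
suitable `B`. -/
theorem exists_generic_matrix (k : ℕ) {G : Matrix (Fin n) (Fin n) ℂ} (hG : G.det ≠ 0) :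
    ∃ B : Matrix (Fin n) (Fin k) ℂ, ∀ I : Finset (Fin n), I.card = k →
      maxMinor B I ≠ 0 ∧ maxMinor (G * B) I ≠ 0 := by
  set Z : Matrix (Fin n) (Fin k) (MvPolynomial (Fin n × Fin k) ℂ) :=
    Matrix.of fun i j => MvPolynomial.X (i, j) with hZ
  have hZev : ∀ B : Matrix (Fin n) (Fin k) ℂ,
      Z.map (MvPolynomial.eval fun p : Fin n × Fin k => B p.1 p.2) = B := by
    intro B
    ext i j
    simp [hZ]
  set GZ : Matrix (Fin n) (Fin k) (MvPolynomial (Fin n × Fin k) ℂ) :=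
    (MvPolynomial.C : ℂ →+* MvPolynomial (Fin n × Fin k) ℂ).mapMatrix G * Z with hGZ
  have hGZev : ∀ B : Matrix (Fin n) (Fin k) ℂ,
      GZ.map (MvPolynomial.eval fun p : Fin n × Fin k => B p.1 p.2) = G * B := by
    intro B
    rw [hGZ, Matrix.map_mul, hZev]
    congr 1
    ext i j
    simp
  have hne : ∏ I ∈ Finset.univ.powersetCard k,
      (polyMinor Z I * polyMinor GZ I) ≠ 0 := by
    refine Finset.prod_ne_zero_iff.2 fun I hI => ?_
    obtain ⟨B, hB⟩ := exists_maxMinor_ne_zero (k := k) (Finset.mem_powersetCard.1 hI).2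
    refine mul_ne_zero (fun h => ?_) fun h => ?_
    · have h1 := eval_polyMinor Z I fun p : Fin n × Fin k => B p.1 p.2
      rw [h, hZev, map_zero] at h1
      exact hB h1.symm
    · have h1 := eval_polyMinor GZ I fun p : Fin n × Fin k => (G⁻¹ * B) p.1 p.2
      -- Evaluated at G⁻¹ * B, the minor of the second product becomes that of B, so the polynomial
      -- is nonzero.
      rw [h, hGZev, map_zero, ← Matrix.mul_assoc, Matrix.mul_nonsing_inv _
        (isUnit_iff_ne_zero.2 hG), Matrix.one_mul] at h1
      exact hB h1.symm
  obtain ⟨ξ, hξ⟩ : ∃ ξ, MvPolynomial.eval ξ (∏ I ∈ Finset.univ.powersetCard k,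
      (polyMinor Z I * polyMinor GZ I)) ≠ 0 := by
    by_contra hcon
    push Not at hcon
    exact hne (MvPolynomial.funext fun ξ => by rw [hcon ξ, map_zero])
  refine ⟨Matrix.of fun i j => ξ (i, j), fun I hI => ?_⟩
  rw [map_prod] at hξ
  have h1 := Finset.prod_ne_zero_iff.1 hξ I (Finset.mem_powersetCard.2 ⟨Finset.subset_univ _, hI⟩)
  have h2 : ξ = fun p : Fin n × Fin k =>
      (Matrix.of fun i j => ξ (i, j) : Matrix (Fin n) (Fin k) ℂ) p.1 p.2 := rfl
  rw [map_mul, h2, eval_polyMinor, eval_polyMinor, hZev, hGZev] at h1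
  exact ⟨left_ne_zero_of_mul h1, right_ne_zero_of_mul h1⟩

theorem exists_isRep {A : Matrix (Fin n) (Fin k) ℂ} {I : Finset (Fin n)} (hA : maxMinor A I ≠ 0)
    (t : ℂˣ) : ∃ x : XX n k, x.IsRep A ∧ x.t = t := by
  refine ⟨⟨Submodule.span ℂ (Set.range A.col), ?_, t⟩, rfl, rfl⟩
  have hI := maxMinor_ne_zero_card hA
  rw [maxMinor_ne_zero_iff A hI] at hA
  rw [← Matrix.range_mulVecLin, LinearMap.finrank_range_of_inj, Module.finrank_fin_fun]
  rw [injective_iff_map_eq_zero]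
  intro w hw
  exact hA w fun i _ => congrFun hw i

theorem maxMinor_scale_row (B : Matrix (Fin n) (Fin k) ℂ) (p : Fin n) (c : ℂ) (I : Finset (Fin n)) :
    maxMinor (Matrix.of fun i j => (if i = p then c else 1) * B i j) I
      = (if p ∈ I then c else 1) * maxMinor B I := by
  by_cases hI : I.card = k
  · rw [maxMinor_of_card _ hI, maxMinor_of_card _ hI]
    have h1 := Matrix.det_mul_column (fun b => if I.orderEmbOfFin hI b = p then c else 1)
      (B.submatrix (I.orderEmbOfFin hI) id)
    have h2 : (∏ b, if I.orderEmbOfFin hI b = p then c else 1) = if p ∈ I then c else 1 := by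
      split_ifs with hp
      · have : p ∈ Set.range (I.orderEmbOfFin hI) := by
          rw [Finset.range_orderEmbOfFin]; exact hp
        obtain ⟨b, rfl⟩ := this
        simp [(I.orderEmbOfFin hI).injective.eq_iff]
      · refine Finset.prod_eq_one fun b _ => if_neg ?_
        rintro rfl
        exact hp (Finset.orderEmbOfFin_mem I hI b)
    rw [h2] at h1
    exact h1
  · rw [maxMinor_of_card_ne _ hI, maxMinor_of_card_ne _ hI, mul_zero]

end Generic

end GeomCrystal

namespace GeomCrystal

variable {n k k₁ k₂ : ℕ}

/-! ### The functions `g(N|t)_{ij}` in coordinates -/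

/-- The entries of `g(N|t)`, without the factors `λ`, for a matrix `M` representing `N`. -/
noncomputable def repGam (M : Matrix (Fin n) (Fin k) ℂ) (t : ℂ) : Matrix (Fin n) (Fin n) ℂ :=
  Matrix.of fun i j => (if (k : ℕ) ≤ j ∧ j ≤ i then t else 1) *
    (maxMinor M (insert i (lowSet k j)) / maxMinor M (baseSet k j))

theorem repGam_eq_gam {x : XX n k} {M : Matrix (Fin n) (Fin k) ℂ} (hM : x.IsRep M) :
    repGam M x.t = gam x := by
  ext i j
  simp only [repGam, gam, Matrix.of_apply, x.maxMinor_div hM]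

theorem XX.good_of_maxMinor_ne_zero {x : XX n k} {M : Matrix (Fin n) (Fin k) ℂ} (hM : x.IsRep M)
    (hkn : k < n) (h : ∀ I : Finset (Fin n), I.card = k → maxMinor M I ≠ 0) : x.Good := fun j =>
  (x.maxMinor_ne_zero_iff_rep hM _).1 (h _ (card_baseSet hkn j))

section Coordinates

/-- The matrix of the first factor of a point of the coordinate space. -/
def matA (ξ : Coord n k₁ k₂ → ℂ) : Matrix (Fin n) (Fin k₁) ℂ :=
  Matrix.of fun i j => ξ (Sum.inl (Sum.inl (i, j)))

/-- The matrix of the second factor of a point of the coordinate space. -/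
def matB (ξ : Coord n k₁ k₂ → ℂ) : Matrix (Fin n) (Fin k₂) ℂ :=
  Matrix.of fun i j => ξ (Sum.inr (Sum.inl (i, j)))

/-- The torus coordinate of the first factor of a point of the coordinate space. -/
def torA (ξ : Coord n k₁ k₂ → ℂ) : ℂ := ξ (Sum.inl (Sum.inr ()))

/-- The torus coordinate of the second factor of a point of the coordinate space. -/
def torB (ξ : Coord n k₁ k₂ → ℂ) : ℂ := ξ (Sum.inr (Sum.inr ()))

variable (n k₁ k₂) in
/-- The generic matrix of the first factor. -/
noncomputable def varA : Matrix (Fin n) (Fin k₁) (MvPolynomial (Coord n k₁ k₂) ℂ) :=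
  Matrix.of fun i j => MvPolynomial.X (Sum.inl (Sum.inl (i, j)))

variable (n k₁ k₂) in
/-- The generic matrix of the second factor. -/
noncomputable def varB : Matrix (Fin n) (Fin k₂) (MvPolynomial (Coord n k₁ k₂) ℂ) :=
  Matrix.of fun i j => MvPolynomial.X (Sum.inr (Sum.inl (i, j)))

theorem eval_polyMinor_varA (ξ : Coord n k₁ k₂ → ℂ) (I : Finset (Fin n)) :
    MvPolynomial.eval ξ (polyMinor (varA n k₁ k₂) I) = maxMinor (matA ξ) I := by
  rw [eval_polyMinor]
  congr 1
  ext i j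
  simp [varA, matA]

theorem eval_polyMinor_varB (ξ : Coord n k₁ k₂ → ℂ) (I : Finset (Fin n)) :
    MvPolynomial.eval ξ (polyMinor (varB n k₁ k₂) I) = maxMinor (matB ξ) I := by
  rw [eval_polyMinor]
  congr 1
  ext i j
  simp [varB, matB]

variable (n k₁ k₂) in
/-- The polynomial whose nonvanishing says that all Plücker coordinates of both points are nonzero
and that the torus coordinates are nonzero with distinct squares. -/
noncomputable def disc : MvPolynomial (Coord n k₁ k₂) ℂ :=
  (MvPolynomial.X (Sum.inl (Sum.inr ())) * MvPolynomial.X (Sum.inr (Sum.inr ())) *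
    (MvPolynomial.X (Sum.inl (Sum.inr ())) ^ 2 - MvPolynomial.X (Sum.inr (Sum.inr ())) ^ 2)) *
  ((∏ I ∈ Finset.univ.powersetCard k₁, polyMinor (varA n k₁ k₂) I) *
    ∏ I ∈ Finset.univ.powersetCard k₂, polyMinor (varB n k₁ k₂) I)

theorem eval_disc_ne_zero_iff (ξ : Coord n k₁ k₂ → ℂ) :
    MvPolynomial.eval ξ (disc n k₁ k₂) ≠ 0 ↔
      (torA ξ ≠ 0 ∧ torB ξ ≠ 0 ∧ torA ξ ^ 2 ≠ torB ξ ^ 2) ∧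
      (∀ I : Finset (Fin n), I.card = k₁ → maxMinor (matA ξ) I ≠ 0) ∧
      ∀ I : Finset (Fin n), I.card = k₂ → maxMinor (matB ξ) I ≠ 0 := by
  simp only [disc, map_mul, map_sub, map_pow, MvPolynomial.eval_X, map_prod, eval_polyMinor_varA,
    eval_polyMinor_varB, mul_ne_zero_iff, Finset.prod_ne_zero_iff, Finset.mem_powersetCard,
    Finset.subset_univ, true_and, sub_ne_zero, torA, torB, and_assoc]

theorem reg_repGam_matA (hk₁n : k₁ < n) (i j : Fin n) :
    Reg (disc n k₁ k₂) fun ξ => repGam (matA ξ) (torA ξ) i j := by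
  have h1 : Reg (disc n k₁ k₂) fun ξ => if (k₁ : ℕ) ≤ j ∧ j ≤ i then torA ξ else 1 := by
    split_ifs
    · exact Reg.coord _
    · exact Reg.const 1
  refine h1.mul (Reg.div_of_dvd (Reg.maxMinor (fun a b => Reg.coord _) _)
    (d := polyMinor (varA n k₁ k₂) (baseSet k₁ j)) ?_ fun ξ => (eval_polyMinor_varA ξ _).symm)
  exact ((Finset.dvd_prod_of_mem _ (Finset.mem_powersetCard.2
    ⟨Finset.subset_univ _, card_baseSet hk₁n j⟩)).mul_right _).mul_left _

theorem reg_repGam_matB (hk₂n : k₂ < n) (i j : Fin n) :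
    Reg (disc n k₁ k₂) fun ξ => repGam (matB ξ) (torB ξ) i j := by
  have h1 : Reg (disc n k₁ k₂) fun ξ => if (k₂ : ℕ) ≤ j ∧ j ≤ i then torB ξ else 1 := by
    split_ifs
    · exact Reg.coord _
    · exact Reg.const 1
  refine h1.mul (Reg.div_of_dvd (Reg.maxMinor (fun a b => Reg.coord _) _)
    (d := polyMinor (varB n k₁ k₂) (baseSet k₂ j)) ?_ fun ξ => (eval_polyMinor_varB ξ _).symm)
  exact ((Finset.dvd_prod_of_mem _ (Finset.mem_powersetCard.2
    ⟨Finset.subset_univ _, card_baseSet hk₂n j⟩)).mul_left _).mul_left _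

/-- The signs in the special values depend on the parities of k₁ and k₂; distinct squares of the
torus coordinates cover every case. -/
theorem lam_ne_lam {s t : ℂˣ} (h : (s : ℂ) ^ 2 ≠ (t : ℂ) ^ 2) : lam k₁ s ≠ lam k₂ t := by
  intro h0
  apply h
  have h1 := congrArg (· ^ 2) h0
  simpa [lam, mul_pow, ← pow_mul, mul_comm _ 2] using h1

end Coordinates

/-! ### Nonvanishing of matrix entries -/

section Entries

theorem cyc_notMem_lowSet [NeZero n] (hk : 1 ≤ k) (hkn : k < n) (i : ℤ) :
    cyc n i ∉ lowSet k (cyc n (i - 1)) := by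
  rw [mem_lowSet hk hkn, off_cyc, Int.emod_eq_of_lt] <;> omega

theorem self_notMem_lowSet (hk : 1 ≤ k) (hkn : k < n) (j : Fin n) : j ∉ lowSet k j := by
  rw [mem_lowSet hk hkn, off_of_le le_rfl]
  omega

theorem self_notMem_baseSet (hk : 1 ≤ k) (hkn : k < n) (j : Fin n) : j ∉ baseSet k j := by
  rw [mem_baseSet hk hkn, off_of_le le_rfl]
  omega

theorem repGam_ne_zero (hk : 1 ≤ k) (hkn : k < n) {M : Matrix (Fin n) (Fin k) ℂ} {t : ℂ}
    (ht : t ≠ 0) (h : ∀ I : Finset (Fin n), I.card = k → maxMinor M I ≠ 0) {i j : Fin n}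
    (hij : i ∉ lowSet k j) : repGam M t i j ≠ 0 := by
  refine mul_ne_zero (by split_ifs <;> simp [ht]) (div_ne_zero (h _ ?_) (h _ (card_baseSet hkn j)))
  rw [Finset.card_insert_of_notMem hij, card_lowSet hk hkn]
  omega

/-- Row j occurs neither in the low set nor in the denominator set of column j, so in that column
only the diagonal entry feels the scaling. This supplies the perturbation in `gen_eps_add_phi`. -/
theorem repGam_scale_row (hk : 1 ≤ k) (hkn : k < n) (M : Matrix (Fin n) (Fin k) ℂ) (t c : ℂ)
    (i j : Fin n) :
    repGam (Matrix.of fun a b => (if a = j then c else 1) * M a b) t i j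
      = (if i = j then c else 1) * repGam M t i j := by
  have h1 := self_notMem_lowSet hk hkn j
  have h2 := self_notMem_baseSet hk hkn j
  simp only [repGam, Matrix.of_apply, maxMinor_scale_row, Finset.mem_insert, h1, h2, or_false,
    if_false, one_mul, eq_comm (a := j)]
  ring

end Entries

/-! ### Generic conditions -/

section Generic

/-- Torus coordinates 1 and 2 have distinct squares, so g(u) is invertible at the special value of
the second factor; then B is chosen generic for that invertible matrix. -/
theorem exists_generic_pair (k₁ k₂ : ℕ) (hk₁ : 1 ≤ k₁) (hk₁n : k₁ < n) :
    ∃ ξ : Coord n k₁ k₂ → ℂ, MvPolynomial.eval ξ (disc n k₁ k₂) ≠ 0 ∧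
      ∀ I : Finset (Fin n), I.card = k₂ →
        maxMinor (ev (repGam (matA ξ) (torA ξ)) ((-1) ^ (k₂ - 1) * torB ξ) * matB ξ) I ≠ 0 := by
  obtain ⟨A, hA⟩ := exists_generic_matrix k₁ (G := (1 : Matrix (Fin n) (Fin n) ℂ)) (by simp)
  obtain ⟨I₀, hI₀⟩ : ∃ I₀ : Finset (Fin n), I₀.card = k₁ :=
    ⟨_, card_baseSet hk₁n ⟨0, by omega⟩⟩
  obtain ⟨u, hu, hut⟩ := exists_isRep (hA I₀ hI₀).1 1
  have hug := XX.good_of_maxMinor_ne_zero hu hk₁n fun I hI => (hA I hI).1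
  have hne : ((1 : ℂˣ) : ℂ) ^ 2 ≠ ((Units.mk0 (2 : ℂ) two_ne_zero : ℂˣ) : ℂ) ^ 2 := by
    norm_num
  have hG := det_ev_gam_ne_zero hk₁ hk₁n hug
    (μ := lam k₂ (Units.mk0 (2 : ℂ) two_ne_zero)) (by rw [hut]; exact (lam_ne_lam hne).symm)
  obtain ⟨B, hB⟩ := exists_generic_matrix k₂ hG
  refine ⟨coords A 1 B (Units.mk0 (2 : ℂ) two_ne_zero), ?_, fun I hI => ?_⟩
  · rw [eval_disc_ne_zero_iff]
    exact ⟨⟨one_ne_zero, two_ne_zero, hne⟩, fun I hI => (hA I hI).1, fun I hI => (hB I hI).1⟩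
  · have h1 := (hB I hI).2
    rw [← repGam_eq_gam hu, hut] at h1
    exact h1

theorem gen_baseSet (k₁ k₂ : ℕ) (hk₁ : 1 ≤ k₁) (hk₁n : k₁ < n) (hk₂n : k₂ < n) :
    Gen fun ξ : Coord n k₁ k₂ → ℂ => ∀ j : Fin n, MvPolynomial.eval ξ (disc n k₁ k₂) ≠ 0 ∧
      maxMinor (ev (repGam (matA ξ) (torA ξ)) ((-1) ^ (k₂ - 1) * torB ξ) * matB ξ)
        (baseSet k₂ j) ≠ 0 := by
  obtain ⟨ξ, h1, h2⟩ := exists_generic_pair k₁ k₂ hk₁ hk₁n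
  refine Gen.forall fun j => Reg.gen (Reg.maxMinor (fun a b => ?_) _)
    ⟨ξ, h1, h2 _ (card_baseSet hk₂n j)⟩
  simp only [Matrix.mul_apply]
  refine Reg.sum _ fun l _ => Reg.mul ?_ (Reg.coord _)
  simp only [ev, Matrix.of_apply]
  split_ifs
  · exact reg_repGam_matA hk₁n _ _
  · exact ((Reg.const _).mul (Reg.coord _)).mul (reg_repGam_matA hk₁n _ _)

/-- This is the numerator of α ε_i(u) + φ_i(v) after clearing diagonal entries. If it vanishes at a
generic point, doubling one row of the second matrix changes just one of its two nonzero terms. -/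
theorem gen_eps_add_phi [NeZero n] (hk₁ : 1 ≤ k₁) (hk₁n : k₁ < n) (hk₂ : 1 ≤ k₂) (hk₂n : k₂ < n)
    (i : ℤ) {α : ℂ} (hα : α ≠ 0) :
    Gen fun ξ : Coord n k₁ k₂ → ℂ => MvPolynomial.eval ξ (disc n k₁ k₂) ≠ 0 ∧
      α * (repGam (matA ξ) (torA ξ) (cyc n i) (cyc n (i - 1)) *
        repGam (matB ξ) (torB ξ) (cyc n (i - 1)) (cyc n (i - 1))) +
      repGam (matB ξ) (torB ξ) (cyc n i) (cyc n (i - 1)) *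
        repGam (matA ξ) (torA ξ) (cyc n i) (cyc n i) ≠ 0 := by
  refine Reg.gen (((Reg.const α).mul ((reg_repGam_matA hk₁n _ _).mul
    (reg_repGam_matB hk₂n _ _))).add ((reg_repGam_matB hk₂n _ _).mul
    (reg_repGam_matA hk₁n _ _))) ?_
  obtain ⟨ξ, h1, -⟩ := exists_generic_pair k₁ k₂ hk₁ hk₁n
  by_cases h0 : α * (repGam (matA ξ) (torA ξ) (cyc n i) (cyc n (i - 1)) *
        repGam (matB ξ) (torB ξ) (cyc n (i - 1)) (cyc n (i - 1))) +
      repGam (matB ξ) (torB ξ) (cyc n i) (cyc n (i - 1)) *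
        repGam (matA ξ) (torA ξ) (cyc n i) (cyc n i) = 0
  swap
  · exact ⟨ξ, h1, h0⟩
  rw [eval_disc_ne_zero_iff] at h1
  obtain ⟨⟨hs, ht, hst⟩, hA, hB⟩ := h1
  set p := cyc n (i - 1) with hp
  -- Doubling row p doubles the diagonal entry of g(v) in column p but not the entry below it, and
  -- keeps all Plücker coordinates nonzero.
  set B' : Matrix (Fin n) (Fin k₂) ℂ := Matrix.of fun a b => (if a = p then 2 else 1) * matB ξ a b
    with hB'
  refine ⟨coords (matA ξ) (Units.mk0 _ hs) B' (Units.mk0 _ ht), ?_, ?_⟩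
  · rw [eval_disc_ne_zero_iff]
    refine ⟨⟨hs, ht, hst⟩, hA, fun I hI => ?_⟩
    change maxMinor B' I ≠ 0
    rw [hB', maxMinor_scale_row]
    exact mul_ne_zero (by split_ifs <;> norm_num) (hB I hI)
  · change α * (repGam (matA ξ) (torA ξ) (cyc n i) p * repGam B' (torB ξ) p p) +
      repGam B' (torB ξ) (cyc n i) p * repGam (matA ξ) (torA ξ) (cyc n i) (cyc n i) ≠ 0
    have hpi : cyc n i ≠ p := (cyc_ne_cyc_sub_one (by omega) i).symm
    rw [hB', repGam_scale_row hk₂ hk₂n, repGam_scale_row hk₂ hk₂n, if_pos rfl, if_neg hpi, one_mul]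
    have h2 : α * (repGam (matA ξ) (torA ξ) (cyc n i) p * repGam (matB ξ) (torB ξ) p p) ≠ 0 :=
      mul_ne_zero hα (mul_ne_zero (repGam_ne_zero hk₁ hk₁n hs hA (cyc_notMem_lowSet hk₁ hk₁n i))
        (repGam_ne_zero hk₂ hk₂n ht hB (self_notMem_lowSet hk₂ hk₂n p)))
    intro h3
    apply h2
    linear_combination h3 - h0

theorem Gen.generically {Q : (Coord n k₁ k₂ → ℂ) → Prop} (h : Gen Q)
    {p : XX n k₁ → XX n k₂ → Prop}
    (hp : ∀ (u : XX n k₁) (v : XX n k₂) (A : Matrix (Fin n) (Fin k₁) ℂ)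
      (B : Matrix (Fin n) (Fin k₂) ℂ), u.IsRep A → v.IsRep B → Q (coords A u.t B v.t) → p u v) :
    Generically p := by
  obtain ⟨F, hF, hFQ⟩ := h
  exact ⟨F, hF, fun u v A B hA hB hne => hp u v A B hA hB (hFQ _ hne)⟩

theorem disc_ne_zero (hk₁ : 1 ≤ k₁) (hk₁n : k₁ < n) : disc n k₁ k₂ ≠ 0 := by
  obtain ⟨ξ, h, -⟩ := exists_generic_pair k₁ k₂ hk₁ hk₁n
  intro h0
  rw [h0, map_zero] at h
  exact h rfl

theorem generically_crystal [NeZero n] (hk₁ : 1 ≤ k₁) (hk₁n : k₁ < n) (hk₂ : 1 ≤ k₂)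
    (hk₂n : k₂ < n) (i : ℤ) (c : ℂˣ) :
    Generically fun (u : XX n k₁) (v : XX n k₂) => (u.Good ∧ v.Good) ∧
      lam k₁ u.t ≠ lam k₂ v.t ∧
      (gam u (cyc n i) (cyc n (i - 1)) ≠ 0 ∧ gam v (cyc n i) (cyc n (i - 1)) ≠ 0) ∧
      gam u (cyc n i) (cyc n (i - 1)) / gam u (cyc n i) (cyc n i) +
        gam v (cyc n i) (cyc n (i - 1)) / gam v (cyc n (i - 1)) (cyc n (i - 1)) ≠ 0 ∧
      (c : ℂ) * (gam u (cyc n i) (cyc n (i - 1)) / gam u (cyc n i) (cyc n i)) +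
        gam v (cyc n i) (cyc n (i - 1)) / gam v (cyc n (i - 1)) (cyc n (i - 1)) ≠ 0 ∧
      ∀ j : Fin n, ∀ y ∈ v.N.map (ev (gam u) (lam k₂ v.t)).mulVecLin,
        (∀ i ∈ baseSet k₂ j, y i = 0) → y = 0 := by
  refine ((gen_baseSet k₁ k₂ hk₁ hk₁n hk₂n).and ((gen_eps_add_phi hk₁ hk₁n hk₂ hk₂n i
    one_ne_zero).and (gen_eps_add_phi hk₁ hk₁n hk₂ hk₂n i c.ne_zero))).generically ?_
  rintro u v A B hA hB ⟨h1, ⟨h0, h2⟩, -, h3⟩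
  rw [eval_disc_ne_zero_iff] at h0
  obtain ⟨⟨-, -, hst⟩, hA', hB'⟩ := h0
  change ∀ I : Finset (Fin n), I.card = k₁ → maxMinor A I ≠ 0 at hA'
  change ∀ I : Finset (Fin n), I.card = k₂ → maxMinor B I ≠ 0 at hB'
  have h1' : ∀ j, maxMinor (ev (repGam A u.t) (lam k₂ v.t) * B) (baseSet k₂ j) ≠ 0 :=
    fun j => (h1 j).2
  have hu0 := repGam_ne_zero hk₁ hk₁n u.t.ne_zero hA' (cyc_notMem_lowSet hk₁ hk₁n i)
  have hv0 := repGam_ne_zero hk₂ hk₂n v.t.ne_zero hB' (cyc_notMem_lowSet hk₂ hk₂n i)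
  have hu1 := repGam_ne_zero hk₁ hk₁n u.t.ne_zero hA' (self_notMem_lowSet hk₁ hk₁n (cyc n i))
  have hv1 := repGam_ne_zero hk₂ hk₂n v.t.ne_zero hB' (self_notMem_lowSet hk₂ hk₂n (cyc n (i - 1)))
  have key : ∀ α : ℂ, α * (repGam A u.t (cyc n i) (cyc n (i - 1)) *
        repGam B v.t (cyc n (i - 1)) (cyc n (i - 1))) +
      repGam B v.t (cyc n i) (cyc n (i - 1)) * repGam A u.t (cyc n i) (cyc n i) ≠ 0 →
      α * (gam u (cyc n i) (cyc n (i - 1)) / gam u (cyc n i) (cyc n i)) +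
        gam v (cyc n i) (cyc n (i - 1)) / gam v (cyc n (i - 1)) (cyc n (i - 1)) ≠ 0 := by
    intro α h h'
    apply h
    rw [← repGam_eq_gam hA, ← repGam_eq_gam hB] at h'
    field_simp at h'
    linear_combination h'
  refine ⟨⟨XX.good_of_maxMinor_ne_zero hA hk₁n hA', XX.good_of_maxMinor_ne_zero hB hk₂n hB'⟩,
    lam_ne_lam hst, ⟨repGam_eq_gam hA ▸ hu0, repGam_eq_gam hB ▸ hv0⟩, ?_, key c h3, ?_⟩
  · simpa only [one_mul] using key 1 h2
  -- Vectors of the image of v.N have the form (G * B) w, with G the value of g(u), and the minor of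
  -- G * B on `baseSet k₂ j` is nonzero.
  · rintro j _ ⟨x, hx, rfl⟩ h4
    obtain ⟨w, rfl⟩ := (v.mem_iff hB x).1 hx
    rw [Matrix.mulVecLin_apply, Matrix.mulVec_mulVec] at h4 ⊢
    rw [← repGam_eq_gam hA] at h4 ⊢
    rw [(maxMinor_ne_zero_iff _ (card_baseSet hk₂n j)).1 (h1' j) w h4, Matrix.mulVec_zero]

end Generic

/-! ### The coenergy function -/

theorem isRational_coenergyE (hk₁ : 1 ≤ k₁) (hk₁n : k₁ < n) (hk₂ : 1 ≤ k₂) (hk₂n : k₂ < n) :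
    IsRational (coenergyE : XX n k₁ → XX n k₂ → Part ℂ) := by
  have hkn : min k₁ k₂ < n := (min_le_left _ _).trans_lt hk₁n
  obtain ⟨p, m, hp⟩ : Reg (disc n k₁ k₂) fun ξ =>
      cornerVal hkn (repGam (matA ξ) (torA ξ) * repGam (matB ξ) (torB ξ)) := by
    refine Reg.det fun i j => ?_
    simp only [Matrix.submatrix_apply, Matrix.mul_apply]
    exact Reg.sum _ fun l _ => (reg_repGam_matA hk₁n _ _).mul (reg_repGam_matB hk₂n _ _)
  -- The additional factor `disc` ensures that, even for m = 0, nonvanishing of the denominator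
  -- forces `disc` to be nonzero, hence both points to be good.
  refine ⟨p * disc n k₁ k₂, disc n k₁ k₂ ^ (m + 1), pow_ne_zero _ (disc_ne_zero hk₁ hk₁n), ?_⟩
  intro u v A B hA hB h
  rw [map_pow] at h
  have h0 : MvPolynomial.eval (coords A u.t B v.t) (disc n k₁ k₂) ≠ 0 :=
    fun h' => h (by rw [h', zero_pow (Nat.succ_ne_zero m)])
  have h1 := hp _ h0
  change cornerVal hkn (repGam A u.t * repGam B v.t) * _ = _ at h1
  have h2 := (eval_disc_ne_zero_iff _).1 h0
  rw [coenergyE_eq hk₁ hk₁n hk₂ hk₂n hkn (XX.good_of_maxMinor_ne_zero hA hk₁n h2.2.1)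
    (XX.good_of_maxMinor_ne_zero hB hk₂n h2.2.2), Part.mem_some_iff, map_mul, map_pow, ← h1,
    repGam_eq_gam hA, repGam_eq_gam hB, pow_succ, mul_assoc, mul_div_assoc,
    div_self (mul_ne_zero (pow_ne_zero _ h0) h0), mul_one]

theorem isGeomCoenergy_coenergyE (hk₁ : 1 ≤ k₁) (hk₁n : k₁ < n) (hk₂ : 1 ≤ k₂) (hk₂n : k₂ < n) :
    IsGeomCoenergy (coenergyE : XX n k₁ → XX n k₂ → Part ℂ) := by
  have : NeZero n := ⟨by omega⟩
  refine ⟨isRational_coenergyE hk₁ hk₁n hk₂ hk₂n, fun i hi hin c => ?_, fun c => ?_⟩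
  · have hi0 : ¬ i ≡ 0 [ZMOD n] := by
      rw [Int.modEq_zero_iff_dvd]
      intro h
      have := Int.le_of_dvd (by omega) h
      omega
    obtain ⟨F, hF, h⟩ := generically_crystal hk₁ hk₁n hk₂ hk₂n i c
    refine ⟨F, hF, fun u v A B hA hB hne => ?_⟩
    obtain ⟨⟨hu, hv⟩, -, ⟨hu0, hv0⟩, h1, hc, -⟩ := h u v A B hA hB hne
    obtain ⟨z, hz, hz'⟩ := compE_coenergyE_eq hk₁ hk₁n hk₂ hk₂n hu hv hi0 c hu0 hv0 h1 hc
    exact ⟨z, hz ▸ Part.mem_some z, hz' ▸ Part.mem_some z⟩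
  · obtain ⟨F, hF, h⟩ := generically_crystal hk₁ hk₁n hk₂ hk₂n 0 c
    refine ⟨F, hF, fun u v A B hA hB hne => ?_⟩
    obtain ⟨⟨hu, hv⟩, hlam, ⟨hu0, hv0⟩, h1, hc, hgood⟩ := h u v A B hA hB hne
    exact compE_zero_coenergyE hk₁ hk₁n hk₂ hk₂n hu hv c hu0 hv0 h1 hc hlam hgood

end GeomCrystal

theorem mainTheorem7 (n k₁ k₂ : ℕ) (hk₁ : 1 ≤ k₁) (hk₁n : k₁ < n)
    (hk₂ : 1 ≤ k₂) (hk₂n : k₂ < n) :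
    (∀ (u : GeomCrystal.XX n k₁) (v : GeomCrystal.XX n k₂)
        (A B : Matrix (Fin n) (Fin n) (Polynomial ℂ)),
        A ∈ GeomCrystal.gMat u → B ∈ GeomCrystal.gMat v →
        ∃ z ∈ GeomCrystal.coenergyE u v,
          GeomCrystal.cornerMinor (min k₁ k₂) (A * B) = Polynomial.C z) ∧
    GeomCrystal.IsGeomCoenergy
      (GeomCrystal.coenergyE : GeomCrystal.XX n k₁ → GeomCrystal.XX n k₂ → Part ℂ) := by
  refine ⟨fun u v A B hA hB => ?_,
    GeomCrystal.isGeomCoenergy_coenergyE hk₁ hk₁n hk₂ hk₂n⟩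
  have hkn : min k₁ k₂ < n := (min_le_left _ _).trans_lt hk₁n
  obtain ⟨hu, rfl⟩ := (GeomCrystal.mem_gMat_iff hk₁ hk₁n u A).1 hA
  obtain ⟨hv, rfl⟩ := (GeomCrystal.mem_gMat_iff hk₂ hk₂n v B).1 hB
  refine ⟨_, ?_, GeomCrystal.cornerMinor_fold (le_min hk₁ hk₂) hkn (min_le_left _ _)
    (min_le_right _ _) (GeomCrystal.loop_gam hk₁ hk₁n hu) (GeomCrystal.loop_gam hk₂ hk₂n hv)⟩
  rw [GeomCrystal.coenergyE_eq hk₁ hk₁n hk₂ hk₂n hkn hu hv]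
  exact Part.mem_some _
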